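/- **Conventions.** For a matroid $M$ on a finite set $E$, $P(M)\subset\mathbb R^E$ is its base polytope, the convex hull of the indicator vectors $v_B$ of its bases $B$. Let $\mathcal M$ be the category whose objects are pairs $(E,M)$ with $E$ a finite set and $M$ a matroid on $E$, and whose morphisms $(E,M)\to(E',M')$ are the bijections $\varphi:E\to E'$ with $P(M')\subset\varphi(P(M))$. Let $\mathcal M_{\mathrm{id}}(E)$ be the subcategory with objects the matroids on $E$ and with only the morphisms $\iota_{M,M'}:M\to M'$ given by $\mathrm{id}_E$ (there is one if and only if $P(M')\subset P(M)$), and let $\mathcal M_{\mathrm{id}}^+(E)$ be its $\mathbb Q$-linear additive closure. *Decompositions.* A decomposition of a matroid $M$ on $E$ is a collection $\mathcal N$ of matroids on $E$ such that every nonempty face of $P(N)$, $N\in\mathcal N$, is again $P(N')$ for some $N'\in\mathcal N$; for $N,N'\in\mathcal N$ the intersection $P(N)\cap P(N')$ is a (possibly empty) face of both; and $P(M)=\bigcup_{N\in\mathcal N}P(N)$. Put $d=\dim P(M)$. For $k\le d$ let $\mathcal N_k$ be the set of $N\in\mathcal N$ with $\dim P(N)=k$ and $P(N)\not\subset\partial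 P(M)$ (relative boundary), and let $\mathcal N_{d+1}=\{M\}$. An orientation $\Omega$ of $\mathcal N$ is an arbitrary choice of an orientation of $P(N)$ for every $N\in\mathcal N$, together with an orientation of $P(M)$; an orientation of a polytope $P$ is a ray in the top exterior power of the span of $\{x-y\mid x,y\in P\}$. Let $C^\Omega_\bullet(\mathcal N)$ be the chain complex in $\mathcal M_{\mathrm{id}}^+(E)$ with $C^\Omega_k=\bigoplus_{N\in\mathcal N_k}N$ and the following differential. For $k\le d$, the component from $N\in\mathcal N_k$ to $N'\in\mathcal N_{k-1}$ is $0$ unless $P(N')$ is a facet of $P(N)$, in which case it is $\iota_{N,N'}$ or $-\iota_{N,N'}$ depending on whether or not the orientation of $P(N')$ is the one induced from $P(N)$ by contraction with an outward normal vector. The component from $M\in\mathcal N_{d+1}$ to $N\in\mathcal N_d$ is $\iota_{M,N}$ or $-\iota_{M,N}$ depending on whether or not the orientations of $P(M)$ and $P(N)$ agree. *Valuative invariants.* Fix an abelian group $A$ and let $\mathcal A$ be the category of finite dimensional $A$-graded vector spaces over $\mathbb Q$. A functor $\Phi:\mathcal M\to\mathcal A$ is a valuative categorical invariant if, for every finite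 set $E$, every matroid $M$ on $E$, every decomposition $\mathcal N$ of $M$ and every orientation $\Omega$ of $\mathcal N$, the complex $\Phi(C^\Omega_\bullet(\mathcal N))$ in $\mathcal A$ is contractible. *Relaxation.* Let $M$ be a matroid of rank $k$ on a finite set $E$. A flat $F$ of $M$ is stressed if the restriction of $M$ to $F$ and the contraction of $M$ by $F$ are both uniform matroids. If $F$ is a stressed flat of rank $r$, let $\operatorname{cusp}(F)$ be the set of $k$-element subsets $S\subset E$ with $|S\cap F|=r+1$. The relaxation of $M$ with respect to a set $\mathcal F$ of stressed flats is the matroid whose bases are the bases of $M$ and the elements of $\bigcup_{G\in\mathcal F}\operatorname{cusp}(G)$. Write $U_{d,S}$ for the uniform matroid of rank $d$ on $S$, let $\Pi_{r,k,F,E}$ be the direct sum of $U_{k-r,E\setminus F}$ and $U_{r,F}$, of which $F$ is a stressed flat, and let $\Lambda_{r,k,F,E}$ be the relaxation of $\Pi_{r,k,F,E}$ with respect to $F$. **Proposition 9.4.** Let $\Gamma$ be a finite group acting on a finite set $E$ and preserving a matroid $M$ of rank $k$ on $E$. Let $F$ be a stressed flat of $M$ of rank $r$, let $\Gamma_F\subset\Gamma$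 be the stabilizer of $F$, and let $\tilde M$ be the relaxation of $M$ with respect to $\{\gamma F\mid\gamma\in\Gamma\}$. Then $\Gamma$ preserves $\tilde M$, $\Gamma_F$ preserves $\Pi_{r,k,F,E}$ and $\Lambda_{r,k,F,E}$, and for every valuative categorical invariant $\Phi:\mathcal M\to\mathcal A$ we have $$\Phi(\tilde M)=\Phi(M)+\operatorname{Ind}_{\Gamma_F}^{\Gamma}\Phi(\Lambda_{r,k,F,E})-\operatorname{Ind}_{\Gamma_F}^{\Gamma}\Phi(\Pi_{r,k,F,E})$$ as virtual graded representations of $\Gamma$, that is, in the Grothendieck group of the category of finite dimensional $A$-graded representations of $\Gamma$ over $\mathbb Q$. -/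

import Mathlib

open CategoryTheory CategoryTheory.Limits Module
open scoped Pointwise

noncomputable section

namespace RelaxValuative

/-- A matroid with ground set `E`. -/
structure MatroidOn (E : Type) where
  toMatroid : Matroid E
  ground_eq : toMatroid.E = Set.univ

/-- The uniform matroid `U_{d,S}` of rank `d` on the set `S` (for `d ≤ |S|`). -/
def uniform {E : Type} [Finite E] (d : ℕ) (S : Set E) : Matroid E :=
  (IndepMatroid.ofFinite (E := S) S.toFinite (fun I => I ⊆ S ∧ I.ncard ≤ d)
    ⟨Set.empty_subset S, by simp⟩
    (fun I J hJ hIJ => ⟨hIJ.trans hJ.1, (Set.ncard_le_ncard hIJ J.toFinite).trans hJ.2⟩)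
    (fun I J hI hJ h => by
      obtain ⟨e, he, heI⟩ := Set.exists_mem_notMem_of_ncard_lt_ncard h I.toFinite
      refine ⟨e, he, heI, Set.insert_subset (hJ.1 he) hI.1, ?_⟩
      rw [Set.ncard_insert_of_notMem heI I.toFinite]
      have := hJ.2
      omega)
    (fun I hI => hI.1)).matroid

/-- A matroid is uniform if it is `U_{d,S}`, where `S` is its ground set, for some `d`. -/
def IsUniform {E : Type} [Finite E] (M : Matroid E) : Prop := ∃ d : ℕ, M = uniform d M.E

/-- A stressed flat: the restriction to `F` and the contraction by `F` are both uniform. -/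
structure IsStressedFlat {E : Type} [Finite E] (M : MatroidOn E) (F : Set E) : Prop where
  isFlat : M.toMatroid.IsFlat F
  restrict_uniform : IsUniform (M.toMatroid.restrict F)
  contract_uniform : IsUniform (M.toMatroid.contract F)

/-- For a matroid of rank `k` and a flat `F` of rank `r`, the set of all `k`-element subsets
`S` of the ground set with `|S ∩ F| = r + 1`. -/
def cusp {E : Type} (M : MatroidOn E) (F : Set E) : Set (Set E) :=
  {S | S.encard = M.toMatroid.eRank ∧ (S ∩ F).encard = M.toMatroid.eRk F + 1}

section lemmas

variable {E : Type}

/-- Membership in the family obtained from the bases of `M` by adding all cusps. -/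
def RelaxBase (M : MatroidOn E) (𝓕 : Set (Set E)) (B : Set E) : Prop :=
  M.toMatroid.IsBase B ∨ ∃ F ∈ 𝓕, B ∈ cusp M F

theorem RelaxBase.ncard_eq {M : MatroidOn E} {𝓕 : Set (Set E)} {B B' : Set E}
    (hB : RelaxBase M 𝓕 B) (hB' : RelaxBase M 𝓕 B') : B.ncard = B'.ncard := by
  have : ∀ {C}, RelaxBase M 𝓕 C → C.encard = M.toMatroid.eRank := by
    rintro C (h | ⟨F, -, h⟩)
    · exact h.encard_eq_eRank
    · exact h.1
  rw [Set.ncard, Set.ncard, this hB, this hB']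

variable [Finite E]

theorem uniform_indep {d : ℕ} {S I : Set E} :
    (uniform d S).Indep I ↔ I ⊆ S ∧ I.ncard ≤ d := Iff.rfl

theorem uniform_ground {d : ℕ} {S : Set E} : (uniform d S).E = S := rfl

theorem IsStressedFlat.indep_of_subset {M : MatroidOn E} {F : Set E} (h : IsStressedFlat M F)
    {X : Set E} (hX : X ⊆ F) (hc : X.encard ≤ M.toMatroid.eRk F) : M.toMatroid.Indep X := by
  obtain ⟨d, hd⟩ := h.restrict_uniform
  obtain ⟨I, hI⟩ := M.toMatroid.exists_isBasis F (by rw [M.ground_eq]; exact Set.subset_univ F)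
  have h1 : (M.toMatroid.restrict F).Indep I := by
    rw [Matroid.restrict_indep_iff]; exact ⟨hI.indep, hI.subset⟩
  rw [hd, uniform_indep] at h1
  have h2 : X.ncard ≤ I.ncard := by
    rw [← hI.encard_eq_eRk, ← X.toFinite.cast_ncard_eq, ← I.toFinite.cast_ncard_eq] at hc
    exact_mod_cast hc
  have h3 : (M.toMatroid.restrict F).Indep X := by
    rw [hd, uniform_indep]; exact ⟨by simpa using hX, h2.trans h1.2⟩
  exact (Matroid.restrict_indep_iff.1 h3).1

theorem IsStressedFlat.indep_union {M : MatroidOn E} {F : Set E} (h : IsStressedFlat M F)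
    {I J : Set E} (hI : M.toMatroid.IsBasis I F) (hJ : Disjoint F J)
    (hc : J.encard + M.toMatroid.eRk F ≤ M.toMatroid.eRank) : M.toMatroid.Indep (J ∪ I) := by
  obtain ⟨d, hd⟩ := h.contract_uniform
  obtain ⟨B, hB⟩ := (M.toMatroid.contract F).exists_isBase
  have hBi := hB.indep
  have hBI : M.toMatroid.IsBase (B ∪ I) := by
    have := (hI.contract_indep_iff (J := B)).1 hBi
    obtain ⟨B', hB', hBB'⟩ := this.1.exists_isBase_superset
    have h4 : B' ∩ F = I := by
      refine (hI.eq_of_subset_indep (hB'.indep.inter_right F) ?_ Set.inter_subset_right).symm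
      exact Set.subset_inter (Set.subset_union_right.trans hBB') hI.subset
    have h5 : (M.toMatroid.contract F).Indep (B' \ F) := by
      rw [hI.contract_indep_iff]
      refine ⟨hB'.indep.subset ?_, Set.disjoint_sdiff_right⟩
      exact Set.union_subset Set.sdiff_subset (Set.subset_union_right.trans hBB')
    have h6 : B = B' \ F := hB.eq_of_subset_indep h5
      (Set.subset_sdiff.2 ⟨Set.subset_union_left.trans hBB', this.2.symm⟩)
    have : B ∪ I = B' := by rw [h6, ← h4, Set.sdiff_union_inter]
    rwa [this]
  have hdj := ((hI.contract_indep_iff (J := B)).1 hBi).2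
  have h7 : M.toMatroid.eRank = B.encard + I.encard := by
    rw [← hBI.encard_eq_eRank, Set.encard_union_eq (hdj.mono_left hI.subset).symm]
  rw [h7, ← hI.encard_eq_eRk, ← J.toFinite.cast_ncard_eq, ← I.toFinite.cast_ncard_eq,
    ← B.toFinite.cast_ncard_eq] at hc
  have hc' : J.ncard + I.ncard ≤ B.ncard + I.ncard := by exact_mod_cast hc
  have hJi : (M.toMatroid.contract F).Indep J := by
    rw [hd, uniform_indep] at hBi ⊢
    refine ⟨?_, by omega⟩
    rw [Matroid.contract_ground, M.ground_eq, Set.subset_sdiff]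
    exact ⟨Set.subset_univ J, hJ.symm⟩
  exact ((hI.contract_indep_iff (J := J)).1 hJi).1

theorem IsStressedFlat.indep_of_ssubset {M : MatroidOn E} {G F : Set E} (hG : IsStressedFlat M G)
    (hF : M.toMatroid.IsFlat F) (hFG : F ⊆ G) (hne : F ≠ G) : M.toMatroid.Indep F := by
  rcases le_total F.encard (M.toMatroid.eRk G) with h | h
  · exact hG.indep_of_subset hFG h
  · exfalso
    obtain ⟨X, hXF, hX⟩ := Set.exists_subset_encard_eq h
    have hXi := hG.indep_of_subset (hXF.trans hFG) hX.le
    have hXb : M.toMatroid.IsBasis X G := by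
      refine hXi.isBasis_of_eRk_ge X.toFinite (hXF.trans hFG) ?_
        (by rw [M.ground_eq]; exact Set.subset_univ G)
      rw [hXi.eRk_eq_encard, hX]
    have : G ⊆ F := by
      rw [← hF.closure]
      exact hXb.subset_closure.trans (M.toMatroid.closure_subset_closure hXF)
    exact hne (hFG.antisymm this)

theorem IsStressedFlat.eq_of_cusp {M : MatroidOn E} {F G S : Set E} (hF : IsStressedFlat M F)
    (hG : IsStressedFlat M G) (hS : S.encard = M.toMatroid.eRank)
    (hSF : M.toMatroid.eRk F + 1 ≤ (S ∩ F).encard)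
    (hSG : M.toMatroid.eRk G + 1 ≤ (S ∩ G).encard) : F = G := by
  by_contra hne
  have key : ∀ {H X : Set E}, M.toMatroid.eRk H + 1 ≤ X.encard → X ⊆ H →
      M.toMatroid.Indep X → False := by
    intro H X h1 h2 h3
    have h4 := h1.trans (h3.encard_le_eRk_of_subset h2)
    have h5 : M.toMatroid.eRk H ≠ ⊤ :=
      ((M.toMatroid.eRk_le_encard H).trans_lt H.toFinite.encard_lt_top).ne
    exact absurd h4 (not_le.2 ((ENat.lt_add_one_iff h5).2 le_rfl))
  by_cases hsub : F ⊆ G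
  · exact key hSF Set.inter_subset_right
      ((hG.indep_of_ssubset hF.isFlat hsub hne).inter_left S)
  · have hfl : M.toMatroid.IsFlat (F ∩ G) := by
      rw [Set.inter_eq_iInter]
      refine Matroid.IsFlat.iInter fun b => ?_
      cases b
      · exact hG.isFlat
      · exact hF.isFlat
    have hi : M.toMatroid.Indep (F ∩ G) :=
      hF.indep_of_ssubset hfl Set.inter_subset_left
        (fun h => hsub (Set.inter_eq_left.1 h))
    obtain ⟨I, hI, hFGI⟩ := hi.subset_isBasis_of_subset Set.inter_subset_left
      (by rw [M.ground_eq]; exact Set.subset_univ F)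
    have hJ : M.toMatroid.Indep (((S ∩ G) \ F) ∪ I) := by
      refine hF.indep_union hI Set.disjoint_sdiff_right ?_
      rw [← hS]
      have h1 : (S \ F).encard + (S ∩ F).encard = S.encard := Set.encard_sdiff_add_encard_inter S F
      have h2 : ((S ∩ G) \ F).encard ≤ (S \ F).encard :=
        Set.encard_le_encard (Set.sdiff_subset_sdiff_left Set.inter_subset_left)
      calc ((S ∩ G) \ F).encard + M.toMatroid.eRk F
          ≤ (S \ F).encard + (S ∩ F).encard :=
            add_le_add h2 (le_self_add.trans hSF)
        _ = S.encard := h1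
    refine key hSG Set.inter_subset_right (hJ.subset ?_)
    intro x hx
    by_cases hxF : x ∈ F
    · exact Or.inr (hFGI ⟨hxF, hx.2⟩)
    · exact Or.inl ⟨hx, hxF⟩

theorem relaxBase_exchange {M : MatroidOn E} {𝓕 : Set (Set E)}
    (h𝓕 : ∀ F ∈ 𝓕, IsStressedFlat M F) : Matroid.ExchangeProperty (RelaxBase M 𝓕) := by
  classical
  intro B₁ B₂ h₁ h₂ e he
  have hcard := h₁.ncard_eq h₂
  obtain ⟨B₀, hB₀⟩ := M.toMatroid.exists_isBase
  have hk : ∀ C : Set E, C.encard = M.toMatroid.eRank ↔ C.ncard = B₀.ncard := by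
    intro C
    rw [← hB₀.encard_eq_eRank, ← C.toFinite.cast_ncard_eq, ← B₀.toFinite.cast_ncard_eq]
    exact_mod_cast Iff.rfl
  have hB₁k : B₁.ncard = B₀.ncard := h₁.ncard_eq (Or.inl hB₀)
  have hB₂k : B₂.ncard = B₀.ncard := h₂.ncard_eq (Or.inl hB₀)
  have hins : ∀ f ∈ B₂ \ B₁, (insert f (B₁ \ {e})).ncard = B₀.ncard := by
    intro f hf
    rw [Set.ncard_insert_of_notMem (fun h => hf.2 h.1) (Set.toFinite _),
      Set.ncard_sdiff_singleton_of_mem he.1]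
    have := (Set.ncard_pos B₁.toFinite).2 ⟨e, he.1⟩
    omega
  have hsplit : ∀ X F : Set E, (X \ F).ncard + (X ∩ F).ncard = X.ncard := by
    intro X F
    rw [add_comm]; exact Set.ncard_inter_add_ncard_sdiff_eq_ncard X F X.toFinite
  have hbasis : ∀ F, ∃ I, M.toMatroid.IsBasis I F := fun F =>
    M.toMatroid.exists_isBasis F (by rw [M.ground_eq]; exact Set.subset_univ F)
  have hbase : ∀ {C : Set E}, M.toMatroid.Indep C → C.ncard = B₀.ncard → M.toMatroid.IsBase C := by
    intro C hC h
    refine hC.isBase_of_eRk_ge C.toFinite ?_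
    rw [hC.eRk_eq_encard, (hk C).2 h]
  have hcusp : ∀ {F I}, M.toMatroid.IsBasis I F → ∀ C, C ∈ cusp M F ↔
      C.ncard = B₀.ncard ∧ (C ∩ F).ncard = I.ncard + 1 := by
    intro F I hI C
    rw [cusp, Set.mem_ofPred_eq, hk, ← hI.encard_eq_eRk, ← (C ∩ F).toFinite.cast_ncard_eq,
      ← I.toFinite.cast_ncard_eq]
    exact_mod_cast Iff.rfl
  have hle : ∀ {F I}, F ∈ 𝓕 → M.toMatroid.IsBasis I F → ∀ C, RelaxBase M 𝓕 C →
      (C ∩ F).ncard ≤ I.ncard + 1 := by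
    intro F I hF hI C hC
    by_contra hlt
    push Not at hlt
    have hlt' : M.toMatroid.eRk F + 1 ≤ (C ∩ F).encard := by
      rw [← hI.encard_eq_eRk, ← (C ∩ F).toFinite.cast_ncard_eq, ← I.toFinite.cast_ncard_eq]
      exact_mod_cast hlt.le
    rcases hC with hC | ⟨G, hG, hC⟩
    · have h3 := (hC.indep.inter_right F).encard_le_eRk_of_subset Set.inter_subset_right
      rw [← hI.encard_eq_eRk, ← (C ∩ F).toFinite.cast_ncard_eq,
        ← I.toFinite.cast_ncard_eq] at h3
      have h4 : (C ∩ F).ncard ≤ I.ncard := by exact_mod_cast h3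
      omega
    · have := (h𝓕 F hF).eq_of_cusp (h𝓕 G hG) hC.1 hlt' hC.2.ge
      subst this
      have := ((hcusp hI C).1 hC).2
      omega
  -- a set of the right size meeting `F` in a set of size `r` is a basis of `M`
  have hPi : ∀ {F I}, F ∈ 𝓕 → M.toMatroid.IsBasis I F → ∀ C : Set E, C.ncard = B₀.ncard →
      (C ∩ F).ncard = I.ncard → M.toMatroid.IsBase C := by
    intro F I hF hI C hC hCF
    have hS := h𝓕 F hF
    have hi : M.toMatroid.Indep (C ∩ F) := by
      refine hS.indep_of_subset Set.inter_subset_right ?_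
      rw [← hI.encard_eq_eRk, ← (C ∩ F).toFinite.cast_ncard_eq, ← I.toFinite.cast_ncard_eq, hCF]
    have hb : M.toMatroid.IsBasis (C ∩ F) F := by
      refine hi.isBasis_of_eRk_ge (Set.toFinite _) Set.inter_subset_right ?_
      rw [hi.eRk_eq_encard, ← hI.encard_eq_eRk, ← (C ∩ F).toFinite.cast_ncard_eq,
        ← I.toFinite.cast_ncard_eq, hCF]
    have hu := hS.indep_union (J := C \ F) hb Set.disjoint_sdiff_right (by
      rw [← hb.encard_eq_eRk, Set.encard_sdiff_add_encard_inter, (hk C).2 hC])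
    rw [Set.sdiff_union_inter] at hu
    exact hbase hu hC
  have hne : ∃ f, f ∈ B₂ \ B₁ := by
    by_contra hcon
    push Not at hcon
    have hs : B₂ ⊆ B₁ := fun x hx => by
      by_contra hx1
      exact hcon x ⟨hx, hx1⟩
    have := Set.eq_of_subset_of_ncard_le hs (by omega) B₁.toFinite
    exact he.2 (this ▸ he.1)
  have hins_notMem : ∀ (F : Set E) f, f ∉ F →
      insert f (B₁ \ {e}) ∩ F = (B₁ \ {e}) ∩ F := by
    intro F f hf
    rw [Set.insert_inter_of_notMem hf]
  have hins_mem : ∀ (F : Set E) f, f ∈ B₂ \ B₁ → f ∈ F →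
      (insert f (B₁ \ {e}) ∩ F).ncard = ((B₁ \ {e}) ∩ F).ncard + 1 := by
    intro F f hf hfF
    rw [Set.insert_inter_of_mem hfF, Set.ncard_insert_of_notMem (fun h => hf.2 h.1.1) (Set.toFinite _)]
  have hdel_mem : ∀ F : Set E, e ∈ F → ((B₁ \ {e}) ∩ F).ncard + 1 = (B₁ ∩ F).ncard := by
    intro F heF
    have : (B₁ \ {e}) ∩ F = (B₁ ∩ F) \ {e} := by ext; simp; tauto
    rw [this]
    exact Set.ncard_sdiff_singleton_add_one ⟨he.1, heF⟩ (Set.toFinite _)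
  have hdel_notMem : ∀ F : Set E, e ∉ F → (B₁ \ {e}) ∩ F = B₁ ∩ F := by
    intro F heF
    ext x
    simp only [Set.mem_inter_iff, Set.mem_sdiff, Set.mem_singleton_iff]
    constructor
    · tauto
    · rintro ⟨h1, h2⟩
      exact ⟨⟨h1, fun h => heF (h ▸ h2)⟩, h2⟩
  rcases h₁ with h₁ | ⟨F, hF, h₁⟩
  · rcases h₂ with h₂ | ⟨F, hF, h₂⟩
    · obtain ⟨f, hf, hfB⟩ := h₁.exchange h₂ he
      exact ⟨f, hf, Or.inl hfB⟩
    · -- `B₁` is a basis of `M` and `B₂` lies in the cusp of `F`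
      obtain ⟨I, hI⟩ := hbasis F
      have hS := h𝓕 F hF
      have h₂' := (hcusp hI B₂).1 h₂
      by_contra hcon
      push Not at hcon
      set H := M.toMatroid.closure (B₁ \ {e}) with hH
      have hCi : M.toMatroid.Indep (B₁ \ {e}) := h₁.indep.subset Set.sdiff_subset
      have hsub : B₂ ⊆ H := by
        intro f hf
        by_cases hfB : f ∈ B₁
        · exact M.toMatroid.subset_closure _ (by rw [M.ground_eq]; exact Set.subset_univ _)
            ⟨hfB, fun h => he.2 (h ▸ hf)⟩
        · by_contra hfH
          apply hcon f ⟨hf, hfB⟩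
          left
          have : M.toMatroid.Indep (insert f (B₁ \ {e})) := by
            rw [hCi.insert_indep_iff]
            exact Or.inl ⟨by rw [M.ground_eq]; exact Set.mem_univ f, hfH⟩
          exact hbase this (hins f ⟨hf, hfB⟩)
      obtain ⟨X, hXB, hX⟩ := Set.exists_subset_card_eq (s := B₂ ∩ F) (n := I.ncard) (by omega)
      have hXe : X.encard = M.toMatroid.eRk F := by
        rw [← hI.encard_eq_eRk, ← X.toFinite.cast_ncard_eq, ← I.toFinite.cast_ncard_eq, hX]
      have hXi := hS.indep_of_subset (hXB.trans Set.inter_subset_right) hXe.le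
      have hXb : M.toMatroid.IsBasis X F := by
        refine hXi.isBasis_of_eRk_ge X.toFinite (hXB.trans Set.inter_subset_right) ?_
        rw [hXi.eRk_eq_encard, hXe]
      have hFH : F ⊆ H := by
        refine hXb.subset_closure.trans ?_
        rw [hH, ← M.toMatroid.closure_closure (B₁ \ {e})]
        exact M.toMatroid.closure_subset_closure ((hXB.trans Set.inter_subset_left).trans hsub)
      have hCF : ((B₁ \ {e}) ∩ F).ncard ≤ I.ncard := by
        have h3 := (hCi.inter_right F).encard_le_eRk_of_subset Set.inter_subset_right
        rw [← hI.encard_eq_eRk, ← (B₁ \ {e} ∩ F).toFinite.cast_ncard_eq,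
          ← I.toFinite.cast_ncard_eq] at h3
        exact_mod_cast h3
      have hBpos := (Set.ncard_pos B₁.toFinite).2 ⟨e, he.1⟩
      have hCcard : (B₁ \ {e}).ncard + 1 = B₀.ncard := by
        rw [Set.ncard_sdiff_singleton_add_one he.1 B₁.toFinite]; omega
      rcases hCF.eq_or_lt with hCF | hCF
      · have hlt : ((B₁ \ {e}) ∩ F).ncard < (B₂ ∩ F).ncard := by omega
        obtain ⟨f, hf, hfC⟩ := Set.exists_mem_notMem_of_ncard_lt_ncard hlt (Set.toFinite _)
        have hfB : f ∉ B₁ := fun h => hfC ⟨⟨h, fun h' => he.2 (h' ▸ hf.1)⟩, hf.2⟩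
        apply hcon f ⟨hf.1, hfB⟩
        refine Or.inr ⟨F, hF, (hcusp hI _).2 ⟨hins f ⟨hf.1, hfB⟩, ?_⟩⟩
        rw [hins_mem F f ⟨hf.1, hfB⟩ hf.2, hCF]
      · -- there is a set `J ⊆ (B₁ \ {e}) \ F` of size `k - r`, which together with a basis of `F`
        -- is a basis of `M` contained in the hyperplane `H`
        have h5 := hsplit (B₁ \ {e}) F
        have h6 : I.ncard ≤ B₀.ncard := by
          rw [← h₂'.1]
          have := Set.ncard_le_ncard (Set.inter_subset_left : B₂ ∩ F ⊆ B₂) B₂.toFinite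
          omega
        obtain ⟨J, hJC, hJ⟩ := Set.exists_subset_card_eq (s := (B₁ \ {e}) \ F)
          (n := B₀.ncard - I.ncard) (by omega)
        have hdj : Disjoint F J := (Set.subset_sdiff.1 hJC).2.symm
        have hJI := hS.indep_union hI hdj (by
          rw [← hI.encard_eq_eRk, ← hB₀.encard_eq_eRank, ← J.toFinite.cast_ncard_eq,
            ← I.toFinite.cast_ncard_eq, ← B₀.toFinite.cast_ncard_eq]
          exact_mod_cast (by omega : J.ncard + I.ncard ≤ B₀.ncard))
        have h7 : (J ∪ I).ncard = B₀.ncard := by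
          rw [Set.ncard_union_eq (hdj.mono_left hI.subset).symm J.toFinite I.toFinite]
          omega
        have h8 : J ∪ I ⊆ H := by
          refine Set.union_subset ?_ (hI.subset.trans hFH)
          exact (hJC.trans Set.sdiff_subset).trans
            (M.toMatroid.subset_closure _ (by rw [M.ground_eq]; exact Set.subset_univ _))
        have h9 := hJI.encard_le_eRk_of_subset h8
        rw [hH, M.toMatroid.eRk_closure_eq, hCi.eRk_eq_encard, ← (J ∪ I).toFinite.cast_ncard_eq,
          ← (B₁ \ {e}).toFinite.cast_ncard_eq] at h9
        have h10 : (J ∪ I).ncard ≤ (B₁ \ {e}).ncard := by exact_mod_cast h9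
        omega
  · -- `B₁` lies in the cusp of `F`
    obtain ⟨I, hI⟩ := hbasis F
    have h₁' := (hcusp hI B₁).1 h₁
    by_cases heF : e ∈ F
    · obtain ⟨f, hf⟩ := hne
      refine ⟨f, hf, ?_⟩
      have h3 := hdel_mem F heF
      by_cases hfF : f ∈ F
      · refine Or.inr ⟨F, hF, (hcusp hI _).2 ⟨hins f hf, ?_⟩⟩
        rw [hins_mem F f hf hfF]; omega
      · refine Or.inl (hPi hF hI _ (hins f hf) ?_)
        rw [hins_notMem F f hfF]; omega
    · have : ∃ f ∈ B₂ \ B₁, f ∉ F := by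
        by_contra hcon
        push Not at hcon
        have hsub : B₂ \ F ⊆ (B₁ \ F) \ {e} := by
          intro x hx
          refine ⟨⟨?_, hx.2⟩, fun h => he.2 (h ▸ hx.1)⟩
          by_contra hx1
          exact hx.2 (hcon x ⟨hx.1, hx1⟩)
        have h3 := Set.ncard_le_ncard hsub (Set.toFinite _)
        have h4 := Set.ncard_sdiff_singleton_add_one (s := B₁ \ F) ⟨he.1, heF⟩ (Set.toFinite _)
        have h5 := hsplit B₁ F
        have h6 := hsplit B₂ F
        have h7 := hle hF hI B₂ h₂
        omega
      obtain ⟨f, hf, hfF⟩ := this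
      refine ⟨f, hf, Or.inr ⟨F, hF, (hcusp hI _).2 ⟨hins f hf, ?_⟩⟩⟩
      rw [hins_notMem F f hfF, hdel_notMem F heF]
      exact h₁'.2

end lemmas


/-! ### Group actions -/

section action

variable {E : Type}

/-- The group `Γ` acting on `E` preserves the matroid `M`. -/
def IsInvariant (Γ : Type) [Group Γ] [MulAction Γ E] (M : MatroidOn E) : Prop :=
  ∀ (γ : Γ) (B : Set E), M.toMatroid.IsBase B → M.toMatroid.IsBase (γ • B)

variable {Γ : Type} [Group Γ] [MulAction Γ E]

theorem IsInvariant.indep {M : MatroidOn E} (hM : IsInvariant Γ M) (γ : Γ) {I : Set E}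
    (hI : M.toMatroid.Indep I) : M.toMatroid.Indep (γ • I) := by
  obtain ⟨B, hB, hIB⟩ := hI.exists_isBase_superset
  exact (hM γ B hB).indep.subset (Set.smul_set_mono hIB)

theorem IsInvariant.indep_iff {M : MatroidOn E} (hM : IsInvariant Γ M) (γ : Γ) {I : Set E} :
    M.toMatroid.Indep (γ • I) ↔ M.toMatroid.Indep I :=
  ⟨fun h => by simpa using hM.indep γ⁻¹ h, hM.indep γ⟩

theorem isInvariant_of_indep {M : MatroidOn E}
    (h : ∀ (γ : Γ) (I : Set E), M.toMatroid.Indep I → M.toMatroid.Indep (γ • I)) :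
    IsInvariant Γ M := by
  intro γ B hB
  obtain ⟨B', hB', hsub⟩ := (h γ B hB.indep).exists_isBase_superset
  have h1 : B = γ⁻¹ • B' := hB.eq_of_subset_indep (h γ⁻¹ B' hB'.indep)
    (Set.subset_smul_set_iff.2 (by simpa using hsub))
  have h2 : γ • B = B' := by rw [h1]; simp
  rwa [h2]

theorem IsInvariant.isBasis {M : MatroidOn E} (hM : IsInvariant Γ M) (γ : Γ) {I X : Set E}
    (h : M.toMatroid.IsBasis I X) : M.toMatroid.IsBasis (γ • I) (γ • X) := by
  refine (hM.indep γ h.indep).isBasis_of_forall_insert (Set.smul_set_mono h.subset) ?_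
  rintro e ⟨he, heI⟩
  obtain ⟨x, hx, rfl⟩ := he
  have hxI : x ∉ I := fun hxI => heI (Set.smul_mem_smul_set hxI)
  have hd := h.insert_dep ⟨hx, hxI⟩
  rw [← Matroid.not_indep_iff (by rw [M.ground_eq]; exact Set.subset_univ _)] at hd ⊢
  have : insert (γ • x) (γ • I) = γ • insert x I := by
    ext y
    simp [Set.mem_smul_set_iff_inv_smul_mem, inv_smul_eq_iff]
  intro hcon
  exact hd ((hM.indep_iff γ).1 (this ▸ hcon))

theorem IsInvariant.eRk_smul {M : MatroidOn E} (hM : IsInvariant Γ M) (γ : Γ) (X : Set E) :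
    M.toMatroid.eRk (γ • X) = M.toMatroid.eRk X := by
  obtain ⟨I, hI⟩ := M.toMatroid.exists_isBasis X (by rw [M.ground_eq]; exact Set.subset_univ X)
  rw [← hI.encard_eq_eRk, ← (hM.isBasis γ hI).encard_eq_eRk, Set.encard_smul_set]

theorem IsInvariant.smul_mem_cusp {M : MatroidOn E} (hM : IsInvariant Γ M) (γ : Γ) {F S : Set E}
    (hS : S ∈ cusp M F) : γ • S ∈ cusp M (γ • F) := by
  refine ⟨?_, ?_⟩
  · rw [Set.encard_smul_set]; exact hS.1
  · rw [← Set.smul_set_inter, Set.encard_smul_set, hM.eRk_smul]; exact hS.2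

theorem uniform_smul_indep [Finite E] {d : ℕ} {S I : Set E} (γ : Γ) :
    (uniform d (γ • S)).Indep I ↔ (uniform d S).Indep (γ⁻¹ • I) := by
  rw [uniform_indep, uniform_indep, Set.ncard_smul_set]
  refine and_congr_left' ?_
  rw [Set.subset_smul_set_iff]

/-- Translates of a stressed flat of an invariant matroid are stressed flats. -/
theorem IsStressedFlat.smul [Finite E] {M : MatroidOn E} (hM : IsInvariant Γ M) {F : Set E}
    (hF : IsStressedFlat M F) (γ : Γ) : IsStressedFlat M (γ • F) := by
  have hg : ∀ X : Set E, X ⊆ M.toMatroid.E := fun X => by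
    rw [M.ground_eq]; exact Set.subset_univ X
  refine ⟨⟨?_, hg _⟩, ?_, ?_⟩
  · intro I X hI hX
    have h1 := hM.isBasis γ⁻¹ hI
    rw [inv_smul_smul] at h1
    exact Set.subset_smul_set_iff.2
      (hF.isFlat.subset_of_isBasis_of_isBasis h1 (hM.isBasis γ⁻¹ hX))
  · obtain ⟨d, hd⟩ := hF.restrict_uniform
    refine ⟨d, Matroid.ext_indep rfl fun I _ => ?_⟩
    rw [Matroid.restrict_ground_eq] at hd ⊢
    rw [uniform_smul_indep, ← hd, Matroid.restrict_indep_iff, Matroid.restrict_indep_iff,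
      hM.indep_iff, Set.subset_smul_set_iff]
  · obtain ⟨d, hd⟩ := hF.contract_uniform
    obtain ⟨I, hI⟩ := M.toMatroid.exists_isBasis F (hg F)
    have hgr : (M.toMatroid.contract (γ • F)).E = γ • (M.toMatroid.contract F).E := by
      rw [Matroid.contract_ground, Matroid.contract_ground, M.ground_eq, Set.smul_set_sdiff,
        Set.smul_set_univ]
    refine ⟨d, Matroid.ext_indep rfl fun J _ => ?_⟩
    rw [hgr, uniform_smul_indep, ← hd, (hM.isBasis γ hI).contract_indep_iff,
      hI.contract_indep_iff, ← hM.indep_iff γ⁻¹, Set.smul_set_union, inv_smul_smul]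
    refine and_congr_right' ?_
    rw [← Set.disjoint_smul_set (a := γ⁻¹), inv_smul_smul]

end action

/-! ### Relaxation -/

section relaxation

variable {E : Type} [Finite E]

/-- The relaxation of `M` with respect to a family `𝓕` of stressed flats: its bases are the bases
of `M` together with the elements of the cusps of the members of `𝓕`. -/
def relax (M : MatroidOn E) (𝓕 : Set (Set E)) (h𝓕 : ∀ F ∈ 𝓕, IsStressedFlat M F) :
    MatroidOn E where
  toMatroid := Matroid.ofIsBaseOfFinite (E := Set.univ) Set.finite_univ (RelaxBase M 𝓕)
    (M.toMatroid.exists_isBase.imp fun _ hB => Or.inl hB) (relaxBase_exchange h𝓕)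
    (fun _ _ => Set.subset_univ _)
  ground_eq := rfl

theorem uniform_disjoint (d r : ℕ) (F : Set E) :
    Disjoint (uniform d Fᶜ).E (uniform r F).E := by
  rw [uniform_ground, uniform_ground]
  exact disjoint_compl_left

/-- `Π_{r,k,F,E}`, the direct sum of `U_{k-r,E∖F}` and `U_{r,F}`. -/
def piMatroid (r k : ℕ) (F : Set E) : MatroidOn E where
  toMatroid := (uniform (k - r) Fᶜ).disjointSum (uniform r F) (uniform_disjoint _ _ _)
  ground_eq := by
    rw [Matroid.disjointSum_ground_eq, uniform_ground, uniform_ground, Set.compl_union_self]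

/-- `Λ_{r,k,F,E}`, the relaxation of `Π_{r,k,F,E}` with respect to its stressed flat `F`. -/
def lambdaMatroid (r k : ℕ) (F : Set E) (hF : IsStressedFlat (piMatroid r k F) F) :
    MatroidOn E :=
  relax (piMatroid r k F) {F} (by rintro _ rfl; exact hF)

theorem piMatroid_indep {r k : ℕ} {F I : Set E} : (piMatroid r k F).toMatroid.Indep I ↔
    (I ∩ Fᶜ).ncard ≤ k - r ∧ (I ∩ F).ncard ≤ r := by
  rw [piMatroid, Matroid.disjointSum_indep_iff, uniform_ground, uniform_ground, uniform_indep,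
    uniform_indep, Set.compl_union_self]
  simp

/-- If `F` is a stressed flat of rank `r` of some matroid of rank `k` on `E`,
then `F` is a stressed flat of `Π_{r,k,F,E}`. -/
theorem IsStressedFlat.piMatroid {M : MatroidOn E} {F : Set E} (hF : IsStressedFlat M F)
    {r k : ℕ} (hr : M.toMatroid.eRk F = r) (hk : M.toMatroid.eRank = k) :
    IsStressedFlat (piMatroid r k F) F := by
  have hg : ∀ X : Set E, X ⊆ (RelaxValuative.piMatroid r k F).toMatroid.E := fun X => by
    rw [MatroidOn.ground_eq]; exact Set.subset_univ X
  have hfin : ∀ X : Set E, (X.ncard : ℕ∞) = X.encard := fun X => X.toFinite.cast_ncard_eq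
  have hFr : r ≤ F.ncard := by
    have := M.toMatroid.eRk_le_encard F
    rw [hr, ← hfin] at this
    exact_mod_cast this
  have hbasis : ∀ I, (RelaxValuative.piMatroid r k F).toMatroid.IsBasis I F → I.ncard = r := by
    intro I hI
    have h1 := (piMatroid_indep.1 hI.indep).2
    rw [Set.inter_eq_left.2 hI.subset] at h1
    obtain ⟨X, hIX, hXF, hX⟩ := Set.exists_subsuperset_card_eq hI.subset h1 hFr
    have h2 : (RelaxValuative.piMatroid r k F).toMatroid.Indep X := by
      rw [piMatroid_indep, Set.inter_eq_left.2 hXF, hX]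
      refine ⟨?_, le_rfl⟩
      rw [(Set.disjoint_compl_right_iff_subset.2 hXF).inter_eq]
      simp
    rw [hI.eq_of_subset_indep h2 hIX hXF, hX]
  have hlt : ∀ e, e ∉ F → r < k := by
    intro e he
    obtain ⟨I, hI⟩ := M.toMatroid.exists_isBasis F (by rw [M.ground_eq]; exact Set.subset_univ F)
    have hei : M.toMatroid.Indep (insert e I) := by
      rw [hI.indep.insert_indep_iff]
      refine Or.inl ⟨by rw [M.ground_eq]; exact Set.mem_univ e, ?_⟩
      rw [hI.closure_eq_closure, hF.isFlat.closure]
      exact he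
    have h1 := hei.encard_le_eRank
    rw [Set.encard_insert_of_notMem (fun h => he (hI.subset h)), hI.encard_eq_eRk, hr, hk] at h1
    have h2 : r + 1 ≤ k := by exact_mod_cast h1
    omega
  refine ⟨⟨?_, hg F⟩, ⟨r, ?_⟩, ⟨k - r, ?_⟩⟩
  · intro I X hI hX e heX
    by_contra he
    have h1 : (RelaxValuative.piMatroid r k F).toMatroid.Indep (insert e I) := by
      rw [piMatroid_indep, Set.insert_inter_of_notMem he, Set.inter_eq_left.2 hI.subset,
        hbasis I hI]
      refine ⟨?_, le_rfl⟩
      have : insert e I ∩ Fᶜ ⊆ {e} := by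
        rintro x ⟨hx | hx, hxF⟩
        · exact hx
        · exact absurd (hI.subset hx) hxF
      have h3 := Set.ncard_le_ncard this
      rw [Set.ncard_singleton] at h3
      have := hlt e he
      omega
    exact he (hI.subset (hX.mem_of_insert_indep heX h1))
  · refine Matroid.ext_indep rfl fun I hI => ?_
    rw [Matroid.restrict_ground_eq] at hI ⊢
    rw [Matroid.restrict_indep_iff, uniform_indep, piMatroid_indep, Set.inter_eq_left.2 hI,
      (Set.disjoint_compl_right_iff_subset.2 hI).inter_eq]
    simp [hI]
  · refine Matroid.ext_indep rfl fun J hJ => ?_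
    obtain ⟨I, hI⟩ := (RelaxValuative.piMatroid r k F).toMatroid.exists_isBasis F (hg F)
    have hJF : Disjoint F J := (Set.subset_sdiff.1 hJ).2.symm
    rw [hI.contract_indep_iff, and_iff_left hJF, uniform_indep, and_iff_right hJ,
      piMatroid_indep, Set.union_inter_distrib_right, Set.union_inter_distrib_right,
      hJF.symm.inter_eq, Set.inter_eq_left.2 hI.subset,
      (Set.disjoint_compl_right_iff_subset.2 hI.subset).inter_eq, Set.union_empty,
      Set.empty_union, hbasis I hI, Set.inter_eq_left.2 (Set.subset_compl_iff_disjoint_left.2 hJF)]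
    simp

variable {Γ : Type} [Group Γ] [MulAction Γ E]

theorem IsInvariant.relax {M : MatroidOn E} (hM : IsInvariant Γ M) {𝓕 : Set (Set E)}
    (h𝓕 : ∀ F ∈ 𝓕, IsStressedFlat M F) (hΓ : ∀ (γ : Γ), ∀ F ∈ 𝓕, γ • F ∈ 𝓕) :
    IsInvariant Γ (relax M 𝓕 h𝓕) := by
  rintro γ B (hB | ⟨F, hF, hB⟩)
  · exact Or.inl (hM γ B hB)
  · exact Or.inr ⟨γ • F, hΓ γ F hF, hM.smul_mem_cusp γ hB⟩

theorem isInvariant_piMatroid (r k : ℕ) (F : Set E) :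
    IsInvariant (MulAction.stabilizer Γ F) (piMatroid r k F) := by
  refine isInvariant_of_indep fun γ I hI => ?_
  have hγ : γ • F = F := γ.2
  have hγc : γ • Fᶜ = Fᶜ := by rw [Set.smul_set_compl, hγ]
  rw [piMatroid_indep] at hI ⊢
  have h1 : γ • I ∩ Fᶜ = γ • (I ∩ Fᶜ) := by rw [Set.smul_set_inter, hγc]
  have h2 : γ • I ∩ F = γ • (I ∩ F) := by rw [Set.smul_set_inter, hγ]
  rwa [h1, h2, Set.ncard_smul_set, Set.ncard_smul_set]

theorem isInvariant_lambdaMatroid {r k : ℕ} {F : Set E}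
    (hF : IsStressedFlat (piMatroid r k F) F) :
    IsInvariant (MulAction.stabilizer Γ F) (lambdaMatroid r k F hF) :=
  (isInvariant_piMatroid r k F).relax _ (by
    rintro γ _ rfl
    exact γ.2)

/-- The relaxation of a `Γ`-invariant matroid `M` with respect to all the translates `γF` of a
stressed flat `F`. -/
def relaxOrbit {M : MatroidOn E} (hM : IsInvariant Γ M) {F : Set E}
    (hF : IsStressedFlat M F) : MatroidOn E :=
  relax M (MulAction.orbit Γ F) (by rintro _ ⟨γ, rfl⟩; exact hF.smul hM γ)

theorem isInvariant_relaxOrbit {M : MatroidOn E} (hM : IsInvariant Γ M) {F : Set E}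
    (hF : IsStressedFlat M F) : IsInvariant Γ (relaxOrbit hM hF) :=
  hM.relax _ (by
    rintro γ _ ⟨δ, rfl⟩
    exact ⟨γ * δ, mul_smul γ δ F⟩)

end relaxation

/-! ### Base polytopes and categories of matroids -/

section categories

/-- The base polytope of `M`: the convex hull in `ℝ^E` of the vectors `v_B`, `B` a basis. -/
def basePolytope {E : Type} (M : MatroidOn E) : Set (E → ℝ) :=
  convexHull ℝ {v | ∃ B, M.toMatroid.IsBase B ∧ v = B.indicator 1}

/-- The linear map `ℝ^E → ℝ^E'` induced by a bijection `φ : E → E'`; it sends the basis vector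
`v_e` to `v_{φ(e)}`. -/
def permute {E E' : Type} (φ : E ≃ E') : (E → ℝ) →ₗ[ℝ] (E' → ℝ) :=
  LinearMap.funLeft ℝ ℝ φ.symm

/-- The objects of the category `𝓜` of matroids: finite sets with a matroid on them. -/
structure MatroidCat : Type 1 where
  carrier : Type
  [finite : Finite carrier]
  matroid : MatroidOn carrier

attribute [instance] MatroidCat.finite

namespace MatroidCat

/-- The morphisms of `𝓜` (weak maps): bijections `φ` with `P(M') ⊆ φ(P(M))`. -/
@[ext]
structure Hom (M M' : MatroidCat) where
  toEquiv : M.carrier ≃ M'.carrier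
  subset : basePolytope M'.matroid ⊆ permute toEquiv '' basePolytope M.matroid

instance : Category MatroidCat where
  Hom := Hom
  id M := ⟨Equiv.refl _, fun x hx => ⟨x, hx, rfl⟩⟩
  comp f g := ⟨f.toEquiv.trans g.toEquiv, fun x hx => by
    obtain ⟨y, hy, rfl⟩ := g.subset hx
    obtain ⟨z, hz, rfl⟩ := f.subset hy
    exact ⟨z, hz, rfl⟩⟩

end MatroidCat

/-- The objects of the category `𝓜_id(E)`: matroids on `E`. -/
structure MatroidId (E : Type) : Type 1 where
  matroid : MatroidOn E

/-- In `𝓜_id(E)` there is exactly one morphism `M → M'` if `P(M') ⊆ P(M)`, and none otherwise. -/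
instance {E : Type} : Category (MatroidId E) where
  Hom M M' := PLift (basePolytope M'.matroid ⊆ basePolytope M.matroid)
  id _ := ⟨subset_rfl⟩
  comp f g := ⟨g.down.trans f.down⟩

/-- The inclusion of `𝓜_id(E)` in `𝓜`. -/
def MatroidId.inclusion (E : Type) [Finite E] : MatroidId E ⥤ MatroidCat where
  obj M := ⟨E, M.matroid⟩
  map f := ⟨Equiv.refl E, fun x hx => ⟨x, f.down hx, rfl⟩⟩

variable {E Γ : Type} [Group Γ] [MulAction Γ E]

theorem IsInvariant.subset_permute {M : MatroidOn E} (hM : IsInvariant Γ M) (γ : Γ) :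
    basePolytope M ⊆ permute (MulAction.toPerm γ) '' basePolytope M := by
  rw [basePolytope, LinearMap.image_convexHull]
  refine convexHull_mono ?_
  rintro _ ⟨B, hB, rfl⟩
  refine ⟨(γ⁻¹ • B).indicator 1, ⟨γ⁻¹ • B, hM γ⁻¹ B hB, rfl⟩, ?_⟩
  funext x
  change (γ⁻¹ • B).indicator 1 (γ⁻¹ • x) = B.indicator 1 x
  by_cases hx : x ∈ B
  · rw [Set.indicator_of_mem hx, Set.indicator_of_mem (Set.smul_mem_smul_set hx)]
    rfl
  · rw [Set.indicator_of_notMem hx, Set.indicator_of_notMem]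
    rwa [Set.smul_mem_smul_set_iff]

variable [Finite E]

/-- The automorphism of `(E, M)` in `𝓜` given by a group element preserving `M`. -/
def IsInvariant.aut {M : MatroidOn E} (hM : IsInvariant Γ M) (γ : Γ) :
    MatroidCat.mk E M ⟶ MatroidCat.mk E M :=
  ⟨MulAction.toPerm γ, hM.subset_permute γ⟩

theorem IsInvariant.aut_one {M : MatroidOn E} (hM : IsInvariant Γ M) :
    hM.aut 1 = 𝟙 (MatroidCat.mk E M) :=
  MatroidCat.Hom.ext (Equiv.ext fun x => one_smul Γ x)

theorem IsInvariant.aut_mul {M : MatroidOn E} (hM : IsInvariant Γ M) (γ δ : Γ) :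
    hM.aut (γ * δ) = hM.aut δ ≫ hM.aut γ :=
  MatroidCat.Hom.ext (Equiv.ext fun x => mul_smul γ δ x)

end categories

/-! ### Decompositions -/

section decompositions

variable {E : Type} [Finite E]

/-- A decomposition of a polyhedron `P`: a collection of polyhedra that contains the nonempty
faces of its members, such that any two members meet in a (possibly empty) common face, and whose
union is `P`.  The nonempty faces of a polyhedron `Q` are the loci where linear functionals
attain their maximum on `Q`, as expressed by `IsExposed ℝ Q`. -/
structure IsPolyhedralDecomposition (𝒬 : Set (Set (E → ℝ))) (P : Set (E → ℝ)) : Prop where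
  face_mem : ∀ Q ∈ 𝒬, ∀ R : Set (E → ℝ), R.Nonempty → IsExposed ℝ Q R → R ∈ 𝒬
  inter_face : ∀ Q ∈ 𝒬, ∀ R ∈ 𝒬, IsExposed ℝ Q (Q ∩ R) ∧ IsExposed ℝ R (Q ∩ R)
  cover : P = ⋃₀ 𝒬

/-- A decomposition of a matroid `M`: a collection of matroids whose base polytopes decompose the
base polytope of `M`. -/
def IsDecomposition (𝒩 : Set (MatroidOn E)) (M : MatroidOn E) : Prop :=
  IsPolyhedralDecomposition (basePolytope '' 𝒩) (basePolytope M)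

/-- The dimension of a polytope. -/
def dimension (P : Set (E → ℝ)) : ℕ := finrank ℝ (vectorSpan ℝ P)

/-- The set `𝒩_k`.  For `k ≤ d = dim P(M)` it consists of the internal faces `N ∈ 𝒩` (those with
`P(N)` not contained in the boundary of `P(M)`) of dimension `k`, and `𝒩_{d+1} = {M}`. -/
def cells (𝒩 : Set (MatroidOn E)) (M : MatroidOn E) (k : ℕ) : Set (MatroidOn E) :=
  {N | (N ∈ 𝒩 ∧ ¬ basePolytope N ⊆ intrinsicFrontier ℝ (basePolytope M) ∧
    dimension (basePolytope N) = k) ∨ (N = M ∧ k = dimension (basePolytope M) + 1)}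

/-- The top exterior power of a subspace `W` of `ℝ^E`, as a line in the exterior algebra
of `ℝ^E`. -/
def topPower (W : Submodule ℝ (E → ℝ)) : Submodule ℝ (ExteriorAlgebra ℝ (E → ℝ)) :=
  (⋀[ℝ]^(finrank ℝ W) W).map (ExteriorAlgebra.map W.subtype).toLinearMap

/-- An orientation of a polytope `P`: a ray in the top exterior power of the span of the
differences `x - y`, `x, y ∈ P`. -/
abbrev PolytopeOrientation (P : Set (E → ℝ)) : Type := Module.Ray ℝ (topPower (vectorSpan ℝ P))

/-- For polytopes `Q ⊆ P` of the same dimension: the orientation of `Q` is the restriction of the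
orientation of `P`. -/
def OrientationsAgree {P Q : Set (E → ℝ)} (oP : PolytopeOrientation P)
    (oQ : PolytopeOrientation Q) : Prop :=
  ∃ (p : topPower (vectorSpan ℝ P)) (q : topPower (vectorSpan ℝ Q)) (hp : p ≠ 0) (hq : q ≠ 0),
    rayOfNeZero ℝ p hp = oP ∧ rayOfNeZero ℝ q hq = oQ ∧
      (p : ExteriorAlgebra ℝ (E → ℝ)) = (q : ExteriorAlgebra ℝ (E → ℝ))

/-- `ν` is an outward normal vector to the facet `Q` of `P`: it is parallel to `P`, and the
functional `x ↦ ⟨ν, x⟩` attains its maximum on `P` at all points of `Q`. -/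
def IsOutwardNormal (P Q : Set (E → ℝ)) (ν : E → ℝ) : Prop :=
  ν ∈ vectorSpan ℝ P ∧ ν ≠ 0 ∧ ∀ x ∈ Q, ∀ y ∈ P, ∑ᶠ e, ν e * y e ≤ ∑ᶠ e, ν e * x e

/-- For a facet `Q` of `P`: the orientation of `Q` is the one induced by the orientation of `P`
by contraction with an outward normal vector, that is, `ω` is positive on `Q` if and only if
`ν ∧ ω` is positive on `P`. -/
def OrientationsMatch {P Q : Set (E → ℝ)} (oP : PolytopeOrientation P)
    (oQ : PolytopeOrientation Q) : Prop :=
  ∃ (ν : E → ℝ) (p : topPower (vectorSpan ℝ P)) (q : topPower (vectorSpan ℝ Q))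
    (hp : p ≠ 0) (hq : q ≠ 0), IsOutwardNormal P Q ν ∧
    rayOfNeZero ℝ p hp = oP ∧ rayOfNeZero ℝ q hq = oQ ∧
      (p : ExteriorAlgebra ℝ (E → ℝ)) = ExteriorAlgebra.ι ℝ ν * q

/-- An orientation of a decomposition of `M`: an arbitrary choice of an orientation for each face
of the decomposition, and one for `M` itself.  (Only the values of `face` on the members of the
decomposition play a role.) -/
structure DecompositionOrientation (M : MatroidOn E) where
  face : ∀ N : MatroidOn E, PolytopeOrientation (basePolytope N)
  total : PolytopeOrientation (basePolytope M)

/-- The `ℚ`-linear additive closure `𝓜_id⁺(E)`. -/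
abbrev MatroidIdPlus (E : Type) := Mat_ (Free ℚ (MatroidId E))

instance finite_matroidOn : Finite (MatroidOn E) := by
  refine Finite.of_injective (fun M : MatroidOn E => {B | M.toMatroid.IsBase B}) ?_
  rintro ⟨M, hM⟩ ⟨N, hN⟩ h
  have : M = N := Matroid.ext_isBase (hM.trans hN.symm) fun B _ => Set.ext_iff.1 h B
  subst this
  rfl

instance finite_cells (𝒩 : Set (MatroidOn E)) (M : MatroidOn E) (k : ℕ) :
    Fintype (cells 𝒩 M k) :=
  Fintype.ofFinite _

/-- The term `C_k` of the complex of a decomposition: the formal direct sum of the members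
of `𝒩_k`. -/
def chainObj (𝒩 : Set (MatroidOn E)) (M : MatroidOn E) (k : ℕ) : MatroidIdPlus E where
  ι := cells 𝒩 M k
  X N := Free.of ℚ (MatroidId.mk N.1)

open Classical in
/-- The component from `X ∈ 𝒩_{k+1}` to `Y ∈ 𝒩_k` of the differential.  It is a multiple of the
morphism `ι_{X,Y}`.  If `k = dim P(M)` (so that `X = M`), the coefficient is `1` or `-1` depending
on whether the orientations of `X` and `Y` agree; otherwise it is `1` or `-1` if `Y` is a facet
of `X`, depending on whether the orientations match, and `0` if `Y` is not a facet of `X`. -/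
def incidence {M : MatroidOn E} (Ω : DecompositionOrientation M) (k : ℕ) (X Y : MatroidOn E) :
    Free.of ℚ (MatroidId.mk X) ⟶ Free.of ℚ (MatroidId.mk Y) :=
  if h : basePolytope Y ⊆ basePolytope X then
    (if k = dimension (basePolytope M) then
      (if OrientationsAgree Ω.total (Ω.face Y) then 1 else -1)
    else if IsExposed ℝ (basePolytope X) (basePolytope Y) then
      (if OrientationsMatch (Ω.face X) (Ω.face Y) then 1 else -1)
    else 0 : ℚ) • (Free.embedding ℚ (MatroidId E)).map
      (X := MatroidId.mk X) (Y := MatroidId.mk Y) ⟨h⟩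
  else 0

/-- The differential `C_{k+1} → C_k` of the complex of a decomposition. -/
def differential (𝒩 : Set (MatroidOn E)) {M : MatroidOn E} (Ω : DecompositionOrientation M)
    (k : ℕ) : chainObj 𝒩 M (k + 1) ⟶ chainObj 𝒩 M k :=
  fun X Y => incidence Ω k X.1 Y.1

end decompositions

/-! ### Valuative functors -/

section valuative

/-- The `ℚ`-linear additive extension `𝓒⁺ ⥤ 𝓓` of a functor `𝓒 ⥤ 𝓓`. -/
def additiveExtension {C D : Type 1} [Category.{0} C] [Category.{0} D] [Preadditive D]
    [Linear ℚ D] [HasFiniteBiproducts D] (F : C ⥤ D) : Mat_ (Free ℚ C) ⥤ D :=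
  Mat_.lift (Free.lift ℚ F)

/-- A complex `⋯ → X 1 → X 0 → 0` is contractible: its identity map is homotopic to zero, that is,
it admits a contracting homotopy. -/
def IsContractible {D : Type 1} [Category.{0} D] [Preadditive D] (X : ℕ → D)
    (d : ∀ k, X (k + 1) ⟶ X k) : Prop :=
  ∃ h : ∀ k, X k ⟶ X (k + 1), h 0 ≫ d 0 = 𝟙 (X 0) ∧
    ∀ k, d k ≫ h k + h (k + 1) ≫ d (k + 1) = 𝟙 (X (k + 1))

/-- A functor on `𝓜` is valuative if, for every oriented decomposition of a matroid, it sends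
(the additive extension of its restriction to `𝓜_id(E)` sends) the complex of the decomposition
to a contractible complex. -/
def IsValuative {D : Type 1} [Category.{0} D] [Preadditive D] [Linear ℚ D]
    [HasFiniteBiproducts D] (Φ : MatroidCat ⥤ D) : Prop :=
  ∀ (E : Type) [Finite E] (M : MatroidOn E) (𝒩 : Set (MatroidOn E))
    (Ω : DecompositionOrientation M), IsDecomposition 𝒩 M →
    IsContractible
      (fun k => (additiveExtension (MatroidId.inclusion E ⋙ Φ)).obj (chainObj 𝒩 M k))
      (fun k => (additiveExtension (MatroidId.inclusion E ⋙ Φ)).map (differential 𝒩 Ω k))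

end valuative

/-! ### Graded vector spaces and virtual representations -/

section graded

instance gradedPreadditive {A : Type} {C : Type*} [Category C] [Preadditive C] :
    Preadditive (GradedObject A C) where
  homGroup X Y := inferInstanceAs (AddCommGroup (∀ a, X a ⟶ Y a))
  add_comp _ _ _ _ _ _ := by
    funext a
    exact Preadditive.add_comp _ _ _ _ _ _
  comp_add _ _ _ _ _ _ := by
    funext a
    exact Preadditive.comp_add _ _ _ _ _ _

instance gradedLinear {A : Type} {R : Type*} [Semiring R] {C : Type*} [Category C]
    [Preadditive C] [Linear R C] : Linear R (GradedObject A C) where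
  homModule X Y := inferInstanceAs (Module R (∀ a, X a ⟶ Y a))
  smul_comp _ _ _ _ _ _ := by
    funext a
    exact Linear.smul_comp _ _ _ _ _ _
  comp_smul _ _ _ _ _ _ := by
    funext a
    exact Linear.comp_smul _ _ _ _ _ _

/-- Finite-dimensionality of an `A`-graded vector space. -/
def FinDimGraded {A : Type} : ObjectProperty (GradedObject A (ModuleCat.{0} ℚ)) := fun X =>
  (∀ a, Module.Finite ℚ (X a)) ∧ {a | Nontrivial (X a)}.Finite

/-- The category of finite-dimensional `A`-graded rational vector spaces. -/
abbrev GrVect (A : Type) := (FinDimGraded (A := A)).FullSubcategory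

/-- Finite-dimensionality of an `A`-graded representation. -/
def FinDimGradedRep {A : Type} {Γ : Type} [Group Γ] :
    ObjectProperty (GradedObject A (Rep.{0} ℚ Γ)) := fun X =>
  (∀ a, Module.Finite ℚ (X a)) ∧ {a | Nontrivial (X a)}.Finite

/-- The category of finite-dimensional `A`-graded rational representations of `Γ`. -/
abbrev GrRep (A : Type) (Γ : Type) [Group Γ] :=
  (FinDimGradedRep (A := A) (Γ := Γ)).FullSubcategory

/-- The subgroup of the free abelian group on the objects of an additive category that is generated
by the elements `[X ⊕ Y] - [X] - [Y]`, where `X ⊕ Y` runs over all the biproducts of `X` and `Y`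
(so that isomorphic objects get the same class). -/
def splitRelations (C : Type*) [Category C] [HasZeroMorphisms C] :
    AddSubgroup (FreeAbelianGroup C) :=
  AddSubgroup.closure {x | ∃ (X Y : C) (b : BinaryBicone X Y), Nonempty b.IsBilimit ∧
    x = FreeAbelianGroup.of b.pt - FreeAbelianGroup.of X - FreeAbelianGroup.of Y}

/-- The split Grothendieck group of an additive category. -/
abbrev SplitK₀ (C : Type*) [Category C] [HasZeroMorphisms C] :=
  FreeAbelianGroup C ⧸ splitRelations C

/-- The class of an object in the Grothendieck group. -/
def SplitK₀.mk {C : Type*} [Category C] [HasZeroMorphisms C] (X : C) : SplitK₀ C :=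
  QuotientAddGroup.mk (FreeAbelianGroup.of X)

/-- Virtual graded representations of a finite group `Γ`: the Grothendieck group of the category of
finite-dimensional graded rational representations of `Γ`.  (All the short exact sequences in this
category split.) -/
abbrev VirtualGrRep (A : Type) (Γ : Type) [Group Γ] := SplitK₀ (GrRep A Γ)

instance {A : Type} : HasFiniteBiproducts (GrVect A) where
  out n := ⟨fun f => by
    classical
    let P : GrVect A := ⟨fun a => ModuleCat.of ℚ (∀ j, (f j).obj a), fun a => by
        have := fun j => (f j).property.1 a
        exact inferInstanceAs (Module.Finite ℚ (∀ j, (f j).obj a)), by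
        refine (Set.finite_iUnion fun j => (f j).property.2).subset ?_
        intro a ha
        by_contra hcon
        have h1 : ∀ j, Subsingleton ((f j).obj a) := by
          intro j
          rw [← not_nontrivial_iff_subsingleton]
          intro h
          exact hcon (Set.mem_iUnion.2 ⟨j, h⟩)
        have h2 : Subsingleton (∀ j, (f j).obj a) := inferInstance
        have h3 : Nontrivial (∀ j, (f j).obj a) := ha
        exact not_subsingleton _ h2⟩
    refine hasBiproduct_of_total
      { pt := P
        π := fun j => ObjectProperty.homMk fun a => ModuleCat.ofHom (LinearMap.proj (φ := fun i => ((f i).obj a : Type)) j)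
        ι := fun j => ObjectProperty.homMk fun a => ModuleCat.ofHom (LinearMap.single ℚ (fun i => ((f i).obj a : Type)) j)
        ι_π := ?_ } ?_
    · intro i j
      apply ObjectProperty.hom_ext
      funext a
      apply ModuleCat.hom_ext
      apply LinearMap.ext
      intro x
      by_cases h : i = j
      · subst h
        simp only [dif_pos]
        exact Pi.single_eq_same (M := fun i => ((f i).obj a : Type)) i x
      · simp only [dif_neg h]
        exact Pi.single_eq_of_ne (M := fun i => ((f i).obj a : Type)) (Ne.symm h) x
    · have key : ∀ (a : A) (x : ∀ i, ((f i).obj a : Type)),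
          (∑ j, Pi.single j (x j) : ∀ i, ((f i).obj a : Type)) = x := fun a x =>
        Finset.univ_sum_single x
      let ev (a : A) : (P ⟶ P) →+ (∀ i, ((f i).obj a : Type)) →ₗ[ℚ] (∀ i, ((f i).obj a : Type)) :=
        { toFun := fun g => (g.hom a).hom
          map_zero' := rfl
          map_add' := fun _ _ => rfl }
      apply ObjectProperty.hom_ext
      funext a
      apply ModuleCat.hom_ext
      change ev a _ = LinearMap.id
      rw [map_sum]
      apply LinearMap.ext
      intro x
      rw [LinearMap.sum_apply]
      exact key a x⟩


theorem finite_indV {Γ : Type} [Group Γ] [Finite Γ] (H : Subgroup Γ) (X : Rep.{0} ℚ H)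
    [Module.Finite ℚ X] : Module.Finite ℚ (Rep.ind H.subtype X) := by
  have h1 : Module.Finite ℚ (MonoidAlgebra ℚ Γ) :=
    Module.Finite.equiv (MonoidAlgebra.coeffLinearEquiv ℚ : MonoidAlgebra ℚ Γ ≃ₗ[ℚ] _).symm
  exact Module.Finite.of_surjective
    (Representation.Coinvariants.mk (Representation.tprod
      ((Representation.leftRegular ℚ Γ).comp H.subtype) X.ρ))
    (Representation.Coinvariants.mk_surjective _)

theorem subsingleton_indV {Γ : Type} [Group Γ] (H : Subgroup Γ) (X : Rep.{0} ℚ H)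
    [Subsingleton X] : Subsingleton (Rep.ind H.subtype X) := by
  have : Subsingleton (TensorProduct ℚ (MonoidAlgebra ℚ Γ) X) := inferInstance
  exact (Representation.Coinvariants.mk_surjective (Representation.tprod
      ((Representation.leftRegular ℚ Γ).comp H.subtype) X.ρ)).subsingleton

/-- Induction of graded representations, degree by degree. -/
def indGr {A : Type} {Γ : Type} [Group Γ] [Finite Γ] (H : Subgroup Γ) (X : GrRep A H) :
    GrRep A Γ :=
  ⟨fun a => Rep.ind H.subtype (X.obj a),
    fun a => by
      have := X.property.1 a
      exact finite_indV H (X.obj a),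
    by
      refine X.property.2.subset fun a ha => ?_
      by_contra hcon
      have h1 : Subsingleton (X.obj a) := not_nontrivial_iff_subsingleton.1 hcon
      have h2 := subsingleton_indV H (X.obj a)
      have h3 : Nontrivial (Rep.ind H.subtype (X.obj a)) := ha
      exact not_subsingleton _ h2⟩

/-- If a group `G` acts on `E` preserving the matroid `N`, then `Φ(N)` is a graded representation
of `G`. -/
def repOf {A : Type} {E G : Type} [Finite E] [Group G] [MulAction G E]
    (Φ : MatroidCat ⥤ GrVect A) {N : MatroidOn E} (hN : IsInvariant G N) : GrRep A G :=
  ⟨fun a => Rep.of (X := ((Φ.obj ⟨E, N⟩).obj a : Type))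
    { toFun := fun γ => ((Φ.map (hN.aut γ)).hom a).hom
      map_one' := by
        rw [hN.aut_one, Φ.map_id]
        rfl
      map_mul' := fun γ δ => by
        rw [hN.aut_mul, Φ.map_comp]
        rfl },
    (Φ.obj ⟨E, N⟩).property⟩

end graded

end RelaxValuative

end

/-!
If `M'` is the relaxation of `M` at a stressed flat `F` of rank `r`, then the hyperplane
`∑ e ∈ F, x e = r` cuts `P(M')` into `P(M)` and `P(Λ)`, and these two pieces meet in the common
facet `P(Π)`. Contractibility of the image under `Φ` of the complex of this decomposition says that
`Φ(M') → Φ(M), Φ(Λ) ⇉ Φ(Π)` is a bicartesian square. The cusps of the flats in the orbit of `F` are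
disjoint, so they can be relaxed one at a time, and pasting the squares gives a bicartesian square
with corners `Φ(M̃)`, `Φ(M)` and the products of the `Φ(Λ)` and of the `Φ(Π)` over the orbit. It is
`Γ`-equivariant, the products are induced from the stabilizer of `F`, and its Mayer-Vietoris
sequence splits equivariantly by Maschke's theorem.
-/

open Filter Topology

noncomputable section

namespace RelaxValuative

section SegmentsAndHyperplanes

variable {V : Type*} [AddCommGroup V] [Module ℝ V] {S T B : Set V} {x y v : V}
  {ℓ : V →ₗ[ℝ] ℝ} {c : ℝ}

theorem mem_vectorSpan_of_add_smul_mem {t : ℝ} (ht : t ≠ 0) (hx : x ∈ S) (h : x + t • v ∈ S) :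
    v ∈ vectorSpan ℝ S := by
  have hv : (x + t • v) -ᵥ x ∈ vectorSpan ℝ S := vsub_mem_vectorSpan ℝ h hx
  rwa [vsub_eq_sub, add_sub_cancel_left, Submodule.smul_mem_iff _ ht] at hv

theorem finrank_inf_ker_add_one [FiniteDimensional ℝ V] {W : Submodule ℝ V} (hv : v ∈ W)
    (hℓv : ℓ v ≠ 0) : finrank ℝ ↥(W ⊓ LinearMap.ker ℓ) + 1 = finrank ℝ W := by
  have hne : ℓ.comp W.subtype ≠ 0 := fun h => hℓv (LinearMap.congr_fun h ⟨v, hv⟩)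
  rw [← Module.Dual.finrank_ker_add_one_of_ne_zero hne, LinearMap.ker_comp,
    ← Submodule.map_comap_subtype, Submodule.finrank_map_subtype_eq]

theorem exists_lineMap_eq (hx : ℓ x ≤ c) (hy : c < ℓ y) :
    ∃ t ∈ Set.Ico (0 : ℝ) 1, ℓ (AffineMap.lineMap x y t) = c := by
  have hpos : 0 < ℓ y - ℓ x := by linarith
  refine ⟨(c - ℓ x) / (ℓ y - ℓ x), ⟨div_nonneg (by linarith) hpos.le,
    (div_lt_one hpos).2 (by linarith)⟩, ?_⟩
  rw [AffineMap.lineMap_apply_module', map_add, map_smul, map_sub, smul_eq_mul,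
    div_mul_cancel₀ _ hpos.ne', sub_add_cancel]

theorem convexHull_inter_le_subset (s : Set V) (ℓ : V →ₗ[ℝ] ℝ) (c : ℝ) :
    convexHull ℝ s ∩ {x | ℓ x ≤ c} ⊆
      convexHull ℝ ((s ∩ {x | ℓ x ≤ c}) ∪ (convexHull ℝ s ∩ {x | ℓ x = c})) := by
  rintro x ⟨hx, hxc : ℓ x ≤ c⟩
  have hs : s = (s ∩ {x | ℓ x ≤ c}) ∪ (s ∩ {x | c < ℓ x}) := by
    rw [← Set.inter_union_distrib_left]
    exact (Set.inter_eq_left.2 fun y _ => le_or_gt (ℓ y) c).symm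
  have hgt : convexHull ℝ (s ∩ {x | c < ℓ x}) ⊆ {x | c < ℓ x} :=
    convexHull_min Set.inter_subset_right (convex_halfSpace_gt ℓ.isLinear c)
  rcases (s ∩ {x | ℓ x ≤ c}).eq_empty_or_nonempty with hle | hle
  · rw [hle, Set.empty_union] at hs
    rw [hs] at hx
    exact absurd hxc (not_le.2 (hgt hx))
  rcases (s ∩ {x | c < ℓ x}).eq_empty_or_nonempty with hlt | hlt
  · rw [hlt, Set.union_empty] at hs
    rw [hs] at hx
    exact convexHull_mono Set.subset_union_left hx
  have hx' := hx
  rw [hs, convexHull_union hle hlt, mem_convexJoin] at hx'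
  obtain ⟨u, hu, w, hw, hxuw⟩ := hx'
  obtain ⟨t, ht, htc⟩ := exists_lineMap_eq hxc (hgt hw)
  have ht' : t ∈ Set.Icc (0 : ℝ) 1 := ⟨ht.1, ht.2.le⟩
  have hq : AffineMap.lineMap x w t ∈ convexHull ℝ s ∩ {x | ℓ x = c} :=
    ⟨(convex_convexHull ℝ s).lineMap_mem hx (convexHull_mono Set.inter_subset_left hw) ht', htc⟩
  have hwbtw : Wbtw ℝ x (AffineMap.lineMap x w t) w := ⟨t, ht', rfl⟩
  have hxq : Wbtw ℝ u x (AffineMap.lineMap x w t) :=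
    (mem_segment_iff_wbtw.1 hxuw).trans_right_left hwbtw
  exact (convex_convexHull ℝ _).segment_subset (convexHull_mono Set.subset_union_left hu)
    (subset_convexHull ℝ _ (Set.mem_union_right _ hq)) hxq.mem_segment

theorem mem_of_isExtreme (hB : IsExtreme ℝ T B) (hx : x ∈ B) (hy : y ∈ T)
    (h : ∀ᶠ t in 𝓝 (0 : ℝ), x + t • (y - x) ∈ T) : y ∈ B := by
  have hneg : Tendsto (fun t : ℝ => -t) (𝓝[>] 0) (𝓝 0) := by
    simpa using (tendsto_neg (0 : ℝ)).mono_left nhdsWithin_le_nhds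
  obtain ⟨t, htT, ht : 0 < t⟩ :=
    ((hneg.eventually h).and (self_mem_nhdsWithin (s := Set.Ioi (0 : ℝ)))).exists
  refine hB.left_mem_of_mem_openSegment hy htT hx
    ⟨t / (1 + t), 1 / (1 + t), by positivity, by positivity, ?_, ?_⟩
  · rw [← add_div, add_comm, div_self (by positivity)]
  · match_scalars <;> field

theorem eq_zero_of_mem_extremePoints (hx : x ∈ S.extremePoints ℝ)
    (h : ∀ᶠ t in 𝓝 (0 : ℝ), x + t • v ∈ S) : v = 0 := by
  have hneg : ∀ᶠ t in 𝓝 (0 : ℝ), x + (-t) • v ∈ S :=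
    (continuous_neg.tendsto' (0 : ℝ) 0 neg_zero).eventually h
  obtain ⟨t, ⟨hpos, hneg⟩, ht⟩ := ((h.and hneg).filter_mono nhdsWithin_le_nhds).and
    (self_mem_nhdsWithin (s := Set.Ioi (0 : ℝ))) |>.exists
  have hmid : x ∈ openSegment ℝ (x + t • v) (x + (-t) • v) :=
    ⟨1 / 2, 1 / 2, by norm_num, by norm_num, by norm_num, by match_scalars <;> ring⟩
  have := hx.2 hpos hneg hmid
  rw [add_eq_left, smul_eq_zero] at this
  exact this.resolve_left (ne_of_gt ht)

end SegmentsAndHyperplanes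

section Convex

variable {V : Type*} [NormedAddCommGroup V] [NormedSpace ℝ V] {S B : Set V} {x y v : V}
  {ℓ : V →ₗ[ℝ] ℝ} {c : ℝ}

theorem eventually_add_smul_mem (hx : x ∈ intrinsicInterior ℝ S) (hv : v ∈ vectorSpan ℝ S) :
    ∀ᶠ t in 𝓝 (0 : ℝ), x + t • v ∈ S := by
  obtain ⟨z, hz, rfl⟩ := hx
  rw [← direction_affineSpan] at hv
  let line : ℝ → affineSpan ℝ S := fun t =>
    ⟨t • v +ᵥ (z : V), AffineSubspace.vadd_mem_of_mem_direction (Submodule.smul_mem _ t hv) z.2⟩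
  have hline : Continuous line := by fun_prop
  have hzero : interior (Subtype.val ⁻¹' S) ∈ 𝓝 (line 0) := by
    have : line 0 = z := Subtype.ext (by simp only [line, zero_smul, zero_vadd])
    exact this ▸ isOpen_interior.mem_nhds hz
  filter_upwards [hline.continuousAt.preimage_mem_nhds hzero] with t ht
  have : t • v +ᵥ (z : V) ∈ S := interior_subset (s := Subtype.val ⁻¹' S) ht
  rwa [vadd_eq_add, add_comm] at this

theorem lineMap_mem_intrinsicInterior (hS : Convex ℝ S) (hx : x ∈ intrinsicInterior ℝ S)
    (hy : y ∈ S) {t : ℝ} (ht : t ∈ Set.Ico (0 : ℝ) 1) :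
    AffineMap.lineMap x y t ∈ intrinsicInterior ℝ S := by
  obtain ⟨x', hx', rfl⟩ := hx
  let y' : affineSpan ℝ S := ⟨y, subset_affineSpan ℝ S hy⟩
  have : Nonempty (affineSpan ℝ S) := ⟨y'⟩
  have hcoe (z : affineSpan ℝ S) :
      (AffineMap.homothety y' (1 - t) z : V) = AffineMap.lineMap (z : V) y t := by
    rw [AffineMap.homothety_eq_lineMap, AffineMap.lineMap_apply_one_sub]
    rfl
  refine ⟨AffineMap.homothety y' (1 - t) x', ?_, hcoe x'⟩
  have hopen : IsOpen (AffineMap.homothety y' (1 - t) '' interior (Subtype.val ⁻¹' S)) :=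
    AffineMap.homothety_isOpenMap y' (1 - t) (sub_pos.2 ht.2).ne' _ isOpen_interior
  refine interior_maximal ?_ hopen ⟨x', hx', rfl⟩
  rintro _ ⟨z, hz, rfl⟩
  rw [Set.mem_preimage, hcoe]
  exact hS.lineMap_mem (interior_subset (s := Subtype.val ⁻¹' S) hz) hy ⟨ht.1, ht.2.le⟩

theorem vectorSpan_inter_eq (hx : x ∈ intrinsicInterior ℝ S) (hxc : ℓ x = c) :
    vectorSpan ℝ (S ∩ {y | ℓ y = c}) = vectorSpan ℝ S ⊓ LinearMap.ker ℓ := by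
  have hxS := intrinsicInterior_subset hx
  refine le_antisymm (le_inf (vectorSpan_mono ℝ Set.inter_subset_left) ?_) ?_
  · rw [vectorSpan_eq_span_vsub_set_right ℝ (show x ∈ S ∩ {y | ℓ y = c} from ⟨hxS, hxc⟩),
      Submodule.span_le]
    rintro _ ⟨y, ⟨-, hyc⟩, rfl⟩
    exact (map_sub ℓ y x).trans (sub_eq_zero.2 (hyc.trans hxc.symm))
  · rintro v ⟨hv, hℓv : ℓ v = 0⟩
    obtain ⟨t, htS, ht : 0 < t⟩ := ((eventually_nhdsWithin_of_eventually_nhds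
      (eventually_add_smul_mem hx hv)).and (self_mem_nhdsWithin (s := Set.Ioi (0 : ℝ)))).exists
    have htc : ℓ (x + t • v) = c := by rw [map_add, map_smul, hℓv, smul_zero, add_zero, hxc]
    exact mem_vectorSpan_of_add_smul_mem ht.ne' ⟨hxS, hxc⟩ ⟨htS, htc⟩

theorem vectorSpan_inter_le (hx : x ∈ intrinsicInterior ℝ S) (hxc : ℓ x = c) :
    vectorSpan ℝ (S ∩ {y | ℓ y ≤ c}) = vectorSpan ℝ S := by
  refine le_antisymm (vectorSpan_mono ℝ Set.inter_subset_left) fun v hv => ?_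
  wlog hℓv : ℓ v ≤ 0 generalizing v
  · exact (Submodule.neg_mem_iff _).1 <| this (-v) ((Submodule.neg_mem_iff _).2 hv) <| by
      rw [map_neg]; linarith
  obtain ⟨t, htS, ht : 0 < t⟩ := ((eventually_nhdsWithin_of_eventually_nhds
    (eventually_add_smul_mem hx hv)).and (self_mem_nhdsWithin (s := Set.Ioi (0 : ℝ)))).exists
  have htc : ℓ (x + t • v) ≤ c := by
    rw [map_add, map_smul, hxc, smul_eq_mul]
    linarith [mul_nonpos_of_nonneg_of_nonpos ht.le hℓv]
  exact mem_vectorSpan_of_add_smul_mem ht.ne' ⟨intrinsicInterior_subset hx, hxc.le⟩ ⟨htS, htc⟩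

theorem finrank_vectorSpan_eq_add_one [FiniteDimensional ℝ V] (hx : x ∈ intrinsicInterior ℝ S)
    (hxc : ℓ x = c) (hy : y ∈ S) (hyc : c < ℓ y) :
    finrank ℝ (vectorSpan ℝ S) = finrank ℝ (vectorSpan ℝ (S ∩ {y | ℓ y = c})) + 1 := by
  have hyx : y -ᵥ x ∈ vectorSpan ℝ S := vsub_mem_vectorSpan ℝ hy (intrinsicInterior_subset hx)
  have hne : ℓ (y -ᵥ x) ≠ 0 := by
    rw [vsub_eq_sub, map_sub, hxc]
    exact (sub_pos.2 hyc).ne'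
  rw [vectorSpan_inter_eq hx hxc, finrank_inf_ker_add_one hyx hne]

theorem exists_mem_intrinsicInterior_eq [FiniteDimensional ℝ V] (hS : Convex ℝ S)
    (hlt : ∃ u ∈ S, ℓ u < c) (hgt : ∃ w ∈ S, c < ℓ w) :
    ∃ x ∈ intrinsicInterior ℝ S, ℓ x = c := by
  obtain ⟨u, hu, huc⟩ := hlt
  obtain ⟨x, hx⟩ := Set.Nonempty.intrinsicInterior hS ⟨u, hu⟩
  wlog hxc : ℓ x ≤ c generalizing ℓ c u
  · obtain ⟨w, hw, hwc⟩ := hgt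
    obtain ⟨y, hy, hyc⟩ := this (ℓ := -ℓ) (c := -c) ⟨u, hu, neg_lt_neg huc⟩ w hw
      (neg_lt_neg hwc) (neg_le_neg (not_le.1 hxc).le)
    exact ⟨y, hy, neg_injective hyc⟩
  obtain ⟨w, hw, hwc⟩ := hgt
  obtain ⟨t, ht, htc⟩ := exists_lineMap_eq hxc hwc
  exact ⟨_, lineMap_mem_intrinsicInterior hS hx hw ht, htc⟩

theorem eq_inter_of_isExposed_inter_le (hS : Convex ℝ S) (hx : x ∈ intrinsicInterior ℝ S)
    (hB : IsExposed ℝ (S ∩ {y | ℓ y ≤ c}) B) (hxB : x ∈ B) :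
    B = S ∩ {y | ℓ y ≤ c} ∨ B = S ∩ {y | ℓ y = c} := by
  have hstay {m y : V} (hm : m ∈ intrinsicInterior ℝ S) (hy : y ∈ S) :
      ∀ᶠ t in 𝓝 (0 : ℝ), m + t • (y - m) ∈ S :=
    eventually_add_smul_mem hm (vsub_mem_vectorSpan ℝ hy (intrinsicInterior_subset hm))
  by_cases hlt : ∃ z ∈ B, ℓ z < c
  · left
    obtain ⟨z, hz, hzc⟩ := hlt
    have hm : AffineMap.lineMap x z (1 / 2 : ℝ) ∈ B :=
      (hB.convex (hS.inter (convex_halfSpace_le ℓ.isLinear c))).lineMap_mem hxB hz (by norm_num)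
    have hmint : AffineMap.lineMap x z (1 / 2 : ℝ) ∈ intrinsicInterior ℝ S :=
      lineMap_mem_intrinsicInterior hS hx (hB.subset hz).1 (by norm_num)
    have hmc : ℓ (AffineMap.lineMap x z (1 / 2 : ℝ)) < c := by
      have hxc : ℓ x ≤ c := (hB.subset hxB).2
      rw [AffineMap.lineMap_apply_module, map_add, map_smul, map_smul, smul_eq_mul, smul_eq_mul]
      linarith
    refine subset_antisymm hB.subset fun y hy => mem_of_isExtreme hB.isExtreme hm hy ?_
    have hlim : Continuous fun t : ℝ => ℓ (AffineMap.lineMap x z (1 / 2 : ℝ))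
        + t * ℓ (y - AffineMap.lineMap x z (1 / 2 : ℝ)) := by fun_prop
    filter_upwards [hstay hmint hy.1, hlim.continuousAt.eventually_lt_const
      (by simpa only [zero_mul, add_zero] using hmc)] with t htS htc
    exact ⟨htS, by simpa only [Set.mem_ofPred_eq, map_add, map_smul, smul_eq_mul] using htc.le⟩
  · right
    push Not at hlt
    have hBc : ∀ y ∈ B, ℓ y = c := fun y hy => le_antisymm (hB.subset hy).2 (hlt y hy)
    refine subset_antisymm (fun y hy => ⟨(hB.subset hy).1, hBc y hy⟩) fun y ⟨hyS, hyc⟩ => ?_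
    have hyc : ℓ y = c := hyc
    refine mem_of_isExtreme hB.isExtreme hxB ⟨hyS, hyc.le⟩ ?_
    filter_upwards [hstay hx hyS] with t ht
    refine ⟨ht, le_of_eq (a := ℓ _) ?_⟩
    rw [map_add, map_smul, map_sub, hyc, hBc x hxB, sub_self, smul_zero, add_zero]

theorem isExposed_inter_eq (l : StrongDual ℝ V) (h : ∀ y ∈ S, l y ≤ c) :
    IsExposed ℝ S (S ∩ {y | l y = c}) := by
  rintro ⟨x, hxS, hxc⟩
  refine ⟨l, Set.ext fun y => and_congr_right fun hy => ⟨fun hyc z hz => ?_, fun hmax => ?_⟩⟩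
  · exact (h z hz).trans_eq (Eq.symm hyc)
  · exact le_antisymm (h y hy) (Eq.trans_le (Eq.symm hxc) (hmax x hxS))

theorem exists_eq_inter_of_isExposed (hB : IsExposed ℝ S B) (hne : B.Nonempty) :
    ∃ (l : StrongDual ℝ V) (c : ℝ), (∀ y ∈ S, l y ≤ c) ∧ B = S ∩ {y | l y = c} := by
  obtain ⟨x, hx⟩ := hne
  obtain ⟨l, rfl⟩ := hB ⟨x, hx⟩
  exact ⟨l, l x, hx.2, Set.ext fun y => and_congr_right fun hy =>
    ⟨fun hmax => le_antisymm (hx.2 y hy) (hmax x hx.1),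
      fun hyx z hz => (hx.2 z hz).trans_eq hyx.symm⟩⟩

theorem exists_forall_mem_convexHull_sub_le {s : Set V} (hs : s.Finite) {l₁ l₂ : V →ₗ[ℝ] ℝ}
    {c₁ c₂ : ℝ} (h₁ : ∀ y ∈ convexHull ℝ s, l₁ y ≤ c₁)
    (h₂ : ∀ y ∈ convexHull ℝ s, l₁ y = c₁ → l₂ y ≤ c₂) :
    ∃ K, ∀ y ∈ convexHull ℝ s, l₂ y - c₂ ≤ K * (c₁ - l₁ y) := by
  obtain ⟨K, hK⟩ := (hs.image fun v => (l₂ v - c₂) / (c₁ - l₁ v)).bddAbove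
  have hconv : Convex ℝ {y | (l₂ + K • l₁) y ≤ c₂ + K * c₁} :=
    convex_halfSpace_le (l₂ + K • l₁).isLinear _
  have hle : convexHull ℝ s ⊆ {y | (l₂ + K • l₁) y ≤ c₂ + K * c₁} := by
    refine convexHull_min (fun v hv => ?_) hconv
    have hvs := subset_convexHull ℝ s hv
    change l₂ v + K * l₁ v ≤ c₂ + K * c₁
    rcases (h₁ v hvs).lt_or_eq with hlt | heq
    · have hKv : (l₂ v - c₂) / (c₁ - l₁ v) ≤ K := hK ⟨v, hv, rfl⟩
      rw [div_le_iff₀ (sub_pos.2 hlt)] at hKv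
      linarith
    · rw [heq]
      linarith [h₂ v hvs heq]
  refine ⟨K, fun y hy => ?_⟩
  have hy' : l₂ y + K * l₁ y ≤ c₂ + K * c₁ := hle hy
  linarith

theorem isExposed_trans_of_finite {s C : Set V} (hs : s.Finite)
    (hB : IsExposed ℝ (convexHull ℝ s) B) (hC : IsExposed ℝ B C) :
    IsExposed ℝ (convexHull ℝ s) C := by
  rcases C.eq_empty_or_nonempty with rfl | hne
  · exact isExposed_empty
  obtain ⟨l₁, c₁, h₁, rfl⟩ := exists_eq_inter_of_isExposed hB (hne.mono hC.subset)
  obtain ⟨l₂, c₂, h₂, rfl⟩ := exists_eq_inter_of_isExposed hC hne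
  obtain ⟨K, hK⟩ := exists_forall_mem_convexHull_sub_le hs (l₁ := l₁.toLinearMap)
    (l₂ := l₂.toLinearMap) h₁ fun y hy hyc => h₂ y ⟨hy, hyc⟩
  have hK' (y : V) (hy : y ∈ convexHull ℝ s) : l₂ y - c₂ ≤ K * (c₁ - l₁ y) := hK y hy
  convert isExposed_inter_eq (S := convexHull ℝ s) (c := (K + 1) * c₁ + c₂) ((K + 1) • l₁ + l₂)
    fun y hy => ?_ using 1
  · ext y
    simp only [Set.mem_inter_iff, Set.mem_ofPred_eq, and_assoc, add_apply,
      smul_apply, smul_eq_mul]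
    refine and_congr_right fun hy => ⟨fun ⟨e₁, e₂⟩ => by rw [e₁, e₂], fun h => ?_⟩
    have e₁ : l₁ y = c₁ := by linarith [h₁ y hy, hK' y hy]
    rw [e₁] at h
    exact ⟨e₁, add_left_cancel h⟩
  · simp only [add_apply, smul_apply, smul_eq_mul]
    linarith [h₁ y hy, hK' y hy]

theorem eq_convexHull_of_isExposed {s : Set V} (hs : s.Finite)
    (hB : IsExposed ℝ (convexHull ℝ s) B) : B = convexHull ℝ (s ∩ B) := by
  refine subset_antisymm ?_
    (convexHull_min Set.inter_subset_right (hB.convex (convex_convexHull ℝ s)))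
  have hvert : B.extremePoints ℝ ⊆ s ∩ B := fun x hx =>
    ⟨extremePoints_convexHull_subset (hB.isExtreme.extremePoints_subset_extremePoints hx), hx.1⟩
  have hclosed : IsClosed (convexHull ℝ (s ∩ B)) :=
    ((hs.subset Set.inter_subset_left).isCompact_convexHull ℝ).isClosed
  calc B = closure (convexHull ℝ (B.extremePoints ℝ)) :=
        (closure_convexHull_extremePoints (hB.isCompact (hs.isCompact_convexHull ℝ))
          (hB.convex (convex_convexHull ℝ s))).symm
    _ ⊆ convexHull ℝ (s ∩ B) := hclosed.closure_subset_iff.2 (convexHull_mono hvert)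

end Convex

section BasePolytope

variable {E : Type}

/-- The vertices of the base polytope: the indicator vectors of the bases. -/
def baseVectors (M : MatroidOn E) : Set (E → ℝ) :=
  {v | ∃ B, M.toMatroid.IsBase B ∧ v = B.indicator 1}

theorem indicator_mem_basePolytope {M : MatroidOn E} {B : Set E} (hB : M.toMatroid.IsBase B) :
    B.indicator 1 ∈ basePolytope M := subset_convexHull ℝ _ ⟨B, hB, rfl⟩

theorem indicator_mem_Icc (B : Set E) : B.indicator (1 : E → ℝ) ∈ Set.Icc 0 1 :=
  ⟨Set.indicator_nonneg fun _ _ => zero_le_one, Set.indicator_le_self' fun _ _ => zero_le_one⟩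

theorem basePolytope_subset_Icc (M : MatroidOn E) : basePolytope M ⊆ Set.Icc 0 1 := by
  refine convexHull_min ?_ (convex_Icc 0 1)
  rintro _ ⟨B, -, rfl⟩
  exact indicator_mem_Icc B

theorem indicator_mem_extremePoints_Icc (B : Set E) :
    B.indicator (1 : E → ℝ) ∈ (Set.Icc (0 : E → ℝ) 1).extremePoints ℝ := by
  rw [← Set.pi_univ_Icc, extremePoints_pi]
  intro e _
  change _ ∈ (Set.Icc (0 : ℝ) 1).extremePoints ℝ
  rw [Set.extremePoints_Icc zero_le_one]
  exact Set.indicator_eq_zero_or_self B 1 e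

theorem indicator_mem_basePolytope_iff {M : MatroidOn E} {B : Set E} :
    B.indicator (1 : E → ℝ) ∈ basePolytope M ↔ M.toMatroid.IsBase B := by
  refine ⟨fun h => ?_, indicator_mem_basePolytope⟩
  obtain ⟨B', hB', heq⟩ := extremePoints_convexHull_subset
    (inter_extremePoints_subset_extremePoints_of_subset (basePolytope_subset_Icc M)
      ⟨h, indicator_mem_extremePoints_Icc B⟩)
  rwa [Set.indicator_one_inj ℝ heq]

theorem MatroidOn.ext_isBase {M N : MatroidOn E}
    (h : ∀ B, M.toMatroid.IsBase B ↔ N.toMatroid.IsBase B) : M = N := by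
  obtain ⟨M, hM⟩ := M
  obtain ⟨N, hN⟩ := N
  obtain rfl : M = N := Matroid.ext_isBase (hM.trans hN.symm) fun B _ => h B
  rfl

theorem basePolytope_injective : Function.Injective (basePolytope (E := E)) := fun M N h =>
  MatroidOn.ext_isBase fun B => by
    rw [← indicator_mem_basePolytope_iff, h, indicator_mem_basePolytope_iff]

theorem basePolytope_mono {M N : MatroidOn E}
    (h : ∀ B, M.toMatroid.IsBase B → N.toMatroid.IsBase B) : basePolytope M ⊆ basePolytope N :=
  convexHull_mono fun _ ⟨B, hB, e⟩ => ⟨B, h B hB, e⟩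

open Classical in
theorem indicator_exchange {B : Set E} {e f : E} (he : e ∈ B) (hf : f ∉ B) :
    (insert f (B \ {e})).indicator (1 : E → ℝ)
      = B.indicator 1 - Pi.single e 1 + Pi.single f 1 := by
  have hfB : f ∉ B \ {e} := fun h => hf h.1
  rw [Set.insert_eq, Set.indicator_union_of_disjoint (Set.disjoint_singleton_left.2 hfB),
    Set.indicator_sdiff (Set.singleton_subset_iff.2 he), Set.indicator_singleton,
    Set.indicator_singleton, add_comm]
  rfl

theorem exists_symm_exchange {M : Matroid E} {B₁ B₂ : Set E} (h₁ : M.IsBase B₁)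
    (h₂ : M.IsBase B₂) {e : E} (he : e ∈ B₁ \ B₂) :
    ∃ f ∈ B₂ \ B₁, M.IsBase (insert f (B₁ \ {e})) ∧ M.IsBase (insert e (B₂ \ {f})) := by
  have hecl : e ∈ M.closure B₂ := h₂.closure_eq ▸ h₁.subset_ground he.1
  have hC := h₂.indep.fundCircuit_isCircuit hecl he.2
  obtain ⟨f, ⟨hfC, hfe⟩, hfcl⟩ : ∃ f ∈ M.fundCircuit e B₂ \ {e}, f ∉ M.closure (B₁ \ {e}) := by
    by_contra! hcon
    exact h₁.indep.notMem_closure_sdiff_of_mem he.1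
      (M.closure_subset_closure_of_subset_closure hcon
        (hC.mem_closure_sdiff_singleton_of_mem (M.mem_fundCircuit e B₂)))
  have hf₂ : f ∈ B₂ := (M.fundCircuit_subset_insert e B₂ hfC).resolve_left hfe
  have hf₁ : f ∉ B₁ := fun h =>
    hfcl (M.mem_closure_of_mem ⟨h, hfe⟩ (Set.sdiff_subset.trans h₁.subset_ground))
  refine ⟨f, ⟨hf₂, hf₁⟩, h₁.exchange_isBase_of_indep hf₁ ?_, h₂.exchange_isBase_of_indep he.2 ?_⟩
  · exact (h₁.indep.sdiff _).insert_indep_iff.2 (Or.inl ⟨h₂.subset_ground hf₂, hfcl⟩)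
  · have := (h₂.indep.mem_fundCircuit_iff hecl he.2).1 hfC
    rwa [← Set.insert_sdiff_singleton_comm (Ne.symm hfe)] at this

variable [Finite E]

theorem finite_baseVectors (M : MatroidOn E) : (baseVectors M).Finite := by
  refine (Set.finite_range fun B : Set E => B.indicator (1 : E → ℝ)).subset ?_
  rintro _ ⟨B, -, rfl⟩
  exact ⟨B, rfl⟩

theorem MatroidOn.exists_isBase_iff {p : Set E → Prop} (hne : ∃ B, p B)
    (hex : Matroid.ExchangeProperty p) : ∃ M : MatroidOn E, ∀ B, M.toMatroid.IsBase B ↔ p B :=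
  ⟨⟨Matroid.ofIsBaseOfFinite (E := Set.univ) Set.finite_univ p hne hex
    (fun _ _ => Set.subset_univ _), rfl⟩, fun _ => Iff.rfl⟩

theorem exists_isBase_iff_isMax (M : MatroidOn E) (l : (E → ℝ) →ₗ[ℝ] ℝ) :
    ∃ N : MatroidOn E, ∀ B, N.toMatroid.IsBase B ↔ M.toMatroid.IsBase B ∧
      ∀ B', M.toMatroid.IsBase B' → l (B'.indicator 1) ≤ l (B.indicator 1) := by
  classical
  refine MatroidOn.exists_isBase_iff ?_ ?_
  · exact Set.exists_max_image {B | M.toMatroid.IsBase B} (fun B => l (B.indicator 1))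
      (Set.toFinite _) M.toMatroid.exists_isBase
  · rintro B₁ B₂ ⟨h₁, m₁⟩ ⟨h₂, m₂⟩ e he
    obtain ⟨f, hf, hb₁, hb₂⟩ := exists_symm_exchange h₁ h₂ he
    refine ⟨f, hf, hb₁, fun B' hB' => (m₁ B' hB').trans ?_⟩
    -- The two exchanges change `l` by opposite amounts, and neither can increase it.
    have := m₂ _ hb₂
    rw [indicator_exchange hf.1 he.2] at this
    rw [indicator_exchange he.1 hf.2]
    simp only [map_add, map_sub] at this ⊢
    linarith

theorem exists_basePolytope_eq_of_isExposed {M : MatroidOn E} {R : Set (E → ℝ)}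
    (hR : IsExposed ℝ (basePolytope M) R) (hne : R.Nonempty) :
    ∃ N : MatroidOn E, basePolytope N = R := by
  have := Fintype.ofFinite E
  obtain ⟨l, hl⟩ := hR hne
  obtain ⟨N, hN⟩ := exists_isBase_iff_isMax M l.toLinearMap
  refine ⟨N, ?_⟩
  rw [eq_convexHull_of_isExposed (finite_baseVectors M) hR, hl]
  refine congrArg (convexHull ℝ) (Set.ext fun v => ⟨?_, ?_⟩)
  · rintro ⟨B, hB, rfl⟩
    obtain ⟨hBM, hmax⟩ := (hN B).1 hB
    refine ⟨⟨B, hBM, rfl⟩, indicator_mem_basePolytope hBM, fun y hy => ?_⟩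
    refine convexHull_min (s := baseVectors M) (t := {y | l y ≤ l (B.indicator 1)}) ?_
      (convex_halfSpace_le l.isLinear _) hy
    rintro _ ⟨B', hB', rfl⟩
    exact hmax B' hB'
  · rintro ⟨⟨B, hB, rfl⟩, -, hmax⟩
    exact ⟨B, (hN B).2 ⟨hB, fun B' hB' => hmax _ (indicator_mem_basePolytope hB')⟩, rfl⟩

theorem isExposed_basePolytope_trans {M : MatroidOn E} {Q R : Set (E → ℝ)}
    (hQ : IsExposed ℝ (basePolytope M) Q) (hR : IsExposed ℝ Q R) :
    IsExposed ℝ (basePolytope M) R := by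
  have := Fintype.ofFinite E
  exact isExposed_trans_of_finite (finite_baseVectors M) hQ hR

end BasePolytope

section Hypersimplex

variable {E : Type} [Finite E]

/-- The sum of the coordinates in `F`, as a linear functional on `ℝ^E`. -/
def coordSum (F : Set E) : (E → ℝ) →ₗ[ℝ] ℝ := ∑ e ∈ F.toFinite.toFinset, LinearMap.proj e

theorem coordSum_apply (F : Set E) (x : E → ℝ) :
    coordSum F x = ∑ e ∈ F.toFinite.toFinset, x e := by
  simp only [coordSum, LinearMap.sum_apply, LinearMap.proj_apply]

theorem coordSum_indicator (F B : Set E) :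
    coordSum F (B.indicator 1) = ((B ∩ F).ncard : ℝ) := by
  classical
  simp only [coordSum_apply, Set.indicator_apply, Pi.one_apply]
  rw [Finset.sum_boole, Set.ncard_eq_toFinset_card _ (Set.toFinite _)]
  congr 2
  ext x
  simp [and_comm]

theorem coordSum_add_compl (F : Set E) (x : E → ℝ) :
    coordSum F x + coordSum Fᶜ x = coordSum Set.univ x := by
  classical
  rw [coordSum_apply, coordSum_apply, coordSum_apply, ← Finset.sum_union]
  · congr 1
    ext x
    simp [em]
  · rw [Set.Finite.disjoint_toFinset]
    exact disjoint_compl_right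

theorem coordSum_single [DecidableEq E] (F : Set E) (e : E) :
    coordSum F (Pi.single e 1) = F.indicator 1 e := by
  classical
  simp [coordSum_apply, Finset.sum_pi_single', Set.indicator_apply]

variable {κ : Type*}

/-- The product of the hypersimplices `{x ∈ [0,1]^(π⁻¹ j) | ∑ x = m j}` over the blocks of the
partition of `E` into the fibres of `π`. -/
def blockHypersimplex (π : E → κ) (m : κ → ℤ) : Set (E → ℝ) :=
  {x | x ∈ Set.Icc 0 1 ∧ ∀ j, coordSum (π ⁻¹' {j}) x = m j}

variable {π : E → κ} {m : κ → ℤ} {x : E → ℝ}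

theorem exists_ne_of_mem_blockHypersimplex (hx : x ∈ blockHypersimplex π m) {e : E}
    (he : x e ∈ Set.Ioo (0 : ℝ) 1) : ∃ f ≠ e, π f = π e ∧ x f ∈ Set.Ioo (0 : ℝ) 1 := by
  classical
  by_contra! hcon
  let ints : AddSubgroup ℝ := (Int.castAddHom ℝ).range
  have hint : ∀ f ∈ (π ⁻¹' {π e}).toFinite.toFinset.erase e, x f ∈ ints := by
    intro f hf
    rw [Finset.mem_erase, Set.Finite.mem_toFinset] at hf
    rcases (hx.1.1 f).eq_or_lt with h0 | h0
    · exact ⟨0, by rw [map_zero]; exact h0⟩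
    · refine ⟨1, ?_⟩
      by_contra hne
      exact hcon f hf.1 hf.2 ⟨h0, lt_of_le_of_ne (hx.1.2 f) fun h => hne (by simp [h])⟩
  have hsum := hx.2 (π e)
  have hmem : e ∈ (π ⁻¹' {π e}).toFinite.toFinset := (Set.Finite.mem_toFinset _).2 rfl
  rw [coordSum_apply, ← Finset.add_sum_erase _ _ hmem] at hsum
  obtain ⟨n, hn⟩ : x e ∈ ints := by
    rw [eq_sub_of_add_eq hsum]
    exact sub_mem ⟨m (π e), rfl⟩ (sum_mem hint)
  replace hn : (n : ℝ) = x e := hn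
  rw [← hn] at he
  have h0 : (0 : ℤ) < n := by exact_mod_cast he.1
  have h1 : n < (1 : ℤ) := by exact_mod_cast he.2
  omega

theorem eventually_add_smul_mem_blockHypersimplex [DecidableEq E]
    (hx : x ∈ blockHypersimplex π m) {e f : E}
    (he : x e ∈ Set.Ioo (0 : ℝ) 1) (hf : x f ∈ Set.Ioo (0 : ℝ) 1) (hef : π f = π e) :
    ∀ᶠ t in 𝓝 (0 : ℝ), x + t • (Pi.single e 1 - Pi.single f 1) ∈ blockHypersimplex π m := by
  have hcube (i : E) : ∀ᶠ t in 𝓝 (0 : ℝ),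
      (x + t • (Pi.single e 1 - Pi.single f 1) : E → ℝ) i ∈ Set.Icc (0 : ℝ) 1 := by
    have hcont : Continuous fun t : ℝ =>
        (x + t • (Pi.single e 1 - Pi.single f 1) : E → ℝ) i := by fun_prop
    by_cases hi : i = e ∨ i = f
    · have hxi : x i ∈ Set.Ioo (0 : ℝ) 1 := by rcases hi with rfl | rfl <;> assumption
      refine (hcont.tendsto' 0 (x i) (by simp)).eventually ?_
      exact Filter.mem_of_superset (Ioo_mem_nhds hxi.1 hxi.2) Set.Ioo_subset_Icc_self
    · rw [not_or] at hi
      refine Filter.Eventually.of_forall fun t => ?_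
      simpa [hi.1, hi.2] using (⟨hx.1.1 i, hx.1.2 i⟩ : x i ∈ Set.Icc (0 : ℝ) 1)
  filter_upwards [eventually_all.2 hcube] with t ht
  refine ⟨⟨fun i => (ht i).1, fun i => (ht i).2⟩, fun j => ?_⟩
  rw [map_add, map_smul, map_sub, hx.2 j, add_eq_left, smul_eq_zero]
  right
  have hmem : e ∈ π ⁻¹' {j} ↔ f ∈ π ⁻¹' {j} := by
    rw [Set.mem_preimage, Set.mem_preimage, hef]
  rw [coordSum_single, coordSum_single, sub_eq_zero]
  by_cases hf : f ∈ π ⁻¹' {j}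
  · rw [Set.indicator_of_mem hf, Set.indicator_of_mem (hmem.2 hf)]; rfl
  · rw [Set.indicator_of_notMem hf, Set.indicator_of_notMem (mt hmem.1 hf)]

theorem eq_indicator_of_mem_extremePoints_blockHypersimplex
    (hx : x ∈ (blockHypersimplex π m).extremePoints ℝ) : x = {e | x e = 1}.indicator 1 := by
  classical
  funext e
  have hcube := (extremePoints_subset hx).1
  rcases (hcube.1 e).eq_or_lt with h0 | h0
  · have h0 : x e = 0 := h0.symm
    rw [h0, Set.indicator_of_notMem]
    exact fun h1 => zero_ne_one (h0.symm.trans h1)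
  rcases (hcube.2 e).eq_or_lt with h1 | h1
  · rw [Set.indicator_of_mem (by exact h1)]
    exact h1
  · obtain ⟨f, hfe, hπ, hf⟩ := exists_ne_of_mem_blockHypersimplex (extremePoints_subset hx) ⟨h0, h1⟩
    have := congrFun (eq_zero_of_mem_extremePoints hx
      (eventually_add_smul_mem_blockHypersimplex (extremePoints_subset hx) ⟨h0, h1⟩ hf hπ)) e
    simp [hfe.symm] at this

theorem convex_blockHypersimplex : Convex ℝ (blockHypersimplex π m) := by
  rw [blockHypersimplex, Set.ofPred_and, Set.ofPred_forall]
  exact (convex_Icc 0 1).inter (convex_iInter fun j => convex_hyperplane (LinearMap.isLinear _) _)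

theorem isCompact_blockHypersimplex : IsCompact (blockHypersimplex π m) := by
  rw [blockHypersimplex, Set.ofPred_and, Set.ofPred_forall]
  refine isCompact_Icc.inter_right (isClosed_iInter fun j => ?_)
  exact isClosed_eq (LinearMap.continuous_of_finiteDimensional _) continuous_const

theorem blockHypersimplex_subset_convexHull (π : E → κ) (m : κ → ℤ) :
    blockHypersimplex π m ⊆
      convexHull ℝ {x | x ∈ blockHypersimplex π m ∧ ∃ B : Set E, x = B.indicator 1} := by
  set vertices := {x | x ∈ blockHypersimplex π m ∧ ∃ B : Set E, x = B.indicator 1}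
  have hfin : vertices.Finite := by
    refine (Set.finite_range fun B : Set E => B.indicator (1 : E → ℝ)).subset ?_
    rintro _ ⟨-, B, rfl⟩
    exact ⟨B, rfl⟩
  have hext : (blockHypersimplex π m).extremePoints ℝ ⊆ vertices := fun x hx =>
    ⟨extremePoints_subset hx, _, eq_indicator_of_mem_extremePoints_blockHypersimplex hx⟩
  rw [← closure_convexHull_extremePoints isCompact_blockHypersimplex convex_blockHypersimplex]
  exact closure_minimal (convexHull_mono hext) (hfin.isClosed_convexHull ℝ)

end Hypersimplex

section HyperplaneSplit

variable {E : Type}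

/-- The hyperplane `ℓ = c` cuts the base polytope of `M` into those of `M₁` (where `ℓ ≤ c`) and
`M₂` (where `c ≤ ℓ`), which meet in the base polytope of `M₀`. -/
structure IsHyperplaneSplit (ℓ : (E → ℝ) →ₗ[ℝ] ℝ) (c : ℝ) (M M₁ M₂ M₀ : MatroidOn E) : Prop where
  lower : basePolytope M₁ = basePolytope M ∩ {x | ℓ x ≤ c}
  upper : basePolytope M₂ = basePolytope M ∩ {x | c ≤ ℓ x}
  wall : basePolytope M₀ = basePolytope M ∩ {x | ℓ x = c}
  exists_lt : ∃ x ∈ basePolytope M, ℓ x < c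
  exists_gt : ∃ x ∈ basePolytope M, c < ℓ x

/-- The matroids whose base polytopes are faces of the base polytopes of `M₁` or of `M₂`. -/
def faces (M₁ M₂ : MatroidOn E) : Set (MatroidOn E) :=
  {K | IsExposed ℝ (basePolytope M₁) (basePolytope K) ∨
    IsExposed ℝ (basePolytope M₂) (basePolytope K)}

theorem isExposed_inter_of_isExposed {T Q R : Set (E → ℝ)} (hQ : IsExposed ℝ T Q)
    (hR : IsExposed ℝ T R) : IsExposed ℝ Q (Q ∩ R) ∧ IsExposed ℝ R (Q ∩ R) :=
  ⟨(hQ.inter hR).mono hQ.subset Set.inter_subset_left,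
    (hQ.inter hR).mono hR.subset Set.inter_subset_right⟩

namespace IsHyperplaneSplit

variable {ℓ : (E → ℝ) →ₗ[ℝ] ℝ} {c : ℝ} {M M₁ M₂ M₀ K : MatroidOn E}

theorem symm (h : IsHyperplaneSplit ℓ c M M₁ M₂ M₀) :
    IsHyperplaneSplit (-ℓ) (-c) M M₂ M₁ M₀ where
  lower := by simp only [LinearMap.neg_apply, neg_le_neg_iff, h.upper]
  upper := by simp only [LinearMap.neg_apply, neg_le_neg_iff, h.lower]
  wall := by simp only [LinearMap.neg_apply, neg_inj, h.wall]
  exists_lt := by simpa only [LinearMap.neg_apply, neg_lt_neg_iff] using h.exists_gt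
  exists_gt := by simpa only [LinearMap.neg_apply, neg_lt_neg_iff] using h.exists_lt

variable (h : IsHyperplaneSplit ℓ c M M₁ M₂ M₀)
include h

theorem lower_subset : basePolytope M₁ ⊆ basePolytope M := h.lower ▸ Set.inter_subset_left

theorem wall_subset_lower : basePolytope M₀ ⊆ basePolytope M₁ := by
  rw [h.lower, h.wall]
  exact Set.inter_subset_inter_right _ fun x hx => le_of_eq hx

theorem lower_inter_upper : basePolytope M₁ ∩ basePolytope M₂ = basePolytope M₀ := by
  rw [h.lower, h.upper, h.wall, ← Set.inter_inter_distrib_left]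
  exact congrArg _ (Set.ext fun _ => (le_antisymm_iff (α := ℝ)).symm)

theorem lower_ne_upper : M₁ ≠ M₂ := by
  rintro rfl
  obtain ⟨x, hx, hlt⟩ := h.exists_lt
  have hx₁ : x ∈ basePolytope M₁ := h.lower ▸ ⟨hx, hlt.le⟩
  have hx₂ : x ∈ basePolytope M ∩ {x | c ≤ ℓ x} := h.upper ▸ hx₁
  exact hlt.not_ge hx₂.2

variable [Finite E]

theorem isExposed_wall : IsExposed ℝ (basePolytope M₁) (basePolytope M₀) := by
  have heq : basePolytope M₀ = basePolytope M₁ ∩ {x | ℓ x = c} := by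
    rw [h.wall, h.lower, Set.inter_assoc]
    exact congrArg _ (Set.inter_eq_right.2 fun x hx => le_of_eq hx).symm
  have := Fintype.ofFinite E
  rw [heq]
  refine isExposed_inter_eq ℓ.toContinuousLinearMap fun y hy => ?_
  rw [h.lower] at hy
  exact hy.2

theorem isExposed_inter {Q R : Set (E → ℝ)} (hQ : IsExposed ℝ (basePolytope M₁) Q)
    (hR : IsExposed ℝ (basePolytope M₂) R) : IsExposed ℝ Q (Q ∩ R) ∧ IsExposed ℝ R (Q ∩ R) := by
  have hcut : Q ∩ R = (Q ∩ basePolytope M₀) ∩ (R ∩ basePolytope M₀) := by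
    rw [← Set.inter_inter_distrib_right, eq_comm, Set.inter_eq_left, ← h.lower_inter_upper]
    exact Set.inter_subset_inter hQ.subset hR.subset
  have hwall : IsExposed ℝ (basePolytope M₀) (Q ∩ R) := by
    rw [hcut]
    exact (isExposed_inter_of_isExposed hQ h.isExposed_wall).2.inter
      (isExposed_inter_of_isExposed hR h.symm.isExposed_wall).2
  exact ⟨(isExposed_basePolytope_trans h.isExposed_wall hwall).mono hQ.subset
      Set.inter_subset_left,
    (isExposed_basePolytope_trans h.symm.isExposed_wall hwall).mono hR.subset
      Set.inter_subset_right⟩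

theorem isDecomposition : IsDecomposition (faces M₁ M₂) M where
  face_mem := by
    rintro _ ⟨K, hK, rfl⟩ R hne hR
    obtain ⟨K', rfl⟩ := exists_basePolytope_eq_of_isExposed hR hne
    exact ⟨K', hK.imp (isExposed_basePolytope_trans · hR) (isExposed_basePolytope_trans · hR), rfl⟩
  inter_face := by
    rintro _ ⟨K, hK | hK, rfl⟩ _ ⟨K', hK' | hK', rfl⟩
    · exact isExposed_inter_of_isExposed hK hK'
    · exact h.isExposed_inter hK hK'
    · exact h.symm.isExposed_inter hK hK'
    · exact isExposed_inter_of_isExposed hK hK'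
  cover := by
    refine subset_antisymm (fun x hx => ?_) ?_
    · rcases le_total (ℓ x) c with hx' | hx'
      · exact ⟨_, ⟨M₁, Or.inl (IsExposed.refl _), rfl⟩, h.lower ▸ ⟨hx, hx'⟩⟩
      · exact ⟨_, ⟨M₂, Or.inr (IsExposed.refl _), rfl⟩, h.upper ▸ ⟨hx, hx'⟩⟩
    · rintro x ⟨_, ⟨K, hK | hK, rfl⟩, hx⟩
      · exact h.lower_subset (hK.subset hx)
      · exact h.symm.lower_subset (hK.subset hx)

theorem exists_mem_intrinsicInterior :
    ∃ x ∈ intrinsicInterior ℝ (basePolytope M), x ∈ basePolytope M₀ := by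
  have := Fintype.ofFinite E
  obtain ⟨x, hx, hxc⟩ :=
    exists_mem_intrinsicInterior_eq (convex_convexHull ℝ _) h.exists_lt h.exists_gt
  exact ⟨x, hx, h.wall ▸ ⟨intrinsicInterior_subset hx, hxc⟩⟩

theorem dimension_lower : dimension (basePolytope M₁) = dimension (basePolytope M₀) + 1 := by
  have := Fintype.ofFinite E
  obtain ⟨x, hx, hxP⟩ := h.exists_mem_intrinsicInterior
  obtain ⟨y, hy, hyc⟩ := h.exists_gt
  rw [h.wall] at hxP
  rw [dimension, dimension, h.lower, vectorSpan_inter_le hx hxP.2, h.wall]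
  exact finrank_vectorSpan_eq_add_one hx hxP.2 hy hyc

theorem dimension_eq : dimension (basePolytope M) = dimension (basePolytope M₀) + 1 := by
  have := Fintype.ofFinite E
  obtain ⟨x, hx, hxP⟩ := h.exists_mem_intrinsicInterior
  obtain ⟨y, hy, hyc⟩ := h.exists_gt
  rw [h.wall] at hxP
  rw [dimension, dimension, h.wall]
  exact finrank_vectorSpan_eq_add_one hx hxP.2 hy hyc

theorem not_subset_intrinsicFrontier (hK : basePolytope M₀ ⊆ basePolytope K) :
    ¬ basePolytope K ⊆ intrinsicFrontier ℝ (basePolytope M) := fun hcon => by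
  obtain ⟨x, hx, hxP⟩ := h.exists_mem_intrinsicInterior
  have := hcon (hK hxP)
  rw [← intrinsicClosure_sdiff_intrinsicInterior] at this
  exact this.2 hx

theorem eq_of_isExposed (hK : IsExposed ℝ (basePolytope M₁) (basePolytope K))
    (hfr : ¬ basePolytope K ⊆ intrinsicFrontier ℝ (basePolytope M)) : K = M₁ ∨ K = M₀ := by
  have := Fintype.ofFinite E
  obtain ⟨x, hxK, hxf⟩ := Set.not_subset.1 hfr
  have hx : x ∈ intrinsicInterior ℝ (basePolytope M) := by
    rw [← intrinsicClosure_sdiff_intrinsicInterior] at hxf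
    by_contra hcon
    exact hxf ⟨subset_intrinsicClosure (h.lower_subset (hK.subset hxK)), hcon⟩
  rw [h.lower] at hK
  exact (eq_inter_of_isExposed_inter_le (convex_convexHull ℝ _) hx hK hxK).imp
    (fun heq => basePolytope_injective (heq.trans h.lower.symm))
    (fun heq => basePolytope_injective (heq.trans h.wall.symm))

theorem mem_cells_iff {n : ℕ} : K ∈ cells (faces M₁ M₂) M n ↔
    (K = M₀ ∧ n = dimension (basePolytope M₀)) ∨
      ((K = M₁ ∨ K = M₂) ∧ n = dimension (basePolytope M₀) + 1) ∨
      (K = M ∧ n = dimension (basePolytope M₀) + 2) := by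
  have hlower := h.dimension_lower
  have hupper := h.symm.dimension_lower
  have htotal := h.dimension_eq
  constructor
  · rintro (⟨hK, hfr, rfl⟩ | ⟨rfl, rfl⟩)
    · rcases hK with hK | hK
      · rcases h.eq_of_isExposed hK hfr with rfl | rfl
        · exact Or.inr (Or.inl ⟨Or.inl rfl, hlower⟩)
        · exact Or.inl ⟨rfl, rfl⟩
      · rcases h.symm.eq_of_isExposed hK hfr with rfl | rfl
        · exact Or.inr (Or.inl ⟨Or.inr rfl, hupper⟩)
        · exact Or.inl ⟨rfl, rfl⟩
    · exact Or.inr (Or.inr ⟨rfl, by rw [htotal]⟩)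
  · rintro (⟨rfl, rfl⟩ | ⟨rfl | rfl, rfl⟩ | ⟨rfl, rfl⟩)
    · exact Or.inl ⟨Or.inl h.isExposed_wall, h.not_subset_intrinsicFrontier subset_rfl, rfl⟩
    · exact Or.inl ⟨Or.inl (IsExposed.refl _),
        h.not_subset_intrinsicFrontier h.wall_subset_lower, hlower⟩
    · exact Or.inl ⟨Or.inr (IsExposed.refl _),
        h.not_subset_intrinsicFrontier h.symm.wall_subset_lower, hupper⟩
    · exact Or.inr ⟨rfl, by rw [htotal]⟩

end IsHyperplaneSplit

theorem basePolytope_eq_inter_le {ℓ : (E → ℝ) →ₗ[ℝ] ℝ} {c : ℝ} {M M₁ M₀ : MatroidOn E}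
    (hwall : basePolytope M₀ = basePolytope M ∩ {x | ℓ x = c})
    (hlower : ∀ B, M₁.toMatroid.IsBase B ↔ M.toMatroid.IsBase B ∧ ℓ (B.indicator 1) ≤ c) :
    basePolytope M₁ = basePolytope M ∩ {x | ℓ x ≤ c} := by
  apply subset_antisymm
  · refine convexHull_min ?_ ((convex_convexHull ℝ _).inter (convex_halfSpace_le ℓ.isLinear c))
    rintro _ ⟨B, hB, rfl⟩
    exact ⟨indicator_mem_basePolytope ((hlower B).1 hB).1, ((hlower B).1 hB).2⟩
  · refine (convexHull_inter_le_subset (baseVectors M) ℓ c).trans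
      (convexHull_min (Set.union_subset ?_ ?_) (convex_convexHull ℝ _))
    · rintro _ ⟨⟨B, hB, rfl⟩, hBc⟩
      exact indicator_mem_basePolytope ((hlower B).2 ⟨hB, hBc⟩)
    · refine hwall.symm.subset.trans (basePolytope_mono fun B hB => (hlower B).2 ?_)
      have hmem : B.indicator 1 ∈ basePolytope M ∩ {x | ℓ x = c} :=
        hwall ▸ indicator_mem_basePolytope hB
      exact ⟨indicator_mem_basePolytope_iff.1 hmem.1, le_of_eq hmem.2⟩

end HyperplaneSplit

section RelaxationSquare

variable {E : Type} [Finite E]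

/-- `N'` is the relaxation of a matroid `N` of rank `k` at a set `F` of rank `r`, and `L` and `P`
have the bases of `Λ_{r,k,F,E}` and `Π_{r,k,F,E}`. The four base polytopes are related by
`P(N) ∪ P(L) = P(N')` and `P(N) ∩ P(L) = P(P)`. -/
structure IsRelaxationSquare (r k : ℕ) (F : Set E) (N N' L P : MatroidOn E) : Prop where
  ncard_eq : ∀ B, N.toMatroid.IsBase B → B.ncard = k
  inter_le : ∀ B, N.toMatroid.IsBase B → (B ∩ F).ncard ≤ r
  isBase_of_eq : ∀ B : Set E, B.ncard = k → (B ∩ F).ncard = r → N.toMatroid.IsBase B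
  isBase_relaxation_iff : ∀ B, N'.toMatroid.IsBase B ↔
    N.toMatroid.IsBase B ∨ (B.ncard = k ∧ (B ∩ F).ncard = r + 1)
  isBase_wall_iff : ∀ B, P.toMatroid.IsBase B ↔ B.ncard = k ∧ (B ∩ F).ncard = r
  isBase_upper_iff : ∀ B, L.toMatroid.IsBase B ↔
    B.ncard = k ∧ ((B ∩ F).ncard = r ∨ (B ∩ F).ncard = r + 1)

variable {r k : ℕ} {F : Set E} {N N' L P : MatroidOn E}

theorem mem_basePolytope_of_coordSum_eq
    (hP : ∀ B : Set E, B.ncard = k → (B ∩ F).ncard = r → P.toMatroid.IsBase B)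
    {x : E → ℝ} (hx : x ∈ Set.Icc 0 1) (hk : coordSum Set.univ x = k) (hr : coordSum F x = r) :
    x ∈ basePolytope P := by
  classical
  have hpre : (fun e => decide (e ∈ F)) ⁻¹' {true} = F ∧
      (fun e => decide (e ∈ F)) ⁻¹' {false} = Fᶜ := by
    constructor <;> ext e <;> simp
  have hcompl (y : E → ℝ) : coordSum Fᶜ y = coordSum Set.univ y - coordSum F y := by
    rw [← coordSum_add_compl F, add_sub_cancel_left]
  have hmem : x ∈ blockHypersimplex (fun e => decide (e ∈ F))
      (fun b => bif b then (r : ℤ) else k - r) := by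
    refine ⟨hx, Bool.forall_bool.2 ⟨?_, ?_⟩⟩
    · simp [hpre.2, hcompl, hk, hr]
    · simp [hpre.1, hr]
  refine convexHull_mono ?_ (blockHypersimplex_subset_convexHull _ _ hmem)
  rintro _ ⟨hB, B, rfl⟩
  have hF := hB.2 true
  have hFc := hB.2 false
  simp only [hpre.1, coordSum_indicator, cond_true, Int.cast_natCast, Nat.cast_inj] at hF
  simp only [hpre.2, hcompl, coordSum_indicator, hF, Set.inter_univ, cond_false, Int.cast_sub,
    Int.cast_natCast, sub_left_inj, Nat.cast_inj] at hFc
  exact ⟨B, hP B hFc hF, rfl⟩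

namespace IsRelaxationSquare

variable (h : IsRelaxationSquare r k F N N' L P)
include h

omit [Finite E] in
theorem isBase_lower_iff (B : Set E) :
    N.toMatroid.IsBase B ↔ N'.toMatroid.IsBase B ∧ (B ∩ F).ncard ≤ r := by
  rw [h.isBase_relaxation_iff]
  refine ⟨fun hB => ⟨Or.inl hB, h.inter_le B hB⟩, fun ⟨hB, hle⟩ =>
    hB.resolve_right fun hr => r.not_succ_le_self (hr.2.symm.trans_le hle)⟩

omit [Finite E] in
theorem isBase_upper_iff' (B : Set E) :
    L.toMatroid.IsBase B ↔ N'.toMatroid.IsBase B ∧ r ≤ (B ∩ F).ncard := by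
  rw [h.isBase_relaxation_iff, h.isBase_upper_iff]
  constructor
  · rintro ⟨hk, hr | hr⟩
    · exact ⟨Or.inl (h.isBase_of_eq B hk hr), hr.ge⟩
    · exact ⟨Or.inr ⟨hk, hr⟩, by omega⟩
  · rintro ⟨hB | hB, hle⟩
    · exact ⟨h.ncard_eq B hB, Or.inl (le_antisymm (h.inter_le B hB) hle)⟩
    · exact ⟨hB.1, Or.inr hB.2⟩

omit [Finite E] in
theorem wall_subset_lower : basePolytope P ⊆ basePolytope N :=
  basePolytope_mono fun B hB => h.isBase_of_eq B ((h.isBase_wall_iff B).1 hB).1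
    ((h.isBase_wall_iff B).1 hB).2

omit [Finite E] in
theorem wall_subset_upper : basePolytope P ⊆ basePolytope L :=
  basePolytope_mono fun B hB => (h.isBase_upper_iff B).2 <|
    ((h.isBase_wall_iff B).1 hB).imp_right Or.inl

omit [Finite E] in
theorem lower_subset : basePolytope N ⊆ basePolytope N' :=
  basePolytope_mono fun B hB => ((h.isBase_lower_iff B).1 hB).1

omit [Finite E] in
theorem upper_subset : basePolytope L ⊆ basePolytope N' :=
  basePolytope_mono fun B hB => ((h.isBase_upper_iff' B).1 hB).1

theorem wall_eq : basePolytope P = basePolytope N' ∩ {x | coordSum F x = r} := by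
  apply subset_antisymm
  · refine convexHull_min ?_ ((convex_convexHull ℝ _).inter
      (convex_hyperplane (coordSum F).isLinear _))
    rintro _ ⟨B, hB, rfl⟩
    refine ⟨h.lower_subset (h.wall_subset_lower (indicator_mem_basePolytope hB)), ?_⟩
    rw [Set.mem_ofPred_eq, coordSum_indicator, ((h.isBase_wall_iff B).1 hB).2]
  · rintro x ⟨hx, hxr⟩
    refine mem_basePolytope_of_coordSum_eq (fun B hk hr => (h.isBase_wall_iff B).2 ⟨hk, hr⟩)
      (basePolytope_subset_Icc _ hx) ?_ hxr
    refine convexHull_min (s := baseVectors N') (t := {x | coordSum Set.univ x = k}) ?_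
      (convex_hyperplane (coordSum _).isLinear _) hx
    rintro _ ⟨B, hB, rfl⟩
    have hk : B.ncard = k := ((h.isBase_relaxation_iff B).1 hB).elim (h.ncard_eq B) And.left
    rw [Set.mem_ofPred_eq, coordSum_indicator, Set.inter_univ, hk]

theorem isHyperplaneSplit (hlt : ∃ B, N.toMatroid.IsBase B ∧ (B ∩ F).ncard < r)
    (hgt : ∃ B : Set E, B.ncard = k ∧ (B ∩ F).ncard = r + 1) :
    IsHyperplaneSplit (coordSum F) r N' N L P where
  lower := basePolytope_eq_inter_le h.wall_eq fun B => by
    rw [coordSum_indicator, Nat.cast_le, h.isBase_lower_iff]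
  upper := by
    have := basePolytope_eq_inter_le (ℓ := -coordSum F) (c := -r) (M₁ := L)
      (by simpa only [LinearMap.neg_apply, neg_inj] using h.wall_eq) fun B => by
        rw [LinearMap.neg_apply, neg_le_neg_iff, coordSum_indicator, Nat.cast_le,
          h.isBase_upper_iff']
    simpa only [LinearMap.neg_apply, neg_le_neg_iff] using this
  wall := h.wall_eq
  exists_lt := by
    obtain ⟨B, hB, hr⟩ := hlt
    refine ⟨_, h.lower_subset (indicator_mem_basePolytope hB), ?_⟩
    rwa [coordSum_indicator, Nat.cast_lt]
  exists_gt := by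
    obtain ⟨B, hk, hr⟩ := hgt
    refine ⟨_, indicator_mem_basePolytope ((h.isBase_relaxation_iff B).2 (Or.inr ⟨hk, hr⟩)), ?_⟩
    rw [coordSum_indicator, hr, Nat.cast_lt]
    exact r.lt_succ_self

end IsRelaxationSquare

end RelaxationSquare

/-! ### Bicartesian squares -/

section Bicartesian

/-- A square of linear maps `γ ∘ α = δ ∘ β` that is both cartesian and cocartesian. -/
structure IsBicartesian {K X Y Z W : Type*} [Ring K] [AddCommGroup X] [AddCommGroup Y]
    [AddCommGroup Z] [AddCommGroup W] [Module K X] [Module K Y] [Module K Z] [Module K W]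
    (α : X →ₗ[K] Y) (β : X →ₗ[K] Z) (γ : Y →ₗ[K] W) (δ : Z →ₗ[K] W) : Prop where
  comm : ∀ x, γ (α x) = δ (β x)
  eq_zero : ∀ x, α x = 0 → β x = 0 → x = 0
  exists_lift : ∀ y z, γ y = δ z → ∃ x, α x = y ∧ β x = z
  exists_add : ∀ w, ∃ y z, γ y + δ z = w

variable {K X Y Z W : Type*} [AddCommGroup X] [AddCommGroup Y] [AddCommGroup Z] [AddCommGroup W]

section Ring

variable [Ring K] [Module K X] [Module K Y] [Module K Z] [Module K W]
  {α : X →ₗ[K] Y} {β : X →ₗ[K] Z} {γ : Y →ₗ[K] W} {δ : Z →ₗ[K] W}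

theorem IsBicartesian.symm (h : IsBicartesian α β γ δ) : IsBicartesian β α δ γ where
  comm x := (h.comm x).symm
  eq_zero x hβ hα := h.eq_zero x hα hβ
  exists_lift z y hzy := (h.exists_lift y z hzy.symm).imp fun _ => And.symm
  exists_add w := by
    obtain ⟨y, z, rfl⟩ := h.exists_add w
    exact ⟨z, y, add_comm _ _⟩

theorem isBicartesian_of_bijective (hcomm : ∀ x, γ (α x) = δ (β x))
    (hα : Function.Bijective α) (hδ : Function.Bijective δ) : IsBicartesian α β γ δ where
  comm := hcomm
  eq_zero x hx _ := hα.1 (by rw [hx, map_zero])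
  exists_lift y z h := by
    obtain ⟨x, rfl⟩ := hα.2 y
    exact ⟨x, rfl, hδ.1 (by rw [← h, hcomm])⟩
  exists_add w := by
    obtain ⟨z, rfl⟩ := hδ.2 w
    exact ⟨0, z, by rw [map_zero, zero_add]⟩

theorem IsBicartesian.congr {Z' W' : Type*} [AddCommGroup Z'] [AddCommGroup W'] [Module K Z']
    [Module K W'] (h : IsBicartesian α β γ δ) (e : Z ≃ₗ[K] Z') (e' : W ≃ₗ[K] W')
    {β' : X →ₗ[K] Z'} {γ' : Y →ₗ[K] W'} {δ' : Z' →ₗ[K] W'} (hβ : ∀ x, e (β x) = β' x)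
    (hγ : ∀ y, e' (γ y) = γ' y) (hδ : ∀ z, e' (δ z) = δ' (e z)) : IsBicartesian α β' γ' δ' where
  comm x := by rw [← hγ, h.comm, hδ, hβ]
  eq_zero x hx hx' := h.eq_zero x hx (e.map_eq_zero_iff.1 ((hβ x).trans hx'))
  exists_lift y z hyz := by
    obtain ⟨x, hx, hx'⟩ := h.exists_lift y (e.symm z) (e'.injective (by simp [hγ, hδ, hyz]))
    exact ⟨x, hx, by simp [← hβ, hx']⟩
  exists_add w := by
    obtain ⟨y, z, hyz⟩ := h.exists_add (e'.symm w)
    exact ⟨y, e z, by rw [← hγ, ← hδ, ← map_add, hyz, e'.apply_symm_apply]⟩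

end Ring

section Field

variable [Field K] [Module K X] [Module K Y] [Module K Z] [Module K W]
  {α : X →ₗ[K] Y} {β : X →ₗ[K] Z} {γ : Y →ₗ[K] W} {δ : Z →ₗ[K] W} {ε₁ ε₂ ε₃ ε₄ : K}

theorem exists_lift_of_smul (hcomm : ∀ x, γ (α x) = δ (β x)) (h₁ : ε₁ ≠ 0) (h₂ : ε₂ ≠ 0)
    (h₃ : ε₃ ≠ 0) (h₄ : ε₄ ≠ 0)
    (hlift : ∀ y z, ε₃ • γ y + ε₄ • δ z = 0 → ∃ x, ε₁ • α x = y ∧ ε₂ • β x = z)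
    {y : Y} {z : Z} (hyz : γ y = δ z) : ∃ x, α x = y ∧ β x = z := by
  obtain ⟨x, hy, hz⟩ := hlift (ε₃⁻¹ • y) (-ε₄⁻¹ • z) (by
    rw [map_smul, map_smul, smul_inv_smul₀ h₃, neg_smul, smul_neg, smul_inv_smul₀ h₄, hyz,
      add_neg_cancel])
  have hα : (ε₁ * ε₃) • α x = y := by rw [mul_comm, mul_smul, hy, smul_inv_smul₀ h₃]
  have hβ : -(ε₂ * ε₄) • β x = z := by
    rw [mul_comm, neg_smul, mul_smul, hz, neg_smul, smul_neg, neg_neg, smul_inv_smul₀ h₄]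
  by_cases hε : ε₁ * ε₃ = -(ε₂ * ε₄)
  · exact ⟨(ε₁ * ε₃) • x, by rw [map_smul, hα], by rw [map_smul, hε, hβ]⟩
  -- the square commutes and anticommutes up to scalars, so the diagonal kills `x`
  have hx : γ (α x) = 0 := by
    have h0 : (ε₁ * ε₃ - -(ε₂ * ε₄)) • γ (α x) = 0 := by
      rw [sub_smul, ← map_smul, hα, hcomm, ← map_smul δ, hβ, hyz, sub_self]
    exact (smul_eq_zero.1 h0).resolve_left (sub_ne_zero.2 hε)
  have hγ : γ y = 0 := by rw [← hα, map_smul, hx, smul_zero]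
  obtain ⟨x₁, hx₁, hx₁'⟩ := hlift y 0 (by rw [hγ, map_zero, smul_zero, smul_zero, add_zero])
  obtain ⟨x₂, hx₂, hx₂'⟩ := hlift 0 z (by
    rw [← hyz, hγ, map_zero, smul_zero, smul_zero, add_zero])
  have hβ₁ : β x₁ = 0 := (smul_eq_zero.1 hx₁').resolve_left h₂
  have hα₂ : α x₂ = 0 := (smul_eq_zero.1 hx₂).resolve_left h₁
  exact ⟨ε₁ • x₁ + ε₂ • x₂, by rw [map_add, map_smul, map_smul, hx₁, hα₂, smul_zero, add_zero],
    by rw [map_add, map_smul, map_smul, hx₂', hβ₁, smul_zero, zero_add]⟩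

/-- Exactness of `X → Y × Z → W` with the maps rescaled arbitrarily makes the commutative square
bicartesian: the signs of an oriented complex are immaterial. -/
theorem isBicartesian_of_smul (hcomm : ∀ x, γ (α x) = δ (β x)) (h₁ : ε₁ ≠ 0) (h₂ : ε₂ ≠ 0)
    (h₃ : ε₃ ≠ 0) (h₄ : ε₄ ≠ 0) (hinj : ∀ x, ε₁ • α x = 0 → ε₂ • β x = 0 → x = 0)
    (hlift : ∀ y z, ε₃ • γ y + ε₄ • δ z = 0 → ∃ x, ε₁ • α x = y ∧ ε₂ • β x = z)
    (hsurj : ∀ w, ∃ y z, ε₃ • γ y + ε₄ • δ z = w) : IsBicartesian α β γ δ where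
  comm := hcomm
  eq_zero x hα hβ := hinj x (by rw [hα, smul_zero]) (by rw [hβ, smul_zero])
  exists_lift _ _ := exists_lift_of_smul hcomm h₁ h₂ h₃ h₄ hlift
  exists_add w := by
    obtain ⟨y, z, rfl⟩ := hsurj w
    exact ⟨ε₃ • y, ε₄ • z, by rw [map_smul, map_smul]⟩

end Field

end Bicartesian

/-! ### Exactness of contractible complexes -/

section Contractible

variable {A : Type} (a : A)

/-- The degree `a` part of a morphism of graded vector spaces. -/
def evalHom {X Y : GrVect A} (f : X ⟶ Y) : (X.obj a : Type) →ₗ[ℚ] (Y.obj a : Type) := (f.hom a).hom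

theorem evalHom_id (X : GrVect A) : evalHom a (𝟙 X) = LinearMap.id := rfl

theorem evalHom_comp {X Y Z : GrVect A} (f : X ⟶ Y) (g : Y ⟶ Z) :
    evalHom a (f ≫ g) = evalHom a g ∘ₗ evalHom a f := rfl

theorem evalHom_zero (X Y : GrVect A) : evalHom a (0 : X ⟶ Y) = 0 := rfl

theorem evalHom_add {X Y : GrVect A} (f g : X ⟶ Y) :
    evalHom a (f + g) = evalHom a f + evalHom a g := rfl

theorem evalHom_smul {X Y : GrVect A} (c : ℚ) (f : X ⟶ Y) :
    evalHom a (c • f) = c • evalHom a f := rfl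

theorem evalHom_sum {X Y : GrVect A} {ι : Type*} (s : Finset ι) (f : ι → (X ⟶ Y)) :
    evalHom a (∑ i ∈ s, f i) = ∑ i ∈ s, evalHom a (f i) :=
  map_sum (AddMonoidHom.mk' (evalHom a) (evalHom_add a)) f s

section Biproduct

variable {ι : Type} [Finite ι] (f : ι → GrVect A)

theorem bijective_pi_evalHom_π :
    Function.Bijective (LinearMap.pi fun i => evalHom a (biproduct.π f i)) := by
  classical
  have := Fintype.ofFinite ι
  refine ⟨?_, fun v => ⟨∑ i, evalHom a (biproduct.ι f i) (v i), funext fun j => ?_⟩⟩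
  · refine (injective_iff_map_eq_zero _).2 fun x hx => ?_
    have h : ∑ i, evalHom a (biproduct.π f i ≫ biproduct.ι f i) x = x := by
      rw [← LinearMap.sum_apply, ← evalHom_sum, biproduct.total, evalHom_id, LinearMap.id_apply]
    rw [← h]
    refine Finset.sum_eq_zero fun i _ => ?_
    rw [evalHom_comp, LinearMap.comp_apply, show evalHom a (biproduct.π f i) x = 0 from
      congrFun hx i, map_zero]
  · rw [LinearMap.pi_apply, map_sum, Finset.sum_eq_single_of_mem j (Finset.mem_univ j)]
    · rw [← LinearMap.comp_apply, ← evalHom_comp, biproduct.ι_π_self, evalHom_id,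
        LinearMap.id_apply]
    · intro i _ hij
      rw [← LinearMap.comp_apply, ← evalHom_comp, biproduct.ι_π_ne _ hij, evalHom_zero,
        LinearMap.zero_apply]

/-- The degree `a` part of a direct sum, as the product of the degree `a` parts. -/
def biproductEquiv : ((⨁ f).obj a : Type) ≃ₗ[ℚ] ∀ i, ((f i).obj a : Type) :=
  LinearEquiv.ofBijective _ (bijective_pi_evalHom_π a f)

theorem biproductEquiv_matrix {ι κ : Type} [Fintype ι] [Finite κ] (f : ι → GrVect A)
    {g : κ → GrVect A} (d : ∀ i j, f i ⟶ g j) (x : ((⨁ f).obj a : Type)) (j : κ) :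
    biproductEquiv a g (evalHom a (biproduct.matrix d) x) j =
      ∑ i, evalHom a (d i j) (biproductEquiv a f x i) := by
  have h : biproduct.matrix d ≫ biproduct.π g j = ∑ i, biproduct.π f i ≫ d i j := by
    rw [biproduct.matrix_π, biproduct.desc_eq]
  change evalHom a (biproduct.π g j) (evalHom a (biproduct.matrix d) x) = _
  rw [← LinearMap.comp_apply, ← evalHom_comp, h, evalHom_sum, LinearMap.sum_apply]
  rfl

end Biproduct

theorem IsContractible.surjective_zero {X : ℕ → GrVect A} {d : ∀ k, X (k + 1) ⟶ X k}
    (h : IsContractible X d) : Function.Surjective (evalHom a (d 0)) := by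
  obtain ⟨s, h0, -⟩ := h
  exact fun x => ⟨evalHom a (s 0) x, LinearMap.congr_fun (congrArg (evalHom a) h0) x⟩

theorem IsContractible.exists_of_eq_zero {X : ℕ → GrVect A} {d : ∀ k, X (k + 1) ⟶ X k}
    (h : IsContractible X d) {k : ℕ} {x : ((X (k + 1)).obj a : Type)}
    (hx : evalHom a (d k) x = 0) : ∃ y, evalHom a (d (k + 1)) y = x := by
  obtain ⟨s, -, hs⟩ := h
  have h1 : evalHom a (s k) (evalHom a (d k) x) +
      evalHom a (d (k + 1)) (evalHom a (s (k + 1)) x) = x :=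
    LinearMap.congr_fun (congrArg (evalHom a) (hs k)) x
  exact ⟨_, by rwa [hx, map_zero, zero_add] at h1⟩

section Matrix

variable {J : ℕ → Type} {f : ∀ k, J k → GrVect A}
  {d : ∀ k (i : J (k + 1)) (j : J k), f (k + 1) i ⟶ f k j}

theorem IsContractible.exists_of_sum_eq_zero [∀ k, Fintype (J k)]
    (h : IsContractible (fun k => ⨁ f k) fun k => biproduct.matrix (d k))
    {k : ℕ} {v : ∀ i, ((f (k + 1) i).obj a : Type)}
    (hv : ∀ j, ∑ i, evalHom a (d k i j) (v i) = 0) :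
    ∃ u : ∀ l, ((f (k + 2) l).obj a : Type), ∀ i, ∑ l, evalHom a (d (k + 1) l i) (u l) = v i := by
  obtain ⟨y, hy⟩ := h.exists_of_eq_zero a (x := (biproductEquiv a (f (k + 1))).symm v) (by
    refine (biproductEquiv a (f k)).injective (funext fun j => ?_)
    rw [biproductEquiv_matrix, LinearEquiv.apply_symm_apply, hv, map_zero, Pi.zero_apply])
  exact ⟨biproductEquiv a _ y, fun i => by
    rw [← biproductEquiv_matrix, hy, LinearEquiv.apply_symm_apply]⟩

theorem IsContractible.exists_sum_eq [∀ k, Fintype (J k)]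
    (h : IsContractible (fun k => ⨁ f k) fun k => biproduct.matrix (d k))
    {k : ℕ} (hk : ∀ n, n + 1 = k → IsEmpty (J n))
    (v : ∀ i, ((f k i).obj a : Type)) :
    ∃ u : ∀ l, ((f (k + 1) l).obj a : Type), ∀ i, ∑ l, evalHom a (d k l i) (u l) = v i := by
  cases k with
  | zero =>
    obtain ⟨y, hy⟩ := h.surjective_zero a ((biproductEquiv a (f 0)).symm v)
    exact ⟨biproductEquiv a _ y, fun i => by
      rw [← biproductEquiv_matrix, hy, LinearEquiv.apply_symm_apply]⟩
  | succ n => exact h.exists_of_sum_eq_zero a fun j => ((hk n rfl).false j).elim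

/-- A contractible complex `0 → V_t → V_n ⊕ V_l → V_p → 0` is a short exact sequence. -/
theorem IsContractible.exact_of_pair [∀ k, Finite (J k)]
    (h : IsContractible (fun k => ⨁ f k) fun k => biproduct.matrix (d k))
    {m : ℕ} {t : J (m + 2)} {n l : J (m + 1)} {p : J m}
    (hbelow : ∀ k, k + 1 = m → IsEmpty (J k)) (hp : ∀ i : J m, i = p)
    (hnl : n ≠ l) (hpair : ∀ i : J (m + 1), i = n ∨ i = l) (ht : ∀ i : J (m + 2), i = t)
    (habove : IsEmpty (J (m + 3))) :
    (∀ x, evalHom a (d (m + 1) t n) x = 0 → evalHom a (d (m + 1) t l) x = 0 → x = 0) ∧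
    (∀ y z, evalHom a (d m n p) y + evalHom a (d m l p) z = 0 →
      ∃ x, evalHom a (d (m + 1) t n) x = y ∧ evalHom a (d (m + 1) t l) x = z) ∧
    ∀ w, ∃ y z, evalHom a (d m n p) y + evalHom a (d m l p) z = w := by
  classical
  have := fun k => Fintype.ofFinite (J k)
  have sum_pair {M : Type} [AddCommMonoid M] (G : J (m + 1) → M) : ∑ i, G i = G n + G l :=
    Fintype.sum_eq_add n l hnl fun i hi => ((hpair i).elim hi.1 hi.2).elim
  have sum_top {M : Type} [AddCommMonoid M] (G : J (m + 2) → M) : ∑ i, G i = G t :=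
    Fintype.sum_eq_single t fun i hi => (hi (ht i)).elim
  refine ⟨fun x hn hl => ?_, fun y z hyz => ?_, fun w => ?_⟩
  · obtain ⟨u, hu⟩ := h.exists_of_sum_eq_zero a (k := m + 1) (v := Pi.single t x) (by
      intro j
      rw [sum_top, Pi.single_eq_same]
      rcases hpair j with rfl | rfl
      exacts [hn, hl])
    rw [← Pi.single_eq_same (M := fun i => ((f (m + 2) i).obj a : Type)) t x, ← hu,
      Fintype.sum_empty]
  · obtain ⟨u, hu⟩ := h.exists_of_sum_eq_zero a (k := m) (v := Pi.single n y + Pi.single l z) (by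
      intro j
      rw [hp j, sum_pair, Pi.add_apply, Pi.add_apply, Pi.single_eq_same, Pi.single_eq_same,
        Pi.single_eq_of_ne hnl, Pi.single_eq_of_ne hnl.symm, add_zero, zero_add, hyz])
    simp only [sum_top, Pi.add_apply] at hu
    exact ⟨u t, by rw [hu, Pi.single_eq_same, Pi.single_eq_of_ne hnl, add_zero],
      by rw [hu, Pi.single_eq_same, Pi.single_eq_of_ne hnl.symm, zero_add]⟩
  · obtain ⟨u, hu⟩ := h.exists_sum_eq a hbelow (Pi.single p w)
    exact ⟨u n, u l, by rw [← sum_pair fun i => evalHom a (d m i p) (u i), hu, Pi.single_eq_same]⟩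

end Matrix

end Contractible

section Orientation

variable {E : Type} [Finite E]

theorem nontrivial_topPower (W : Submodule ℝ (E → ℝ)) : Nontrivial (topPower W) := by
  have hpos : 0 < finrank ℝ (⋀[ℝ]^(finrank ℝ W) W) := by
    rw [exteriorPower.finrank_eq, Nat.choose_self]
    exact one_pos
  have := Module.nontrivial_of_finrank_pos hpos
  obtain ⟨x, hx⟩ := exists_ne (0 : ⋀[ℝ]^(finrank ℝ W) W)
  have hinj : Function.Injective (ExteriorAlgebra.map W.subtype) :=
    ExteriorAlgebra.map_injective_field (LinearMap.ker_eq_bot.2 W.injective_subtype)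
  refine ⟨⟨_, Submodule.mem_map_of_mem x.2⟩, 0, fun h0 => hx (Subtype.ext (hinj ?_))⟩
  rw [Submodule.coe_zero, map_zero]
  exact congrArg Subtype.val h0

instance nonempty_polytopeOrientation (P : Set (E → ℝ)) : Nonempty (PolytopeOrientation P) := by
  have := nontrivial_topPower (vectorSpan ℝ P)
  obtain ⟨x, hx⟩ := exists_ne (0 : topPower (vectorSpan ℝ P))
  exact ⟨rayOfNeZero ℝ x hx⟩

instance nonempty_decompositionOrientation (M : MatroidOn E) :
    Nonempty (DecompositionOrientation M) :=
  ⟨⟨fun _ => Classical.arbitrary _, Classical.arbitrary _⟩⟩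

end Orientation

/-! ### Valuative functors on hyperplane splits and relaxations -/

section Valuative

variable {E : Type} [Finite E]

section Piece

variable {A : Type} (Φ : MatroidCat ⥤ GrVect A) (a : A)

/-- The degree `a` part of the value of a functor at an object. -/
abbrev piece (X : MatroidCat) : Type := ((Φ.obj X).obj a : Type)

/-- The degree `a` part of the value of a functor at a morphism. -/
def pieceMap {X Y : MatroidCat} (f : X ⟶ Y) : piece Φ a X →ₗ[ℚ] piece Φ a Y := evalHom a (Φ.map f)

theorem pieceMap_id (X : MatroidCat) : pieceMap Φ a (𝟙 X) = LinearMap.id := by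
  rw [pieceMap, Φ.map_id, evalHom_id]

theorem pieceMap_comp {X Y Z : MatroidCat} (f : X ⟶ Y) (g : Y ⟶ Z) (x : piece Φ a X) :
    pieceMap Φ a (f ≫ g) x = pieceMap Φ a g (pieceMap Φ a f x) := by
  rw [pieceMap, Φ.map_comp, evalHom_comp]
  rfl

/-- The morphism `ι_{X,Y}` of `𝓜` given by the identity of `E`. -/
def iota {X Y : MatroidOn E} (h : basePolytope Y ⊆ basePolytope X) :
    MatroidCat.mk E X ⟶ MatroidCat.mk E Y :=
  (MatroidId.inclusion E).map (X := MatroidId.mk X) (Y := MatroidId.mk Y) ⟨h⟩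

theorem iota_comp {X Y Z : MatroidOn E} (h : basePolytope Y ⊆ basePolytope X)
    (h' : basePolytope Z ⊆ basePolytope Y) : iota h ≫ iota h' = iota (h'.trans h) := rfl

theorem iota_self {X : MatroidOn E} (h : basePolytope X ⊆ basePolytope X) :
    iota h = 𝟙 (MatroidCat.mk E X) := rfl

theorem pieceMap_iota_comp {X Y Z : MatroidOn E} (h : basePolytope Y ⊆ basePolytope X)
    (h' : basePolytope Z ⊆ basePolytope Y) (x : piece Φ a ⟨E, X⟩) :
    pieceMap Φ a (iota h') (pieceMap Φ a (iota h) x) = pieceMap Φ a (iota (h'.trans h)) x := by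
  rw [← iota_comp h h', pieceMap_comp]

theorem bijective_pieceMap_iota {X Y : MatroidOn E} (h : basePolytope Y ⊆ basePolytope X)
    (hXY : X = Y) : Function.Bijective (pieceMap Φ a (iota h)) := by
  subst hXY
  rw [iota_self, pieceMap_id]
  exact Function.bijective_id

/-- The image under `Φ` of the component `X → Y` of the differential of the complex of a
decomposition. -/
def incidenceMap {M : MatroidOn E} (Ω : DecompositionOrientation M) (k : ℕ) (X Y : MatroidOn E) :
    Φ.obj ⟨E, X⟩ ⟶ Φ.obj ⟨E, Y⟩ :=
  (Free.lift ℚ (MatroidId.inclusion E ⋙ Φ)).map (incidence Ω k X Y)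

theorem lift_map_smul_embedding {C D : Type 1} [Category.{0} C] [Category.{0} D] [Preadditive D]
    [Linear ℚ D] (G : C ⥤ D) {X Y : C} (c : ℚ) (f : X ⟶ Y) :
    (Free.lift ℚ G).map (c • (Free.embedding ℚ C).map f) = c • G.map f := by
  rw [Functor.map_smul]
  congr 1
  exact (Free.lift_map_single ℚ G f 1).trans (one_smul ℚ _)

theorem exists_evalHom_incidenceMap_eq {M : MatroidOn E} (Ω : DecompositionOrientation M) {k : ℕ}
    {X Y : MatroidOn E} (h : basePolytope Y ⊆ basePolytope X)
    (hk : k = dimension (basePolytope M) ∨ IsExposed ℝ (basePolytope X) (basePolytope Y)) :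
    ∃ ε : ℚ, ε ≠ 0 ∧ evalHom a (incidenceMap Φ Ω k X Y) = ε • pieceMap Φ a (iota h) := by
  classical
  obtain ⟨ε, hε, hinc⟩ : ∃ ε : ℚ, ε ≠ 0 ∧ incidence Ω k X Y = ε •
      (Free.embedding ℚ (MatroidId E)).map (X := MatroidId.mk X) (Y := MatroidId.mk Y) ⟨h⟩ := by
    refine ⟨_, ?_, dif_pos h⟩
    split_ifs <;> simp_all
  have hmap : incidenceMap Φ Ω k X Y = ε • Φ.map (iota h) :=
    (congrArg _ hinc).trans (lift_map_smul_embedding (MatroidId.inclusion E ⋙ Φ) ε _)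
  exact ⟨ε, hε, by rw [hmap, evalHom_smul, pieceMap]⟩

end Piece

variable {A : Type} {Φ : MatroidCat ⥤ GrVect A} (hΦ : IsValuative Φ) (a : A)
include hΦ

/-- The complex of the decomposition into the faces of `M₁` and `M₂` is
`M → M₁ ⊕ M₂ → M₀`, up to signs. -/
theorem IsHyperplaneSplit.isBicartesian {ℓ : (E → ℝ) →ₗ[ℝ] ℝ} {c : ℝ} {M M₁ M₂ M₀ : MatroidOn E}
    (h : IsHyperplaneSplit ℓ c M M₁ M₂ M₀) :
    IsBicartesian (pieceMap Φ a (iota h.lower_subset)) (pieceMap Φ a (iota h.symm.lower_subset))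
      (pieceMap Φ a (iota h.wall_subset_lower))
      (pieceMap Φ a (iota h.symm.wall_subset_lower)) := by
  obtain ⟨Ω⟩ := nonempty_decompositionOrientation M
  have hdim := h.dimension_eq
  set m := dimension (basePolytope M₀) with hm
  have mem_wall : M₀ ∈ cells (faces M₁ M₂) M m := h.mem_cells_iff.2 (Or.inl ⟨rfl, hm⟩)
  have mem_lower : M₁ ∈ cells (faces M₁ M₂) M (m + 1) :=
    h.mem_cells_iff.2 (Or.inr (Or.inl ⟨Or.inl rfl, rfl⟩))
  have mem_upper : M₂ ∈ cells (faces M₁ M₂) M (m + 1) :=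
    h.mem_cells_iff.2 (Or.inr (Or.inl ⟨Or.inr rfl, rfl⟩))
  have mem_total : M ∈ cells (faces M₁ M₂) M (m + 2) :=
    h.mem_cells_iff.2 (Or.inr (Or.inr ⟨rfl, rfl⟩))
  obtain ⟨ε₁, h₁, e₁⟩ := exists_evalHom_incidenceMap_eq Φ a Ω h.lower_subset (Or.inl hdim.symm)
  obtain ⟨ε₂, h₂, e₂⟩ :=
    exists_evalHom_incidenceMap_eq Φ a Ω h.symm.lower_subset (Or.inl hdim.symm)
  obtain ⟨ε₃, h₃, e₃⟩ :=
    exists_evalHom_incidenceMap_eq Φ a Ω (k := m) h.wall_subset_lower (Or.inr h.isExposed_wall)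
  obtain ⟨ε₄, h₄, e₄⟩ := exists_evalHom_incidenceMap_eq Φ a Ω (k := m) h.symm.wall_subset_lower
    (Or.inr h.symm.isExposed_wall)
  have hcontr : IsContractible (fun k => ⨁ fun i : cells (faces M₁ M₂) M k => Φ.obj ⟨E, i.1⟩)
      fun k => biproduct.matrix fun i j => incidenceMap Φ Ω k i.1 j.1 :=
    hΦ E M (faces M₁ M₂) Ω h.isDecomposition
  obtain ⟨hinj, hlift, hsurj⟩ := hcontr.exact_of_pair a (m := m) (t := ⟨M, mem_total⟩)
    (n := ⟨M₁, mem_lower⟩) (l := ⟨M₂, mem_upper⟩) (p := ⟨M₀, mem_wall⟩)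
    (fun k hk => ⟨fun i => by have := h.mem_cells_iff.1 i.2; omega⟩)
    (fun i => Subtype.ext (by have := h.mem_cells_iff.1 i.2; grind))
    (fun heq => h.lower_ne_upper (congrArg Subtype.val heq))
    (fun i => by have := h.mem_cells_iff.1 i.2; grind)
    (fun i => Subtype.ext (by have := h.mem_cells_iff.1 i.2; grind))
    ⟨fun i => by have := h.mem_cells_iff.1 i.2; omega⟩
  simp only [e₁, e₂, e₃, e₄, LinearMap.smul_apply] at hinj hlift hsurj
  refine isBicartesian_of_smul (fun x => ?_) h₁ h₂ h₃ h₄ hinj hlift hsurj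
  rw [pieceMap_iota_comp, pieceMap_iota_comp]

theorem IsRelaxationSquare.isBicartesian {r k : ℕ} {F : Set E} {N N' L P : MatroidOn E}
    (h : IsRelaxationSquare r k F N N' L P) :
    IsBicartesian (pieceMap Φ a (iota h.lower_subset)) (pieceMap Φ a (iota h.upper_subset))
      (pieceMap Φ a (iota h.wall_subset_lower)) (pieceMap Φ a (iota h.wall_subset_upper)) := by
  have hcomm (x) : pieceMap Φ a (iota h.wall_subset_lower) (pieceMap Φ a (iota h.lower_subset) x) =
      pieceMap Φ a (iota h.wall_subset_upper) (pieceMap Φ a (iota h.upper_subset) x) := by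
    rw [pieceMap_iota_comp, pieceMap_iota_comp]
  by_cases hgt : ∃ B : Set E, B.ncard = k ∧ (B ∩ F).ncard = r + 1
  · by_cases hlt : ∃ B, N.toMatroid.IsBase B ∧ (B ∩ F).ncard < r
    · exact (h.isHyperplaneSplit hlt hgt).isBicartesian hΦ a
    · have hr (B) (hB : N.toMatroid.IsBase B) : r ≤ (B ∩ F).ncard :=
        not_lt.1 fun hlt' => hlt ⟨B, hB, hlt'⟩
      refine (isBicartesian_of_bijective (fun x => (hcomm x).symm)
        (bijective_pieceMap_iota Φ a _ (MatroidOn.ext_isBase fun B => ?_))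
        (bijective_pieceMap_iota Φ a _ (MatroidOn.ext_isBase fun B => ?_))).symm
      · rw [h.isBase_upper_iff', iff_self_and, h.isBase_relaxation_iff]
        exact fun hB => hB.elim (hr B) fun hB => hB.2 ▸ r.le_succ
      · rw [h.isBase_wall_iff]
        exact ⟨fun hB => ⟨h.ncard_eq B hB, (h.inter_le B hB).antisymm (hr B hB)⟩,
          fun hB => h.isBase_of_eq B hB.1 hB.2⟩
  · refine isBicartesian_of_bijective hcomm
      (bijective_pieceMap_iota Φ a _ (MatroidOn.ext_isBase fun B => ?_))
      (bijective_pieceMap_iota Φ a _ (MatroidOn.ext_isBase fun B => ?_))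
    · rw [h.isBase_relaxation_iff, or_iff_left fun hB => hgt ⟨B, hB⟩]
    · rw [h.isBase_wall_iff, h.isBase_upper_iff]
      exact and_congr_right fun hk => or_iff_left fun hr => hgt ⟨B, hk, hr⟩

end Valuative

/-! ### Iterated relaxations -/

section Iteration

section Paste

variable {K ι X X' Y : Type*} {Z W : ι → Type*} [Ring K] [AddCommGroup X] [AddCommGroup X']
  [AddCommGroup Y] [∀ i, AddCommGroup (Z i)] [∀ i, AddCommGroup (W i)] [Module K X] [Module K X']
  [Module K Y] [∀ i, Module K (Z i)] [∀ i, Module K (W i)] {γ : ∀ i, Y →ₗ[K] W i}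
  {δ : ∀ i, Z i →ₗ[K] W i}

theorem isBicartesian_pi_of_isEmpty [IsEmpty ι] {α : X →ₗ[K] Y} {β : ∀ i, X →ₗ[K] Z i}
    (hα : Function.Bijective α) : IsBicartesian α (LinearMap.pi β) (LinearMap.pi γ)
      (LinearMap.pi fun i => δ i ∘ₗ LinearMap.proj i) :=
  isBicartesian_of_bijective (fun _ => Subsingleton.elim _ _) hα
    ⟨fun _ _ _ => Subsingleton.elim _ _, fun w => ⟨0, Subsingleton.elim _ w⟩⟩

theorem forall_coe_insert [DecidableEq ι] {s : Finset ι} {j : ι} {p : ↥(insert j s) → Prop}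
    (hj : p ⟨j, s.mem_insert_self j⟩) (hs : ∀ i : s, p ⟨i, Finset.mem_insert_of_mem i.2⟩)
    (i : ↥(insert j s)) : p i := by
  obtain ⟨i, hi⟩ := i
  obtain rfl | hi' := Finset.mem_insert.1 hi
  exacts [hj, hs ⟨i, hi'⟩]

theorem IsBicartesian.pi_insert [DecidableEq ι] {s : Finset ι} {j : ι} {α : X →ₗ[K] Y}
    {α' : X' →ₗ[K] X} {α'' : X' →ₗ[K] Y} {β : ∀ i : s, X →ₗ[K] Z i}
    {β' : ∀ i : ↥(insert j s), X' →ₗ[K] Z i} {γ' : X →ₗ[K] W j}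
    (h : IsBicartesian α (LinearMap.pi β) (LinearMap.pi fun i : s => γ i)
      (LinearMap.pi fun i : s => δ i ∘ₗ LinearMap.proj i))
    (hj : IsBicartesian α' (β' ⟨j, s.mem_insert_self j⟩) γ' (δ j))
    (hα : ∀ x, α'' x = α (α' x)) (hγ : ∀ x, γ' x = γ j (α x))
    (hβ : ∀ (i : s) x, β' ⟨i, Finset.mem_insert_of_mem i.2⟩ x = β i (α' x)) :
    IsBicartesian α'' (LinearMap.pi β') (LinearMap.pi fun i : ↥(insert j s) => γ i)
      (LinearMap.pi fun i : ↥(insert j s) => δ i ∘ₗ LinearMap.proj i) where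
  comm x := by
    refine funext <| forall_coe_insert ?_ fun i => ?_
    · exact (congrArg (γ j) (hα x)).trans ((hγ _).symm.trans (hj.comm x))
    · exact (congrArg (γ i) (hα x)).trans
        ((congrFun (h.comm (α' x)) i).trans (congrArg (δ i) (hβ i x).symm))
  eq_zero x hx hx' := by
    refine hj.eq_zero x (h.eq_zero _ ?_ (funext fun i => ?_)) (congrFun hx' ⟨j, _⟩)
    · rw [← hα, hx]
    · exact (hβ i x).symm.trans (congrFun hx' ⟨i, _⟩)
  exists_lift y z hyz := by
    obtain ⟨x, rfl, hx⟩ := h.exists_lift y (fun i : s => z ⟨i, Finset.mem_insert_of_mem i.2⟩)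
      (funext fun i => congrFun hyz ⟨i, _⟩)
    obtain ⟨x', rfl, hx'⟩ := hj.exists_lift x (z ⟨j, _⟩) ((hγ x).trans (congrFun hyz ⟨j, _⟩))
    exact ⟨x', hα x', funext <| forall_coe_insert hx' fun i => (hβ i x').trans (congrFun hx i)⟩
  exists_add w := by
    obtain ⟨y, z, hyz⟩ := h.exists_add fun i : s => w ⟨i, Finset.mem_insert_of_mem i.2⟩
    obtain ⟨x, z', hxz'⟩ := hj.exists_add (w ⟨j, s.mem_insert_self j⟩ - γ j y)
    have hw : ∀ i : ↥(insert j s), ∃ v, γ i (y + α x) + δ i v = w i := by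
      refine forall_coe_insert ⟨z', ?_⟩ fun i => ⟨z i - β i x, ?_⟩
      · rw [map_add, ← hγ, add_assoc, hxz', add_sub_cancel]
      · have hx : γ i (α x) = δ i (β i x) := congrFun (h.comm x) i
        have hy : γ i y + δ i (z i) = w ⟨i, _⟩ := congrFun hyz i
        rw [map_add, map_sub, hx, ← hy]
        abel
    choose v hv using hw
    exact ⟨y + α x, v, funext hv⟩

theorem IsBicartesian.of_univ [Fintype ι] {α : X →ₗ[K] Y} {β : ∀ i, X →ₗ[K] Z i}
    (h : IsBicartesian α (LinearMap.pi fun i : (Finset.univ : Finset ι) => β i)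
      (LinearMap.pi fun i : (Finset.univ : Finset ι) => γ i)
      (LinearMap.pi fun i : (Finset.univ : Finset ι) => δ i ∘ₗ LinearMap.proj i)) :
    IsBicartesian α (LinearMap.pi β) (LinearMap.pi γ)
      (LinearMap.pi fun i => δ i ∘ₗ LinearMap.proj i) where
  comm x := funext fun i => congrFun (h.comm x) ⟨i, Finset.mem_univ i⟩
  eq_zero x hx hx' := h.eq_zero x hx (funext fun i => congrFun hx' i)
  exists_lift y z hyz :=
    (h.exists_lift y (fun i => z i) (funext fun i => congrFun hyz i)).imp fun _ hx =>
      ⟨hx.1, funext fun i => congrFun hx.2 ⟨i, Finset.mem_univ i⟩⟩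
  exists_add w := by
    obtain ⟨y, z, hyz⟩ := h.exists_add fun i => w i
    exact ⟨y, fun i => z ⟨i, Finset.mem_univ i⟩, funext fun i => congrFun hyz ⟨i, _⟩⟩

end Paste

section Relaxations

variable {E : Type} {r k : ℕ} {ι : Type} [DecidableEq ι] {R : Finset ι → MatroidOn E}
  {F : ι → Set E} {L P : ι → MatroidOn E}
  (h : ∀ s i, i ∉ s → IsRelaxationSquare r k (F i) (R s) (R (insert i s)) (L i) (P i))
include h

theorem basePolytope_empty_subset_of_isRelaxationSquare (s : Finset ι) :
    basePolytope (R ∅) ⊆ basePolytope (R s) := by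
  induction s using Finset.induction_on with
  | empty => exact subset_rfl
  | insert i s hi ih => exact ih.trans (h s i hi).lower_subset

theorem basePolytope_upper_subset_of_isRelaxationSquare {s : Finset ι} {i : ι} (hi : i ∈ s) :
    basePolytope (L i) ⊆ basePolytope (R s) := by
  have := (h (s.erase i) i (Finset.notMem_erase i s)).upper_subset
  rwa [Finset.insert_erase hi] at this

variable [Finite E] {A : Type} {Φ : MatroidCat ⥤ GrVect A} (hΦ : IsValuative Φ) (a : A)
include hΦ

theorem isBicartesian_of_isRelaxationSquare (s : Finset ι) :
    IsBicartesian
      (pieceMap Φ a (iota (basePolytope_empty_subset_of_isRelaxationSquare h s)))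
      (LinearMap.pi fun i : s =>
        pieceMap Φ a (iota (basePolytope_upper_subset_of_isRelaxationSquare h i.2)))
      (LinearMap.pi fun i : s => pieceMap Φ a (iota (h ∅ i (by simp)).wall_subset_lower))
      (LinearMap.pi fun i : s =>
        pieceMap Φ a (iota (h ∅ i (by simp)).wall_subset_upper) ∘ₗ LinearMap.proj i) := by
  induction s using Finset.induction_on with
  | empty => exact isBicartesian_pi_of_isEmpty (bijective_pieceMap_iota Φ a _ rfl)
  | insert j s hj ih =>
    refine IsBicartesian.pi_insert (Z := fun i => piece Φ a ⟨E, L i⟩)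
      (W := fun i => piece Φ a ⟨E, P i⟩)
      (γ := fun i => pieceMap Φ a (iota (h ∅ i (by simp)).wall_subset_lower))
      (δ := fun i => pieceMap Φ a (iota (h ∅ i (by simp)).wall_subset_upper))
      (β' := fun i : ↥(insert j s) =>
        pieceMap Φ a (iota (basePolytope_upper_subset_of_isRelaxationSquare h i.2)))
      ih ((h s j hj).isBicartesian hΦ a) ?_ ?_ fun i => ?_
    all_goals exact fun x => (pieceMap_iota_comp Φ a _ _ x).symm

theorem isBicartesian_of_isRelaxationSquare_univ [Fintype ι] {M M' : MatroidOn E} (hM : M = R ∅)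
    (hM' : M' = R Finset.univ) (h₁ : basePolytope M ⊆ basePolytope M')
    (h₂ : ∀ i, basePolytope (L i) ⊆ basePolytope M')
    (h₃ : ∀ i, basePolytope (P i) ⊆ basePolytope M)
    (h₄ : ∀ i, basePolytope (P i) ⊆ basePolytope (L i)) :
    IsBicartesian (pieceMap Φ a (iota h₁)) (LinearMap.pi fun i => pieceMap Φ a (iota (h₂ i)))
      (LinearMap.pi fun i => pieceMap Φ a (iota (h₃ i)))
      (LinearMap.pi fun i => pieceMap Φ a (iota (h₄ i)) ∘ₗ LinearMap.proj i) := by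
  subst hM hM'
  exact (isBicartesian_of_isRelaxationSquare h hΦ a Finset.univ).of_univ
    (β := fun i => pieceMap Φ a (iota (h₂ i))) (γ := fun i => pieceMap Φ a (iota (h₃ i)))
    (δ := fun i => pieceMap Φ a (iota (h₄ i)))

end Relaxations

end Iteration

/-! ### Relaxations at stressed flats -/

section Stressed

variable {E : Type} [Finite E] {M : MatroidOn E} {F : Set E} {r k : ℕ}

theorem encard_eq_natCast_iff {X : Set E} {n : ℕ} : X.encard = n ↔ X.ncard = n := by
  rw [← X.toFinite.cast_ncard_eq, Nat.cast_inj]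

theorem uniform_isBase_iff {d : ℕ} {S B : Set E} (hd : d ≤ S.ncard) :
    (uniform d S).IsBase B ↔ B ⊆ S ∧ B.ncard = d := by
  refine ⟨fun hB => ?_, fun ⟨hBS, hBd⟩ => ?_⟩
  · obtain ⟨hBS, hBd⟩ := uniform_indep.1 hB.indep
    refine ⟨hBS, hBd.antisymm (not_lt.1 fun hlt => ?_)⟩
    obtain ⟨e, he, heB⟩ := Set.exists_mem_notMem_of_ncard_lt_ncard (hlt.trans_le hd) B.toFinite
    refine hB.insert_dep ⟨he, heB⟩ |>.not_indep <| uniform_indep.2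
      ⟨Set.insert_subset he hBS, (Set.ncard_insert_of_notMem heB).trans_le hlt⟩
  · exact (uniform_indep.2 ⟨hBS, hBd.le⟩).isBase_of_maximal fun J hJ hBJ =>
      Set.eq_of_subset_of_ncard_le hBJ ((uniform_indep.1 hJ).2.trans hBd.ge) J.toFinite

omit [Finite E] in
theorem MatroidOn.exists_isBase_inter (N : MatroidOn E) (X : Set E) :
    ∃ B, N.toMatroid.IsBase B ∧ (B ∩ X).encard = N.toMatroid.eRk X := by
  obtain ⟨I, hI⟩ := N.toMatroid.exists_isBasis X (N.ground_eq ▸ X.subset_univ)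
  obtain ⟨B, hB, hIB⟩ := hI.indep.exists_isBase_superset
  refine ⟨B, hB, ?_⟩
  rw [← hI.encard_eq_eRk, hI.eq_of_subset_indep (hB.indep.inter_right X)
    (Set.subset_inter hIB hI.subset) Set.inter_subset_right]

section PiMatroid

variable (h₀ : ∃ B : Set E, B.ncard = k ∧ (B ∩ F).ncard = r)
include h₀

theorem piMatroid_isBase_iff {B : Set E} :
    (piMatroid r k F).toMatroid.IsBase B ↔ B.ncard = k ∧ (B ∩ F).ncard = r := by
  have hsplit (X : Set E) : (X ∩ F).ncard + (X ∩ Fᶜ).ncard = X.ncard :=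
    Set.ncard_inter_add_ncard_sdiff_eq_ncard X F X.toFinite
  obtain ⟨B₀, hk₀, hr₀⟩ := h₀
  have hF : r ≤ F.ncard := hr₀ ▸ Set.ncard_le_ncard Set.inter_subset_right
  have hFc : k - r = (B₀ ∩ Fᶜ).ncard := by have := hsplit B₀; omega
  rw [piMatroid, Matroid.disjointSum_isBase_iff, uniform_ground, uniform_ground,
    uniform_isBase_iff hF, uniform_isBase_iff (hFc ▸ Set.ncard_le_ncard Set.inter_subset_right),
    Set.compl_union_self, and_iff_right Set.inter_subset_right,
    and_iff_right Set.inter_subset_right, and_iff_left B.subset_univ]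
  have := hsplit B
  have := hsplit B₀
  omega

theorem eRank_piMatroid : (piMatroid r k F).toMatroid.eRank = k := by
  obtain ⟨B, hB⟩ := (piMatroid r k F).toMatroid.exists_isBase
  rw [← hB.encard_eq_eRank, encard_eq_natCast_iff, ((piMatroid_isBase_iff h₀).1 hB).1]

theorem eRk_piMatroid : (piMatroid r k F).toMatroid.eRk F = r := by
  obtain ⟨B, hB, hBF⟩ := (piMatroid r k F).exists_isBase_inter F
  rw [← hBF, encard_eq_natCast_iff, ((piMatroid_isBase_iff h₀).1 hB).2]

end PiMatroid

theorem relax_isBase_iff {𝓕 : Set (Set E)} (h𝓕 : ∀ F ∈ 𝓕, IsStressedFlat M F) {B : Set E} :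
    (relax M 𝓕 h𝓕).toMatroid.IsBase B ↔
      M.toMatroid.IsBase B ∨ ∃ F ∈ 𝓕, B ∈ cusp M F := Iff.rfl

section Rank

variable (hr : M.toMatroid.eRk F = r) (hk : M.toMatroid.eRank = k)
include hr hk

theorem mem_cusp_iff {C : Set E} :
    C ∈ cusp M F ↔ C.ncard = k ∧ (C ∩ F).ncard = r + 1 := by
  rw [cusp, Set.mem_ofPred_eq, hr, hk, ← Nat.cast_succ, encard_eq_natCast_iff,
    encard_eq_natCast_iff]

theorem exists_ncard_inter_eq : ∃ B : Set E, B.ncard = k ∧ (B ∩ F).ncard = r := by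
  obtain ⟨B, hB, hBF⟩ := M.exists_isBase_inter F
  exact ⟨B, encard_eq_natCast_iff.1 (hB.encard_eq_eRank.trans hk),
    encard_eq_natCast_iff.1 (hBF.trans hr)⟩

theorem lambdaMatroid_isBase_iff (hF : IsStressedFlat (piMatroid r k F) F) {B : Set E} :
    (lambdaMatroid r k F hF).toMatroid.IsBase B ↔
      B.ncard = k ∧ ((B ∩ F).ncard = r ∨ (B ∩ F).ncard = r + 1) := by
  have h₀ := exists_ncard_inter_eq hr hk
  rw [lambdaMatroid, relax_isBase_iff, piMatroid_isBase_iff h₀, and_or_left,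
    ← mem_cusp_iff (eRk_piMatroid h₀) (eRank_piMatroid h₀)]
  simp only [Set.mem_singleton_iff, exists_eq_left]

theorem IsStressedFlat.isBase_of_ncard (hF : IsStressedFlat M F) {B : Set E} (hB : B.ncard = k)
    (hBF : (B ∩ F).ncard = r) : M.toMatroid.IsBase B := by
  rw [← encard_eq_natCast_iff] at hB hBF
  have hi : M.toMatroid.Indep (B ∩ F) :=
    hF.indep_of_subset Set.inter_subset_right (by rw [hr, hBF])
  have hbasis : M.toMatroid.IsBasis (B ∩ F) F :=
    hi.isBasis_of_eRk_ge (Set.toFinite _) Set.inter_subset_right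
      (by rw [hi.eRk_eq_encard, hBF, hr]) (M.ground_eq ▸ F.subset_univ)
  have hindep := hF.indep_union (J := B \ F) hbasis Set.disjoint_sdiff_right (by
    rw [hr, ← hBF, Set.encard_sdiff_add_encard_inter, hB, hk])
  rw [Set.sdiff_union_inter] at hindep
  exact hindep.isBase_of_eRk_ge B.toFinite (by rw [hindep.eRk_eq_encard, hB, hk])

theorem isRelaxationSquare_relax (hF : IsStressedFlat M F) {𝓕 𝓖 : Set (Set E)}
    (h𝓕 : ∀ G ∈ 𝓕, IsStressedFlat M G) (h𝓖 : ∀ G ∈ 𝓖, IsStressedFlat M G) (hF𝓕 : F ∉ 𝓕)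
    (h𝓖𝓕 : 𝓖 = insert F 𝓕) : IsRelaxationSquare r k F (relax M 𝓕 h𝓕) (relax M 𝓖 h𝓖)
      (lambdaMatroid r k F (hF.piMatroid hr hk)) (piMatroid r k F) where
  ncard_eq B hB := by
    rw [← encard_eq_natCast_iff, ← hk]
    exact hB.elim (·.encard_eq_eRank) fun ⟨_, _, hcusp⟩ => hcusp.1
  inter_le B hB := by
    rw [← Nat.cast_le (α := ℕ∞), (B ∩ F).toFinite.cast_ncard_eq, ← hr]
    obtain hB | ⟨G, hG, hcusp⟩ := hB
    · exact (hB.indep.inter_right F).encard_le_eRk_of_subset Set.inter_subset_right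
    -- distinct stressed flats have disjoint cusps
    · refine not_lt.1 fun hlt => hF𝓕 ?_
      exact hF.eq_of_cusp (h𝓕 G hG) hcusp.1 (Order.add_one_le_of_lt hlt) hcusp.2.ge ▸ hG
  isBase_of_eq B hB hBF := Or.inl (hF.isBase_of_ncard hr hk hB hBF)
  isBase_relaxation_iff B := by
    subst h𝓖𝓕
    rw [relax_isBase_iff, relax_isBase_iff, ← mem_cusp_iff hr hk, or_assoc,
      or_comm (b := B ∈ cusp M F)]
    simp only [Set.mem_insert_iff, exists_eq_or_imp]
  isBase_wall_iff _ := piMatroid_isBase_iff (exists_ncard_inter_eq hr hk)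
  isBase_upper_iff _ := lambdaMatroid_isBase_iff hr hk _

end Rank

end Stressed

/-! ### Relations in the Grothendieck group -/

section Classes

theorem SplitK₀.mk_pt {C : Type*} [Category C] [HasZeroMorphisms C] {X Y : C}
    (b : BinaryBicone X Y) (hb : b.IsBilimit) :
    SplitK₀.mk b.pt = SplitK₀.mk X + SplitK₀.mk Y := by
  have h : (QuotientAddGroup.mk (FreeAbelianGroup.of b.pt - FreeAbelianGroup.of X -
      FreeAbelianGroup.of Y) : SplitK₀ C) = 0 :=
    (QuotientAddGroup.eq_zero_iff _).2 (AddSubgroup.subset_closure ⟨X, Y, b, ⟨hb⟩, rfl⟩)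
  rw [QuotientAddGroup.mk_sub, QuotientAddGroup.mk_sub, sub_sub, sub_eq_zero] at h
  exact h

variable {A Γ : Type} [Group Γ]

theorem mk_eq_add_of_splitting {X T W : GrRep A Γ} {f : ∀ a, X.obj a ⟶ T.obj a}
    {g : ∀ a, T.obj a ⟶ W.obj a} {hfg : ∀ a, f a ≫ g a = 0}
    (S : ∀ a, (ShortComplex.mk (f a) (g a) (hfg a)).Splitting) :
    (SplitK₀.mk T : VirtualGrRep A Γ) = SplitK₀.mk X + SplitK₀.mk W :=
  SplitK₀.mk_pt
    { pt := T
      fst := ObjectProperty.homMk fun a => (S a).r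
      snd := ObjectProperty.homMk g
      inl := ObjectProperty.homMk f
      inr := ObjectProperty.homMk fun a => (S a).s
      inl_fst := ObjectProperty.hom_ext _ (funext fun a => (S a).f_r)
      inl_snd := ObjectProperty.hom_ext _ (funext hfg)
      inr_fst := ObjectProperty.hom_ext _ (funext fun a => (S a).s_r)
      inr_snd := ObjectProperty.hom_ext _ (funext fun a => (S a).s_g) }
    (isBinaryBilimitOfTotal _ (ObjectProperty.hom_ext _ (funext fun a => (S a).id)))

/-- The direct sum of two graded representations. -/
def prodGr (X Y : GrRep A Γ) : GrRep A Γ :=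
  ⟨fun a => Rep.of ((X.obj a).ρ.prod (Y.obj a).ρ), fun a => by
    have := X.property.1 a
    have := Y.property.1 a
    exact inferInstanceAs (Module.Finite ℚ ((X.obj a).V × (Y.obj a).V)), by
    refine (X.property.2.union Y.property.2).subset fun a (ha : Nontrivial (_ × _)) => ?_
    by_contra hXY
    rw [Set.mem_union, not_or] at hXY
    have : Subsingleton (X.obj a).V := not_nontrivial_iff_subsingleton.1 hXY.1
    have : Subsingleton (Y.obj a).V := not_nontrivial_iff_subsingleton.1 hXY.2
    exact not_subsingleton ((X.obj a).V × (Y.obj a).V) inferInstance⟩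

theorem mk_prodGr (X Y : GrRep A Γ) :
    (SplitK₀.mk (prodGr X Y) : VirtualGrRep A Γ) = SplitK₀.mk X + SplitK₀.mk Y :=
  mk_eq_add_of_splitting (T := prodGr X Y)
    (f := fun a => Rep.ofHom (.inl ℚ (X.obj a).ρ (Y.obj a).ρ))
    (g := fun a => Rep.ofHom (.snd ℚ (X.obj a).ρ (Y.obj a).ρ))
    (hfg := fun _ => Rep.hom_ext (Representation.IntertwiningMap.snd_comp_inl))
    fun a =>
      { r := Rep.ofHom (.fst ℚ (X.obj a).ρ (Y.obj a).ρ)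
        s := Rep.ofHom (.inr ℚ (X.obj a).ρ (Y.obj a).ρ)
        f_r := Rep.hom_ext Representation.IntertwiningMap.fst_comp_inl
        s_g := Rep.hom_ext Representation.IntertwiningMap.snd_comp_inr
        id := Rep.hom_ext Representation.IntertwiningMap.coprod_inl_inr }

/-- The Mayer–Vietoris sequence `X → Y × Z → W` of a commutative square of representations. -/
def mayerVietoris {X Y Z W : Rep.{0} ℚ Γ} (α : X ⟶ Y) (β : X ⟶ Z) (γ : Y ⟶ W) (δ : Z ⟶ W)
    (h : α ≫ γ = β ≫ δ) : ShortComplex (Rep.{0} ℚ Γ) where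
  X₁ := X
  X₂ := Rep.of (Y.ρ.prod Z.ρ)
  X₃ := W
  f := Rep.ofHom (α.hom.prod β.hom)
  g := Rep.ofHom (γ.hom.comp (.fst ℚ Y.ρ Z.ρ) - δ.hom.comp (.snd ℚ Y.ρ Z.ρ))
  zero := by
    ext x
    exact sub_eq_zero.2 (congrArg (fun f : X ⟶ W => f.hom x) h)

theorem shortExact_mayerVietoris {X Y Z W : Rep.{0} ℚ Γ} {α : X ⟶ Y} {β : X ⟶ Z} {γ : Y ⟶ W}
    {δ : Z ⟶ W} (h : α ≫ γ = β ≫ δ)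
    (hb : IsBicartesian α.hom.toLinearMap β.hom.toLinearMap γ.hom.toLinearMap δ.hom.toLinearMap) :
    (mayerVietoris α β γ δ h).ShortExact where
  exact := by
    rw [← ShortComplex.exact_map_iff_of_faithful _ (forget₂ (Rep ℚ Γ) (ModuleCat ℚ)),
      ShortComplex.moduleCat_exact_iff]
    rintro ⟨y, z⟩ hyz
    obtain ⟨x, hy, hz⟩ := hb.exists_lift y z (sub_eq_zero.1 hyz)
    exact ⟨x, Prod.ext hy hz⟩
  mono_f := by
    refine (Rep.mono_iff_injective _).2 ((injective_iff_map_eq_zero _).2 fun x hx => ?_)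
    exact hb.eq_zero x (congrArg Prod.fst hx) (congrArg Prod.snd hx)
  epi_g := (Rep.epi_iff_surjective _).2 fun w => by
    obtain ⟨y, z, rfl⟩ := hb.exists_add w
    refine ⟨(y, -z), ?_⟩
    change γ.hom y - δ.hom (-z) = _
    rw [map_neg, sub_neg_eq_add]
    rfl

theorem mk_add_mk_of_isBicartesian [Finite Γ] {X Y Z W : GrRep A Γ} {α : ∀ a, X.obj a ⟶ Y.obj a}
    {β : ∀ a, X.obj a ⟶ Z.obj a} {γ : ∀ a, Y.obj a ⟶ W.obj a} {δ : ∀ a, Z.obj a ⟶ W.obj a}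
    (h : ∀ a, IsBicartesian (α a).hom.toLinearMap (β a).hom.toLinearMap (γ a).hom.toLinearMap
      (δ a).hom.toLinearMap) :
    (SplitK₀.mk X + SplitK₀.mk W : VirtualGrRep A Γ) = SplitK₀.mk Y + SplitK₀.mk Z := by
  have hcomm a : α a ≫ γ a = β a ≫ δ a := Rep.hom_ext (DFunLike.ext _ _ (h a).comm)
  rw [← mk_prodGr Y Z]
  exact (mk_eq_add_of_splitting (T := prodGr Y Z) fun a =>
    (shortExact_mayerVietoris (hcomm a) (h a)).splittingOfProjective).symm

end Classes

/-! ### Induced representations -/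

section Induced

variable {Γ ι : Type} [Group Γ] {H : Subgroup Γ} {τ : ι → Γ}

theorem bijective_mul_of_smul_eq [MulAction Γ ι] {i₀ : ι}
    (hH : ∀ γ, γ ∈ H ↔ γ • i₀ = i₀) (hτ : ∀ i, τ i • i = i₀) :
    Function.Bijective fun x : H × ι => (x.1 : Γ) * τ x.2 := by
  have hinv (η : H) (i : ι) : ((η : Γ) * τ i)⁻¹ • i₀ = i := by
    rw [inv_smul_eq_iff, mul_smul, hτ, (hH η).1 η.2]
  refine ⟨fun ⟨η, i⟩ ⟨η', i'⟩ h => ?_, fun γ => ?_⟩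
  · have hi : i = i' := by rw [← hinv η i, ← hinv η' i']; exact congrArg (·⁻¹ • i₀) h
    subst hi
    exact Prod.ext (Subtype.ext (mul_right_cancel h)) rfl
  · refine ⟨(⟨γ * (τ (γ⁻¹ • i₀))⁻¹, (hH _).2 ?_⟩, γ⁻¹ • i₀), inv_mul_cancel_right _ _⟩
    rw [mul_smul, inv_smul_eq_iff.2 (hτ _).symm, smul_inv_smul]

theorem bijective_coindV_eval {K V : Type*} [CommSemiring K] [AddCommMonoid V] [Module K V]
    (hτ : Function.Bijective fun x : H × ι => (x.1 : Γ) * τ x.2) (ρ : Representation K H V) :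
    Function.Bijective fun (f : Representation.coindV H.subtype ρ) i => f.1 (τ i) := by
  refine ⟨fun f f' h => Subtype.ext (funext fun g => ?_), fun v => ?_⟩
  · obtain ⟨⟨η, i⟩, rfl⟩ := hτ.2 g
    exact (f.2 η (τ i)).trans ((congrArg (ρ η) (congrFun h i)).trans (f'.2 η (τ i)).symm)
  · let e := Equiv.ofBijective _ hτ
    have he (η : H) (g : Γ) : e.symm (η * g) = (η * (e.symm g).1, (e.symm g).2) := by
      refine e.symm_apply_eq.2 (Eq.trans ?_ (mul_assoc (η : Γ) (e.symm g).1 _).symm)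
      exact congrArg ((η : Γ) * ·) (e.apply_symm_apply g).symm
    refine ⟨⟨fun g => ρ (e.symm g).1 (v (e.symm g).2), fun η g => ?_⟩, funext fun i => ?_⟩
    · change ρ (e.symm (η * g)).1 (v (e.symm (η * g)).2) = _
      rw [he, map_mul, Module.End.mul_apply]
    · have : e.symm (τ i) = (1, i) := e.symm_apply_eq.2 (one_mul (τ i)).symm
      change ρ (e.symm (τ i)).1 (v (e.symm (τ i)).2) = v i
      rw [this, map_one, Module.End.one_apply]

/-- Evaluation of functions in a coinduced representation at coset representatives. -/
def coindVEquivPi {K V : Type*} [CommSemiring K] [AddCommMonoid V] [Module K V]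
    (hτ : Function.Bijective fun x : H × ι => (x.1 : Γ) * τ x.2) (ρ : Representation K H V) :
    Representation.coindV H.subtype ρ ≃ₗ[K] (ι → V) :=
  .ofBijective (LinearMap.funLeft K V τ ∘ₗ Submodule.subtype _) (bijective_coindV_eval hτ ρ)

variable [Finite Γ]

/-- The identification of induced with coinduced representations of a finite group. -/
def coindIsoInd (L : Rep.{0} ℚ H) : Rep.coind H.subtype L ≅ Rep.ind H.subtype L :=
  open scoped Classical in (Rep.indCoindIso L).symm

theorem isBicartesian_ind (hτ : Function.Bijective fun x : H × ι => (x.1 : Γ) * τ x.2)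
    {X Y : Rep.{0} ℚ Γ} {L P : Rep.{0} ℚ H} (α : X ⟶ Y) (β : Rep.res H.subtype X ⟶ L)
    (γ : Rep.res H.subtype Y ⟶ P) (δ : L ⟶ P)
    (h : IsBicartesian α.hom.toLinearMap
      (LinearMap.pi fun i => β.hom.toLinearMap ∘ₗ X.ρ (τ i))
      (LinearMap.pi fun i => γ.hom.toLinearMap ∘ₗ Y.ρ (τ i))
      (LinearMap.pi fun i => δ.hom.toLinearMap ∘ₗ LinearMap.proj i)) :
    IsBicartesian α.hom.toLinearMap
      (Rep.resCoindToHom H.subtype X L β ≫ (coindIsoInd L).hom).hom.toLinearMap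
      (Rep.resCoindToHom H.subtype Y P γ ≫ (coindIsoInd P).hom).hom.toLinearMap
      ((coindIsoInd L).inv ≫ Rep.coindMap H.subtype δ ≫ (coindIsoInd P).hom).hom.toLinearMap := by
  let ind (L : Rep.{0} ℚ H) : Rep.coind H.subtype L ≃ₗ[ℚ] Rep.ind H.subtype L :=
    (Representation.equivOfIso (coindIsoInd L)).toLinearEquiv
  refine h.congr ((coindVEquivPi hτ L.ρ).symm ≪≫ₗ ind L) ((coindVEquivPi hτ P.ρ).symm ≪≫ₗ ind P)
    (fun x => congrArg (ind L) ?_) (fun y => congrArg (ind P) ?_) fun z => ?_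
  · exact (LinearEquiv.symm_apply_eq _).2 rfl
  · exact (LinearEquiv.symm_apply_eq _).2 rfl
  · obtain ⟨f, rfl⟩ := (coindVEquivPi hτ L.ρ).surjective z
    rw [LinearEquiv.trans_apply, LinearEquiv.trans_apply, LinearEquiv.symm_apply_apply]
    refine congrArg (ind P) (Eq.trans ?_ (congrArg (Rep.coindMap H.subtype δ).hom
      (Rep.inv_hom_apply _ _ (coindIsoInd L) f)).symm)
    exact (LinearEquiv.symm_apply_eq _).2 rfl

end Induced

/-! ### Families of matroids permuted by a group -/

section Family

variable {E A Γ ι : Type} [Group Γ] [MulAction Γ E]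

theorem basePolytope_subset_permute {X Y : MatroidOn E} (γ : Γ)
    (h : ∀ B, Y.toMatroid.IsBase B → X.toMatroid.IsBase (γ⁻¹ • B)) :
    basePolytope Y ⊆ permute (MulAction.toPerm γ) '' basePolytope X := by
  rw [basePolytope, basePolytope, LinearMap.image_convexHull]
  refine convexHull_mono ?_
  rintro _ ⟨B, hB, rfl⟩
  refine ⟨(γ⁻¹ • B).indicator 1, ⟨γ⁻¹ • B, h B hB, rfl⟩, funext fun x => ?_⟩
  change (γ⁻¹ • B).indicator 1 (γ⁻¹ • x) = B.indicator 1 x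
  by_cases hx : x ∈ B <;> simp [hx]

variable (Γ) in
/-- A family of matroids on `E` with `N (γ i) = γ (N i)`. -/
def IsEquivariantFamily [MulAction Γ ι] (N : ι → MatroidOn E) : Prop :=
  ∀ (γ : Γ) (i j : ι), γ • i = j →
    ∀ B, (N j).toMatroid.IsBase B → (N i).toMatroid.IsBase (γ⁻¹ • B)

theorem isInvariant_subgroup {N : MatroidOn E} (hN : IsInvariant Γ N) (H : Subgroup Γ) :
    IsInvariant H N :=
  fun γ => hN γ

variable [Finite E]

/-- The morphism `(E, X) → (E, Y)` of `𝓜` given by the action of a group element on `E`. -/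
def translate {X Y : MatroidOn E} (γ : Γ)
    (h : ∀ B, Y.toMatroid.IsBase B → X.toMatroid.IsBase (γ⁻¹ • B)) :
    MatroidCat.mk E X ⟶ MatroidCat.mk E Y :=
  ⟨MulAction.toPerm γ, basePolytope_subset_permute γ h⟩

variable (Φ : MatroidCat ⥤ GrVect A) (a : A)

theorem pieceMap_comm {X Y Y' Z : MatroidCat} {f : X ⟶ Y} {g : Y ⟶ Z} {f' : X ⟶ Y'} {g' : Y' ⟶ Z}
    (h : f ≫ g = f' ≫ g') (x : piece Φ a X) :
    pieceMap Φ a g (pieceMap Φ a f x) = pieceMap Φ a g' (pieceMap Φ a f' x) := by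
  rw [← pieceMap_comp, h, pieceMap_comp]

/-- An isomorphism of `𝓜`, seen through a functor in a fixed degree. -/
def pieceEquiv {X Y : MatroidCat} (e : X ≅ Y) : piece Φ a X ≃ₗ[ℚ] piece Φ a Y :=
  .ofLinearMap (pieceMap Φ a e.hom) (pieceMap Φ a e.inv)
    (LinearMap.ext fun x => by
      rw [LinearMap.comp_apply, ← pieceMap_comp, e.inv_hom_id, pieceMap_id])
    (LinearMap.ext fun x => by
      rw [LinearMap.comp_apply, ← pieceMap_comp, e.hom_inv_id, pieceMap_id])

/-- The members of an equivariant family at `i` and at `γ i` are isomorphic. -/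
def IsEquivariantFamily.iso [MulAction Γ ι] {N : ι → MatroidOn E} (hN : IsEquivariantFamily Γ N)
    (γ : Γ) {i j : ι} (h : γ • i = j) : MatroidCat.mk E (N i) ≅ MatroidCat.mk E (N j) where
  hom := translate γ (hN γ i j h)
  inv := translate γ⁻¹ (hN γ⁻¹ j i (inv_smul_eq_iff.2 h.symm))
  hom_inv_id := MatroidCat.Hom.ext (Equiv.ext fun x => inv_smul_smul γ x)
  inv_hom_id := MatroidCat.Hom.ext (Equiv.ext fun x => smul_inv_smul γ x)

/-- The homomorphism of representations given by an inclusion of invariant base polytopes. -/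
def iotaRep {X Y : MatroidOn E} (hX : IsInvariant Γ X) (hY : IsInvariant Γ Y)
    (h : basePolytope Y ⊆ basePolytope X) : (repOf Φ hX).obj a ⟶ (repOf Φ hY).obj a :=
  Rep.ofHom ⟨pieceMap Φ a (iota h), fun γ => LinearMap.ext fun x =>
    pieceMap_comm Φ a (f := hX.aut γ) (g' := hY.aut γ) (MatroidCat.Hom.ext rfl) x⟩

variable [MulAction Γ ι] {M M' : MatroidOn E} (hM : IsInvariant Γ M) (hM' : IsInvariant Γ M')
  {L P : ι → MatroidOn E} (hL : IsEquivariantFamily Γ L) (hP : IsEquivariantFamily Γ P)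
  {H : Subgroup Γ} {i₀ : ι} (hLH : IsInvariant H (L i₀)) (hPH : IsInvariant H (P i₀))
  {h₁ : basePolytope M ⊆ basePolytope M'} {h₂ : ∀ i, basePolytope (L i) ⊆ basePolytope M'}
  {h₃ : ∀ i, basePolytope (P i) ⊆ basePolytope M}
  {h₄ : ∀ i, basePolytope (P i) ⊆ basePolytope (L i)}
include hL hP

theorem isBicartesian_translate {τ : ι → Γ} (hτ : ∀ i, τ i • i = i₀)
    (h : IsBicartesian (pieceMap Φ a (iota h₁))
      (LinearMap.pi fun i => pieceMap Φ a (iota (h₂ i)))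
      (LinearMap.pi fun i => pieceMap Φ a (iota (h₃ i)))
      (LinearMap.pi fun i => pieceMap Φ a (iota (h₄ i)) ∘ₗ LinearMap.proj i)) :
    IsBicartesian (pieceMap Φ a (iota h₁))
      (LinearMap.pi fun i => pieceMap Φ a (iota (h₂ i₀)) ∘ₗ pieceMap Φ a (hM'.aut (τ i)))
      (LinearMap.pi fun i => pieceMap Φ a (iota (h₃ i₀)) ∘ₗ pieceMap Φ a (hM.aut (τ i)))
      (LinearMap.pi fun i => pieceMap Φ a (iota (h₄ i₀)) ∘ₗ LinearMap.proj i) :=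
  h.congr (.piCongrRight fun i => pieceEquiv Φ a (hL.iso (τ i) (hτ i)))
    (.piCongrRight fun i => pieceEquiv Φ a (hP.iso (τ i) (hτ i)))
    (fun x => funext fun i => pieceMap_comm Φ a (f := iota (h₂ i)) (g' := iota (h₂ i₀))
      (MatroidCat.Hom.ext rfl) x)
    (fun y => funext fun i => pieceMap_comm Φ a (f := iota (h₃ i)) (g' := iota (h₃ i₀))
      (MatroidCat.Hom.ext rfl) y)
    (fun z => funext fun i => pieceMap_comm Φ a (f := iota (h₄ i)) (g' := iota (h₄ i₀))
      (MatroidCat.Hom.ext rfl) (z i))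

theorem mk_add_mk_of_equivariantFamily [Finite Γ] [MulAction.IsPretransitive Γ ι]
    (hH : ∀ γ, γ ∈ H ↔ γ • i₀ = i₀)
    (h : ∀ a, IsBicartesian (pieceMap Φ a (iota h₁))
      (LinearMap.pi fun i => pieceMap Φ a (iota (h₂ i)))
      (LinearMap.pi fun i => pieceMap Φ a (iota (h₃ i)))
      (LinearMap.pi fun i => pieceMap Φ a (iota (h₄ i)) ∘ₗ LinearMap.proj i)) :
    (SplitK₀.mk (repOf Φ hM') + SplitK₀.mk (indGr H (repOf Φ hPH)) : VirtualGrRep A Γ) =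
      SplitK₀.mk (repOf Φ hM) + SplitK₀.mk (indGr H (repOf Φ hLH)) := by
  choose τ hτ using fun i => MulAction.exists_smul_eq Γ i i₀
  exact mk_add_mk_of_isBicartesian (X := repOf Φ hM') (Y := repOf Φ hM)
    (Z := indGr H (repOf Φ hLH)) (W := indGr H (repOf Φ hPH)) fun a =>
    isBicartesian_ind (bijective_mul_of_smul_eq hH hτ) (iotaRep Φ a hM' hM h₁)
      (iotaRep Φ a (isInvariant_subgroup hM' H) hLH (h₂ i₀))
      (iotaRep Φ a (isInvariant_subgroup hM H) hPH (h₃ i₀)) (iotaRep Φ a hLH hPH (h₄ i₀))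
      (isBicartesian_translate Φ a hM hM' hL hP hτ (h a))

end Family

/-! ### Relaxations along an orbit -/

section Orbit

variable {E : Type} [Finite E] {M : MatroidOn E} {r k : ℕ}

section Subset

variable {F : Set E} {𝓕 : Set (Set E)}

theorem basePolytope_subset_relax (h𝓕 : ∀ F ∈ 𝓕, IsStressedFlat M F) :
    basePolytope M ⊆ basePolytope (relax M 𝓕 h𝓕) :=
  basePolytope_mono fun _ => Or.inl

variable (hr : M.toMatroid.eRk F = r) (hk : M.toMatroid.eRank = k)
include hr hk

theorem basePolytope_piMatroid_subset (hF : IsStressedFlat M F) :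
    basePolytope (piMatroid r k F) ⊆ basePolytope M := by
  refine basePolytope_mono fun B hB => ?_
  obtain ⟨hBk, hBr⟩ := (piMatroid_isBase_iff (exists_ncard_inter_eq hr hk)).1 hB
  exact hF.isBase_of_ncard hr hk hBk hBr

theorem basePolytope_lambdaMatroid_subset_relax (h𝓕 : ∀ F ∈ 𝓕, IsStressedFlat M F) (hF : F ∈ 𝓕) :
    basePolytope (lambdaMatroid r k F ((h𝓕 F hF).piMatroid hr hk)) ⊆
      basePolytope (relax M 𝓕 h𝓕) := by
  refine basePolytope_mono fun B hB => ?_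
  obtain ⟨hBk, hBr | hBr⟩ := (lambdaMatroid_isBase_iff hr hk _).1 hB
  · exact Or.inl ((h𝓕 F hF).isBase_of_ncard hr hk hBk hBr)
  · exact Or.inr ⟨F, hF, (mem_cusp_iff hr hk).2 ⟨hBk, hBr⟩⟩

end Subset

variable {ι : Type} {F : ι → Set E} (hF : ∀ i, IsStressedFlat M (F i))

/-- The relaxation of a matroid with respect to the members of a family of stressed flats with
index in a given finite set. -/
def relaxFamily (s : Finset ι) : MatroidOn E :=
  relax M (F '' s) (Set.forall_mem_image.2 fun i _ => hF i)

theorem relaxFamily_empty : relaxFamily hF ∅ = M :=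
  MatroidOn.ext_isBase fun B => (relax_isBase_iff _).trans (by simp)

theorem relaxFamily_univ [Fintype ι] {𝓕 : Set (Set E)} (h𝓕 : ∀ F ∈ 𝓕, IsStressedFlat M F)
    (h : Set.range F = 𝓕) : relaxFamily hF Finset.univ = relax M 𝓕 h𝓕 := by
  subst h
  simp only [relaxFamily, Finset.coe_univ, Set.image_univ]

variable (hr : ∀ i, M.toMatroid.eRk (F i) = r) (hk : M.toMatroid.eRank = k)

theorem isRelaxationSquare_relaxFamily [DecidableEq ι] (hinj : Function.Injective F)
    (s : Finset ι) (i : ι) (hi : i ∉ s) :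
    IsRelaxationSquare r k (F i) (relaxFamily hF s) (relaxFamily hF (insert i s))
      (lambdaMatroid r k (F i) ((hF i).piMatroid (hr i) hk)) (piMatroid r k (F i)) :=
  isRelaxationSquare_relax (hr i) hk (hF i) _ _ (by rwa [hinj.mem_set_image, Finset.mem_coe])
    (by rw [Finset.coe_insert, Set.image_insert_eq])

variable {Γ : Type} [Group Γ] [MulAction Γ E] [MulAction Γ ι]
  (hsmul : ∀ (γ : Γ) i, F (γ • i) = γ • F i)

omit [Finite E] in
theorem ncard_inv_smul_inter (γ : Γ) (B F : Set E) :
    (γ⁻¹ • B ∩ F).ncard = (B ∩ γ • F).ncard := by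
  rw [← Set.ncard_smul_set γ (γ⁻¹ • B ∩ F), Set.smul_set_inter, smul_inv_smul]

include hr hk hsmul

theorem isEquivariantFamily_piMatroid :
    IsEquivariantFamily Γ fun i => piMatroid r k (F i) := by
  rintro γ i _ rfl B hB
  rw [piMatroid_isBase_iff (exists_ncard_inter_eq (hr _) hk), hsmul] at hB
  rwa [piMatroid_isBase_iff (exists_ncard_inter_eq (hr i) hk), Set.ncard_smul_set,
    ncard_inv_smul_inter]

theorem isEquivariantFamily_lambdaMatroid :
    IsEquivariantFamily Γ fun i => lambdaMatroid r k (F i) ((hF i).piMatroid (hr i) hk) := by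
  rintro γ i _ rfl B hB
  rw [lambdaMatroid_isBase_iff (hr _) hk, hsmul] at hB
  rwa [lambdaMatroid_isBase_iff (hr i) hk, Set.ncard_smul_set, ncard_inv_smul_inter]

end Orbit

end RelaxValuative

end

open RelaxValuative in
theorem proposition9p4 {E Γ A : Type} [Finite E] [Group Γ] [Finite Γ] [MulAction Γ E]
    [AddCommGroup A]
    (M : RelaxValuative.MatroidOn E) (hM : RelaxValuative.IsInvariant Γ M)
    (F : Set E) (hF : RelaxValuative.IsStressedFlat M F) (r k : ℕ)
    (hr : M.toMatroid.eRk F = r) (hk : M.toMatroid.eRank = k)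
    (Φ : RelaxValuative.MatroidCat ⥤ RelaxValuative.GrVect A)
    (hΦ : RelaxValuative.IsValuative Φ) :
    (RelaxValuative.SplitK₀.mk
        (RelaxValuative.repOf Φ (RelaxValuative.isInvariant_relaxOrbit hM hF)) :
      RelaxValuative.VirtualGrRep A Γ) =
    RelaxValuative.SplitK₀.mk (RelaxValuative.repOf Φ hM)
    + RelaxValuative.SplitK₀.mk (RelaxValuative.indGr (MulAction.stabilizer Γ F)
        (RelaxValuative.repOf Φ
          (RelaxValuative.isInvariant_lambdaMatroid (Γ := Γ) (hF.piMatroid hr hk))))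
    - RelaxValuative.SplitK₀.mk (RelaxValuative.indGr (MulAction.stabilizer Γ F)
        (RelaxValuative.repOf Φ (RelaxValuative.isInvariant_piMatroid (Γ := Γ) r k F))) := by
  classical
  have : Fintype (MulAction.orbit Γ F) := .ofFinite _
  have horbit : ∀ G ∈ MulAction.orbit Γ F, IsStressedFlat M G ∧ M.toMatroid.eRk G = r := by
    rintro _ ⟨γ, rfl⟩
    exact ⟨hF.smul hM γ, (hM.eRk_smul γ F).trans hr⟩
  have hF' (i : MulAction.orbit Γ F) : IsStressedFlat M i.1 := (horbit i i.2).1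
  have hr' (i : MulAction.orbit Γ F) : M.toMatroid.eRk i.1 = r := (horbit i i.2).2
  have hsquare (a : A) := isBicartesian_of_isRelaxationSquare_univ
    (isRelaxationSquare_relaxFamily hF' hr' hk Subtype.val_injective) hΦ a
    (relaxFamily_empty hF').symm
    (relaxFamily_univ hF' (fun G hG => (horbit G hG).1) Subtype.range_val).symm
    (basePolytope_subset_relax _)
    (fun i => basePolytope_lambdaMatroid_subset_relax (hr' i) hk _ i.2)
    (fun i => basePolytope_piMatroid_subset (hr' i) hk (hF' i))
    (fun _ => basePolytope_subset_relax _)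
  exact eq_sub_iff_add_eq.2 <| mk_add_mk_of_equivariantFamily Φ hM (isInvariant_relaxOrbit hM hF)
    (isEquivariantFamily_lambdaMatroid hF' hr' hk fun _ _ => rfl)
    (isEquivariantFamily_piMatroid hr' hk fun _ _ => rfl)
    (i₀ := ⟨F, MulAction.mem_orbit_self F⟩) _ _
    (fun _ => ⟨fun h => Subtype.ext h, congrArg Subtype.val⟩) hsquare
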